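/- Let $\mathbb F$ be an algebraically closed field of characteristic $p\ge 0$, let $G$ be a finite group, and let $V_1,\dots,V_r$ be pairwise non-isomorphic simple $\mathbb FG$-modules (for instance, a complete set of representatives). For $m\ge 0$ let $G_m=G^m\rtimes S_m$ be the wreath product, where $S_m$ permutes the factors of $G^m$. If $L$ is an $\mathbb FS_m$-module, then $V_k^{\otimes m}\otimes L$ is regarded as an $\mathbb FG_m$-module: $G^m$ acts factorwise on $V_k^{\otimes m}$ and trivially on $L$, and $S_m$ acts diagonally, permuting the tensor factors of $V_k^{\otimes m}$. For a $p$-regular partition $\mu$ (no $p$ nonzero parts are equal; no condition if $p=0$) let $D^\mu=S^\mu/(S^\mu\cap (S^\mu)^\perp)$ be the corresponding simple $\mathbb FS_{|\mu|}$-module, where $S^\mu$ is the Specht module and $\perp$ refers to the standard bilinear form on the permutation module on $\mu$-tabloids. Let $n\ge 1$ and let $\mu^\centerdot=(\mu^1,\dots,\mu^r)$ be $p$-regular partitions with $\widehat n=(n_1,\dots,n_r)=(|\mu^1|,\dots,|\mu^r|)$ and $n_1+\dots+n_r=n$. Put $G_{\widehat n}=G_{n_1}\times\dots\times G_{n_r}\subseteq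 G_n$ and $$D_{\widehat n}^{\mu^\centerdot}=\mathrm{ind}_{G_{\widehat n}}^{G_n}\bigl((V_1^{\otimes n_1}\otimes D^{\mu^1})\otimes\cdots\otimes(V_r^{\otimes n_r}\otimes D^{\mu^r})\bigr).$$ For $k$ with $n_k>0$ let $\widehat n_k^-=(n_1,\dots,n_k-1,\dots,n_r)$ and $$D_{\widehat n_k^-}^{\mathrm{soc}(\mu^\centerdot)}=\mathrm{ind}_{G_{\widehat n_k^-}}^{G_{n-1}}\bigl((V_1^{\otimes n_1}\otimes D^{\mu^1})\otimes\cdots\otimes(V_k^{\otimes (n_k-1)}\otimes \mathrm{soc}(\mathrm{res}_{S_{n_k-1}}D^{\mu^k}))\otimes\cdots\otimes(V_r^{\otimes n_r}\otimes D^{\mu^r})\bigr).$$ Let $G_{n-1,1}\cong G_{n-1}\times G$ be the subgroup of $G_n$ generated by $G^n$ and $S_{n-1}$. Then each $D_{\widehat n_k^-}^{\mathrm{soc}(\mu^\centerdot)}$ is a semisimple $\mathbb FG_{n-1}$-module, and there is an isomorphism of $\mathbb F G_{n-1,1}$-modules $$\mathrm{soc}\bigl(\mathrm{res}_{G_{n-1,1}}D_{\widehat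 n}^{\mu^\centerdot}\bigr)\cong\bigoplus_{1\le k\le r,\ n_k>0}D_{\widehat n_k^-}^{\mathrm{soc}(\mu^\centerdot)}\otimes V_k ,$$ where $\otimes$ on the right is the outer tensor product of a $G_{n-1}$-module and a $G$-module. -/

import Mathlib

open scoped TensorProduct MonoidAlgebra DirectSum

universe u v w

noncomputable section

/-! ### Wreath products -/

/-- The wreath product `G^ι ⋊ Perm ι`, where `(w · g) i = g (w⁻¹ i)`; the group `G_n` is
`Wreath G (Fin n)`. -/
abbrev Wreath (G : Type v) [Group G] (ι : Type) : Type v :=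
  (ι → G) ⋊[(mulAutArrow : Equiv.Perm ι →* MulAut (ι → G))] Equiv.Perm ι

namespace Wreath

variable {G : Type v} [Group G]

theorem mul_left_apply {ι : Type} (x y : Wreath G ι) (i : ι) :
    (x * y).left i = x.left i * y.left (x.right.symm i) := rfl

theorem mul_right_apply {ι : Type} (x y : Wreath G ι) (i : ι) :
    (x * y).right i = x.right (y.right i) := rfl

/-- Transport of a wreath product along a bijection of the index sets. -/
def reindexHom {α β : Type} (e : α ≃ β) : Wreath G α →* Wreath G β where
  toFun x := ⟨fun b => x.left (e.symm b), e.permCongr x.right⟩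
  map_one' := by
    apply SemidirectProduct.ext
    · rfl
    · ext; simp
  map_mul' x y := by
    apply SemidirectProduct.ext
    · ext b
      rw [mul_left_apply, mul_left_apply]
      exact congrArg (x.left (e.symm b) * y.left ·) (e.symm_apply_apply _).symm
    · ext b; simp

/-- The embedding of a product of wreath products `∏ᵢ Wreath G (β i)` in the wreath product over the
disjoint union of the index sets. -/
def sigmaHom {κ : Type} (β : κ → Type) : (∀ i, Wreath G (β i)) →* Wreath G (Σ i, β i) where
  toFun x := ⟨fun q => (x q.1).left q.2, Equiv.Perm.sigmaCongrRightHom β fun i => (x i).right⟩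
  map_one' := by
    apply SemidirectProduct.ext
    · rfl
    · ext1 q; simp
  map_mul' x y := by
    apply SemidirectProduct.ext
    · ext q
      rw [mul_left_apply]
      simp only [Pi.mul_apply, mul_left_apply]
      rfl
    · ext1 q; simp

/-- The Young-type embedding `G_{n₁} × ⋯ × G_{n_r} → G_n`, `n = n₁ + ⋯ + n_r`, on consecutive
blocks. -/
def youngHom {r n : ℕ} (d : Fin r → ℕ) (h : ∑ i, d i = n) :
    (∀ i, Wreath G (Fin (d i))) →* Wreath G (Fin n) :=
  (reindexHom (finSigmaFinEquiv.trans (finCongr h))).comp (sigmaHom fun i => Fin (d i))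

/-- The embedding `G_n × G → G_{n+1}` whose image `G_{n,1}` consists of all `(g, w)` such that `w`
fixes the last letter; the factor `G` is the last factor of `G^{n+1}`. -/
def lastHom (n : ℕ) : Wreath G (Fin n) × G →* Wreath G (Fin (n + 1)) where
  toFun x := ⟨Fin.snoc x.1.left x.2, Equiv.Perm.viaEmbeddingHom Fin.castSuccEmb x.1.right⟩
  map_one' := by
    apply SemidirectProduct.ext
    · ext i
      refine Fin.lastCases ?_ (fun j => ?_) i <;> simp
    · simp
  map_mul' x y := by
    apply SemidirectProduct.ext
    · have hc : ∀ (e : Equiv.Perm (Fin n)) (j : Fin n),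
          (Equiv.Perm.viaEmbeddingHom Fin.castSuccEmb e).symm j.castSucc = (e.symm j).castSucc :=
        fun e j => by
          rw [Equiv.symm_apply_eq]
          exact (by simp :
            j.castSucc = (e (e.symm j)).castSucc).trans
              (Equiv.Perm.viaEmbedding_apply e Fin.castSuccEmb (e.symm j)).symm
      have hl : ∀ e : Equiv.Perm (Fin n),
          (Equiv.Perm.viaEmbeddingHom Fin.castSuccEmb e).symm (Fin.last n) = Fin.last n :=
        fun e => by
          rw [Equiv.symm_apply_eq]
          exact (Equiv.Perm.viaEmbedding_apply_of_notMem e Fin.castSuccEmb _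
            (by rintro ⟨j, hj⟩; exact (Fin.castSucc_lt_last j).ne hj)).symm
      ext i
      rw [mul_left_apply]
      refine Fin.lastCases ?_ (fun j => ?_) i
      · simp only [hl, Fin.snoc_last, Prod.snd_mul]
      · simp only [hc, Fin.snoc_castSucc, Prod.fst_mul, mul_left_apply]
    · simp

end Wreath

/-! ### Constructions with representations -/

section Reps

variable {F : Type u} [Field F]

/-- The socle: the sum of all simple submodules. -/
def socle {Γ : Type*} [Monoid Γ] {W : Type*} [AddCommGroup W] [Module F W]
    (τ : Representation F Γ W) : Subrepresentation τ :=
  Subrepresentation.ofSubmodule'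
    (sSup {N : Submodule F[Γ] τ.asModule | IsSimpleModule F[Γ] N})

/-- The outer tensor product `W₁ ⊗ W₂` of a `Γ₁`-module and a `Γ₂`-module, a module over
`Γ₁ × Γ₂`. -/
def outerTensor {Γ₁ Γ₂ W₁ W₂ : Type*} [Monoid Γ₁] [Monoid Γ₂] [AddCommGroup W₁] [Module F W₁]
    [AddCommGroup W₂] [Module F W₂] (τ₁ : Representation F Γ₁ W₁) (τ₂ : Representation F Γ₂ W₂) :
    Representation F (Γ₁ × Γ₂) (W₁ ⊗[F] W₂) :=
  Representation.tprod (τ₁.comp (MonoidHom.fst Γ₁ Γ₂)) (τ₂.comp (MonoidHom.snd Γ₁ Γ₂))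

/-- The outer tensor product `⨂ᵢ Wᵢ` of a family of `Γᵢ`-modules, a module over `∏ᵢ Γᵢ`. -/
def outerPiTensor {κ : Type*} {Γ W : κ → Type*} [∀ i, Monoid (Γ i)] [∀ i, AddCommGroup (W i)]
    [∀ i, Module F (W i)] (τ : ∀ i, Representation F (Γ i) (W i)) :
    Representation F (∀ i, Γ i) (⨂[F] i, W i) where
  toFun x := PiTensorProduct.map fun i => τ i (x i)
  map_one' := by simp
  map_mul' x y := by
    simp only [Pi.mul_apply, map_mul]
    exact PiTensorProduct.map_mul _ _

/-- The module `V^{⊗ ι}` over the wreath product `G^ι ⋊ Perm ι`: the base group acts factorwise and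
`Perm ι` permutes the tensor factors, `(g, w) (⨂ vᵢ) = ⨂ gᵢ v_{w⁻¹ i}`. -/
def wreathPower {G : Type v} [Group G] {V : Type w} [AddCommGroup V] [Module F V]
    (ρ : Representation F G V) (ι : Type) : Representation F (Wreath G ι) (⨂[F] _ : ι, V) where
  toFun x := (PiTensorProduct.map fun i => ρ (x.left i)) ∘ₗ
    (PiTensorProduct.reindex F (fun _ => V) x.right).toLinearMap
  map_one' := by
    ext m
    simp
    rfl
  map_mul' x y := by
    ext m
    simp only [LinearMap.compMultilinearMap_apply, LinearMap.comp_apply, LinearEquiv.coe_coe,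
      PiTensorProduct.reindex_tprod, PiTensorProduct.map_tprod, Module.End.mul_apply,
      Wreath.mul_left_apply, map_mul]
    rfl

/-- The module `V^{⊗ ι} ⊗ L` over `G^ι ⋊ Perm ι`, for a `Perm ι`-module `L`: the base group acts on
`V^{⊗ ι}` only, and `Perm ι` acts diagonally. -/
def wreathTensor {G : Type v} [Group G] {V : Type w} [AddCommGroup V] [Module F V]
    (ρ : Representation F G V) {ι : Type} {L : Type*} [AddCommGroup L] [Module F L]
    (τ : Representation F (Equiv.Perm ι) L) :
    Representation F (Wreath G ι) ((⨂[F] _ : ι, V) ⊗[F] L) :=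
  Representation.tprod (wreathPower ρ ι) (τ.comp SemidirectProduct.rightHom)

end Reps

/-! ### Modules over symmetric groups -/

/-- A natural number `deg` together with a module over the symmetric group `S_deg`. -/
structure SymRep (F : Type u) [Field F] where
  deg : ℕ
  carrier : Type u
  [addCommGroup : AddCommGroup carrier]
  [module : Module F carrier]
  rep : Representation F (Equiv.Perm (Fin deg)) carrier

attribute [instance] SymRep.addCommGroup SymRep.module

/-- `soc (res_{S_{m-1}} L)` for an `S_m`-module `L` (used for `m ≥ 1` only), where `S_{m-1}` is the
stabilizer of the last letter in `S_m`. -/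
def SymRep.socRes {F : Type u} [Field F] (L : SymRep F) : SymRep F where
  deg := L.deg - 1
  carrier := (socle (L.rep.comp (Equiv.Perm.viaEmbeddingHom
    (Fin.castLEEmb (Nat.sub_le L.deg 1))))).toSubmodule
  rep := (socle (L.rep.comp (Equiv.Perm.viaEmbeddingHom
    (Fin.castLEEmb (Nat.sub_le L.deg 1))))).toRepresentation

/-! ### The simple modules `D^μ` of symmetric groups -/

/-- A `μ`-tableau, recorded by the map sending each entry to the cell that it occupies. -/
def Tableau (μ : YoungDiagram) : Type := Fin μ.card ≃ μ.cells

namespace Tableau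

variable {μ : YoungDiagram}

/-- The row of the entry `x`. -/
def row (t : Tableau μ) (x : Fin μ.card) : ℕ := (Equiv.toFun t x).1.1

/-- The column of the entry `x`. -/
def col (t : Tableau μ) (x : Fin μ.card) : ℕ := (Equiv.toFun t x).1.2

/-- `σ • t` is obtained from `t` by replacing every entry `x` by `σ x`. -/
instance : MulAction (Equiv.Perm (Fin μ.card)) (Tableau μ) where
  smul σ t := Equiv.trans σ⁻¹ t
  one_smul _ := rfl
  mul_smul _ _ _ := rfl

theorem row_smul (σ : Equiv.Perm (Fin μ.card)) (t : Tableau μ) (x : Fin μ.card) :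
    (σ • t).row x = t.row (σ⁻¹ x) := rfl

theorem col_smul (σ : Equiv.Perm (Fin μ.card)) (t : Tableau μ) (x : Fin μ.card) :
    (σ • t).col x = t.col (σ⁻¹ x) := rfl

/-- Row equivalence of tableaux. -/
instance rowSetoid (μ : YoungDiagram) : Setoid (Tableau μ) where
  r t s := ∀ x, t.row x = s.row x
  iseqv := ⟨fun _ _ => rfl, fun h x => (h x).symm, fun h h' x => (h x).trans (h' x)⟩

end Tableau

/-- A `μ`-tabloid: a row equivalence class of `μ`-tableaux. -/
def Tabloid (μ : YoungDiagram) : Type := Quotient (Tableau.rowSetoid μ)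

namespace Tabloid

variable {μ : YoungDiagram}

/-- The tabloid of a tableau. -/
def mk (t : Tableau μ) : Tabloid μ := Quotient.mk _ t

instance : MulAction (Equiv.Perm (Fin μ.card)) (Tabloid μ) where
  smul σ := Quotient.map (σ • ·) fun _ _ h x => h (σ⁻¹ x)
  one_smul T := Quotient.inductionOn T fun _ => rfl
  mul_smul _ _ T := Quotient.inductionOn T fun _ => rfl

theorem smul_mk (σ : Equiv.Perm (Fin μ.card)) (t : Tableau μ) : σ • mk t = mk (σ • t) := rfl

end Tabloid

section Specht

variable (F : Type u) [Field F] (μ : YoungDiagram)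

/-- The permutation module `M^μ`, with basis the set of `μ`-tabloids. -/
abbrev permModule : Representation F (Equiv.Perm (Fin μ.card)) F[Tabloid μ] :=
  Representation.ofMulAction F (Equiv.Perm (Fin μ.card)) (Tabloid μ)

variable {μ}

/-- The polytabloid `e_t = ∑_σ sgn(σ) {σ t}`, the sum over the column stabilizer of `t`. -/
def polytabloid (t : Tableau μ) : F[Tabloid μ] :=
  ∑ σ : Equiv.Perm (Fin μ.card) with ∀ x, t.col (σ x) = t.col x,
    MonoidAlgebra.single (Tabloid.mk (σ • t)) ((Equiv.Perm.sign σ : ℤ) : F)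

theorem permModule_polytabloid (τ : Equiv.Perm (Fin μ.card)) (t : Tableau μ) :
    permModule F μ τ (polytabloid F t) = polytabloid F (τ • t) := by
  classical
  unfold polytabloid
  rw [map_sum]
  refine Finset.sum_equiv (MulAut.conj τ).toEquiv (fun σ => ?_) (fun σ _ => ?_)
  · rw [Finset.mem_filter, Finset.mem_filter]
    refine and_congr (by simp) ⟨fun h x => ?_, fun h x => ?_⟩
    · simpa [Tableau.col_smul] using h (τ⁻¹ x)
    · simpa [Tableau.col_smul] using h (τ x)
  · have hs : Equiv.Perm.sign ((MulAut.conj τ).toEquiv σ) = Equiv.Perm.sign σ := by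
      change Equiv.Perm.sign (τ * σ * τ⁻¹) = _
      rw [map_mul, map_mul, map_inv, mul_inv_cancel_comm]
    rw [hs, Representation.ofMulAction_single, Tabloid.smul_mk]
    simp [mul_smul]

variable (μ)

/-- The Specht module `S^μ`, spanned by the polytabloids. -/
def specht : Subrepresentation (permModule F μ) where
  toSubmodule := Submodule.span F (Set.range (polytabloid F (μ := μ)))
  apply_mem_toSubmodule τ v hv := by
    have h := Submodule.mem_map_of_mem (f := permModule F μ τ) hv
    rw [Submodule.map_span] at h
    refine Submodule.span_mono ?_ h
    rintro _ ⟨_, ⟨t, rfl⟩, rfl⟩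
    exact ⟨τ • t, (permModule_polytabloid F τ t).symm⟩

variable {F μ} in
/-- The symmetric bilinear form on `M^μ` for which the tabloids are an orthonormal basis. -/
def tabloidForm (a b : F[Tabloid μ]) : F := a.coeff.sum fun T c => c * b.coeff T

variable {F μ} in
theorem tabloidForm_perm (τ : Equiv.Perm (Fin μ.card)) (a b : F[Tabloid μ]) :
    tabloidForm a (permModule F μ τ b) = tabloidForm (permModule F μ τ⁻¹ a) b := by
  unfold tabloidForm
  rw [Representation.ofMulAction_def (g := τ⁻¹)]
  simp only [Representation.coeff_ofMulAction, LinearMap.comp_apply, LinearEquiv.coe_coe,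
    MonoidAlgebra.coeffLinearEquiv_apply, MonoidAlgebra.coeffLinearEquiv_symm_apply,
    Finsupp.lmapDomain_apply]
  rw [Finsupp.sum_mapDomain_index (by simp) (by intros; ring)]

/-- The submodule `S^μ ∩ (S^μ)^⊥` of `S^μ`. -/
def spechtRadical : Submodule F (specht F μ).toSubmodule where
  carrier := {x | ∀ y ∈ specht F μ, tabloidForm y (x : F[Tabloid μ]) = 0}
  zero_mem' := by intro y _; simp [tabloidForm]
  add_mem' {a b} ha hb y hy := by
    have h : tabloidForm y ((a : F[Tabloid μ]) + b) =
        tabloidForm y (a : F[Tabloid μ]) + tabloidForm y (b : F[Tabloid μ]) := by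
      simp [tabloidForm, mul_add, Finsupp.sum_add]
    simpa [ha y hy, hb y hy] using h
  smul_mem' c a ha y hy := by
    have h : tabloidForm y (c • (a : F[Tabloid μ])) = c * tabloidForm y (a : F[Tabloid μ]) := by
      simp [tabloidForm, Finsupp.mul_sum, mul_left_comm]
    simpa [ha y hy] using h

theorem spechtRadical_le_comap (τ : Equiv.Perm (Fin μ.card)) :
    spechtRadical F μ ≤ (spechtRadical F μ).comap ((specht F μ).toRepresentation τ) := by
  intro x hx y hy
  change tabloidForm y (permModule F μ τ x) = 0
  rw [tabloidForm_perm]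
  exact hx _ ((specht F μ).apply_mem_toSubmodule τ⁻¹ hy)

/-- The module `D^μ = S^μ / (S^μ ∩ (S^μ)^⊥)` over the symmetric group of degree `|μ|`, which is
simple if `μ` is `p`-regular, `p` the characteristic of `F`. -/
def dModule : SymRep F where
  deg := μ.card
  carrier := (specht F μ).toSubmodule ⧸ spechtRadical F μ
  rep := (specht F μ).toRepresentation.quotient (spechtRadical F μ) (spechtRadical_le_comap F μ)

end Specht

/-- A partition is `p`-regular if it does not have `p` equal (nonzero) parts; for `p = 0` every
partition is regular. -/
def IsPRegular (p : ℕ) (μ : YoungDiagram) : Prop := p = 0 ∨ ∀ a, μ.rowLens.count a < p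

/-! ### The modules `D_{n̂}` of wreath products -/

section Induced

variable {F : Type u} [Field F] {G : Type v} [Group G] {r : ℕ} {V : Fin r → Type w}
  [∀ i, AddCommGroup (V i)] [∀ i, Module F (V i)]

variable (V) in
/-- The vector space `(V₁^{⊗ n₁} ⊗ L₁) ⊗ ⋯ ⊗ (V_r^{⊗ n_r} ⊗ L_r)`. -/
def YoungSpace (L : Fin r → SymRep F) : Type (max u w) :=
  ⨂[F] i, (⨂[F] _ : Fin (L i).deg, V i) ⊗[F] (L i).carrier

instance (L : Fin r → SymRep F) : AddCommGroup (YoungSpace V L) :=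
  inferInstanceAs (AddCommGroup (⨂[F] i, (⨂[F] _ : Fin (L i).deg, V i) ⊗[F] (L i).carrier))

instance (L : Fin r → SymRep F) : Module F (YoungSpace V L) :=
  inferInstanceAs (Module F (⨂[F] i, (⨂[F] _ : Fin (L i).deg, V i) ⊗[F] (L i).carrier))

/-- The module `(V₁^{⊗ n₁} ⊗ L₁) ⊗ ⋯ ⊗ (V_r^{⊗ n_r} ⊗ L_r)` over `G_{n₁} × ⋯ × G_{n_r}`, where `L_i`
is a module over the symmetric group of degree `n_i`. -/
def youngRep (ρ : ∀ i, Representation F G (V i)) (L : Fin r → SymRep F) :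
    Representation F (∀ i, Wreath G (Fin (L i).deg)) (YoungSpace V L) :=
  outerPiTensor fun i => wreathTensor (ρ i) (L i).rep

/-- The `G_n`-module induced from the module
`(V₁^{⊗ n₁} ⊗ L₁) ⊗ ⋯ ⊗ (V_r^{⊗ n_r} ⊗ L_r)` over `G_{n₁} × ⋯ × G_{n_r}`, where
`n = n₁ + ⋯ + n_r`. -/
def wreathInd (ρ : ∀ i, Representation F G (V i)) (L : Fin r → SymRep F) {n : ℕ}
    (h : ∑ i, (L i).deg = n) :
    Representation F (Wreath G (Fin n))
      (Representation.IndV (Wreath.youngHom (G := G) (fun i => (L i).deg) h) (youngRep ρ L)) :=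
  Representation.ind (Wreath.youngHom (G := G) (fun i => (L i).deg) h) (youngRep ρ L)

/-- The family obtained from `L` by replacing the `k`-th member `L_k`, a module over the symmetric
group of degree `n_k`, by `soc (res L_k)`, a module over the symmetric group of degree `n_k - 1`. -/
def socFamily (L : Fin r → SymRep F) (k : Fin r) : Fin r → SymRep F :=
  Function.update L k (L k).socRes

theorem sum_deg_socFamily (L : Fin r → SymRep F) {n : ℕ} (h : ∑ i, (L i).deg = n + 1) (k : Fin r)
    (hk : 0 < (L k).deg) : ∑ i, (socFamily L k i).deg = n := by
  have h1 := Finset.add_sum_erase Finset.univ (fun i => (L i).deg) (Finset.mem_univ k)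
  have h2 := Finset.add_sum_erase Finset.univ (fun i => (socFamily L k i).deg) (Finset.mem_univ k)
  have h3 : ∑ i ∈ Finset.univ.erase k, (socFamily L k i).deg =
      ∑ i ∈ Finset.univ.erase k, (L i).deg := by
    refine Finset.sum_congr rfl fun i hi => ?_
    rw [socFamily, Function.update_of_ne (Finset.ne_of_mem_erase hi)]
  have h4 : (socFamily L k k).deg = (L k).deg - 1 := by
    rw [socFamily, Function.update_self]; rfl
  omega

end Induced

end

/-!
By the density theorem there are elements `ε i` of `F[G]` acting on `V i` as rank one idempotents
and killing `V j` for `j ≠ i`. A pure tensor of the `ε i` in `F[G^n]` maps an induced module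
`ind (⨂ (V i ^ {⊗ n_i} ⊗ L i))` to a single translate of the multiplicity space `⨂ L i`, and the
translates of these multiplicity spaces generate the induced module. As in a Morita equivalence,
such elements identify the submodules of a representation with the families of submodules of its
multiplicity spaces, and two modules with the same multiplicity spaces and the same compressed
action are isomorphic.

Restricted to `G_{n-1,1}`, the translates of the multiplicity space fall into one orbit for every
nonempty block `k`, which consists of those placing a letter of this block last, and the
multiplicity space of the orbit is `⨂ L i` restricted to the permutations fixing a letter of the
block `k`. The module `D^{soc} ⊗ V k` has the same compressed action, on the outer tensor product of
`soc (res (L k))` and the other `L i`, which is the socle of the restricted `⨂ L i` because the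
socle of an outer tensor product is the outer tensor product of the socles.

That the modules `D^μ` are semisimple is James' submodule theorem: a submodule of the permutation
module contains `S^μ` or is contained in its orthogonal complement.
-/

noncomputable section

/-! ### Socles -/

section SupAtoms

variable {α : Type*} [CompleteLattice α]

theorem orderIso_map_sSup_isAtom {β : Type*} [CompleteLattice β] (f : α ≃o β) :
    f (sSup {a | IsAtom a}) = sSup {b | IsAtom b} := by
  rw [map_sSup]
  congr 1
  ext b
  exact ⟨fun ⟨a, ha, hab⟩ => hab ▸ (f.isAtom_iff a).2 ha,
    fun hb => ⟨f.symm b, (f.symm.isAtom_iff b).2 hb, f.apply_symm_apply b⟩⟩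

theorem sSup_isAtom_pi_apply {κ : Type*} {α : κ → Type*} [∀ k, CompleteLattice (α k)] (k : κ) :
    sSup {a : ∀ k, α k | IsAtom a} k = sSup {a : α k | IsAtom a} := by
  classical
  rw [sSup_apply]
  refine le_antisymm (iSup_le fun ⟨a, ha⟩ => ?_) (sSup_le fun b hb => ?_)
  · obtain ⟨l, hl, hl'⟩ := Pi.isAtom_iff.1 ha
    obtain rfl | hkl := eq_or_ne k l
    · exact le_sSup hl
    · exact (hl' k hkl).trans_le bot_le
  · have hatom : IsAtom (Function.update (⊥ : ∀ k, α k) k b) :=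
      Pi.isAtom_iff.2 ⟨k, by simpa using hb, fun j hj => by simp [hj]⟩
    simpa using le_iSup (fun a : {a : ∀ k, α k | IsAtom a} => a.1 k) ⟨_, hatom⟩

end SupAtoms

/-- The socle of a module over a ring: the sum of its simple submodules. -/
def moduleSocle (A X : Type*) [Ring A] [AddCommGroup X] [Module A X] : Submodule A X :=
  sSup {N : Submodule A X | IsSimpleModule A N}

theorem moduleSocle_eq_sSup_isAtom (A X : Type*) [Ring A] [AddCommGroup X] [Module A X] :
    moduleSocle A X = sSup {N : Submodule A X | IsAtom N} := by
  simp only [moduleSocle, isSimpleModule_iff_isAtom]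

/-! ### Modules governed by corners of a ring -/

theorem map_mem_of_mem_span {A M S : Type*} [Ring A] [AddCommGroup M] [SetLike S M]
    [AddSubgroupClass S M] (f : A →+ M) (N : S) {s : Set A}
    (h : ∀ c, ∀ a ∈ s, ∀ d, f (c * a * d) ∈ N) {u : A} (hu : u ∈ TwoSidedIdeal.span s) :
    f u ∈ N := by
  rw [TwoSidedIdeal.mem_span_iff_mem_addSubgroup_closure] at hu
  induction hu using AddSubgroup.closure_induction with
  | mem u hu =>
    obtain ⟨_, ⟨c, -, a, ha, rfl⟩, d, -, rfl⟩ := hu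
    exact h c a ha d
  | zero => simpa only [map_zero] using zero_mem N
  | add u v _ _ hu hv => simpa only [map_add] using add_mem hu hv
  | neg u _ hu => simpa only [map_neg] using neg_mem hu

section Corner

variable {A : Type*} [Ring A] {K : Type*} {B : K → Type*} [∀ k, Ring (B k)]

/-- The `A`-module `X` is governed by the `B k`-modules `Y k` via the elements `e k` of `A`: the
images of the `Y k` are the spaces `e k • X`, the compression of the action of `a` to `Y k` is
`t k a`, and the two-sided ideal generated by the `e k` acts unitally on `X`. If `A` is generated by
orthogonal idempotents `e k` as a two-sided ideal, these are the data of the Morita equivalence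
between `A` and its corners `e k * A * e k`; here the `e k` need not be idempotent, and `t k`
is only required to be multiplicative on `X`. -/
structure IsModuleCorner (e : K → A) (t : ∀ k, A → B k) {X : Type*} [AddCommGroup X] [Module A X]
    {Y : K → Type*} [∀ k, AddCommGroup (Y k)] [∀ k, Module (B k) (Y k)]
    (ι : ∀ k, Y k →+ X) : Prop where
  injective : ∀ k, Function.Injective (ι k)
  surjective : ∀ k, Function.Surjective (t k)
  exists_smul_eq : ∀ k x, ∃ y, e k • x = ι k y
  smul_smul : ∀ k (a : A) (y : Y k), e k • a • ι k y = ι k (t k a • y)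
  smul_smul_of_ne : ∀ k l, k ≠ l → ∀ (a : A) (y : Y l), e k • a • ι l y = 0
  unital : ∃ u ∈ TwoSidedIdeal.span (Set.range e), ∀ x : X, u • x = x

namespace IsModuleCorner

variable {e : K → A} {t : ∀ k, A → B k} {X : Type*} [AddCommGroup X] [Module A X]
  {X' : Type*} [AddCommGroup X'] [Module A X']
  {Y : K → Type*} [∀ k, AddCommGroup (Y k)] [∀ k, Module (B k) (Y k)]
  {Y' : K → Type*} [∀ k, AddCommGroup (Y' k)] [∀ k, Module (B k) (Y' k)]
  {ι : ∀ k, Y k →+ X} {ι' : ∀ k, Y k →+ X'}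

/-- The submodule of `X` generated by submodules of the modules `Y k` governing `X`. -/
def induced (ι : ∀ k, Y k →+ X) (N : ∀ k, Submodule (B k) (Y k)) : Submodule A X :=
  Submodule.span A {x | ∃ k, ∃ y ∈ N k, ι k y = x}

theorem mem_induced (N : ∀ k, Submodule (B k) (Y k)) {k : K} {y : Y k} (hy : y ∈ N k) :
    ι k y ∈ induced (A := A) ι N :=
  Submodule.subset_span ⟨k, y, hy, rfl⟩

/-- The submodule of `Y k` corresponding to a submodule `M` of a module governed by the `Y k`: the
elements whose image lies in `M`. -/
def restrict (h : IsModuleCorner e t ι) (M : Submodule A X) (k : K) : Submodule (B k) (Y k) where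
  carrier := {y | ι k y ∈ M}
  zero_mem' := by simp
  add_mem' ha hb := by simpa using M.add_mem ha hb
  smul_mem' b y hy := by
    obtain ⟨a, rfl⟩ := h.surjective k b
    change ι k _ ∈ M
    rw [← h.smul_smul]
    exact M.smul_mem _ (M.smul_mem _ hy)

theorem exists_mem_smul_smul_eq (h : IsModuleCorner e t ι) {N : ∀ k, Submodule (B k) (Y k)} {x : X}
    (hx : x ∈ induced (A := A) ι N) (k : K) (a : A) : ∃ z ∈ N k, e k • a • x = ι k z := by
  induction hx using Submodule.span_induction generalizing a with
  | mem x hx =>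
    obtain ⟨l, z, hz, rfl⟩ := hx
    obtain rfl | hkl := eq_or_ne k l
    · exact ⟨_, (N k).smul_mem _ hz, h.smul_smul k a z⟩
    · exact ⟨0, (N k).zero_mem, by rw [h.smul_smul_of_ne k l hkl, map_zero]⟩
  | zero => exact ⟨0, (N k).zero_mem, by simp⟩
  | add x y _ _ hx hy =>
    obtain ⟨z, hz, hxz⟩ := hx a
    obtain ⟨w, hw, hyw⟩ := hy a
    exact ⟨z + w, (N k).add_mem hz hw, by rw [smul_add, smul_add, hxz, hyw, map_add]⟩
  | smul b x _ hx =>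
    obtain ⟨z, hz, hxz⟩ := hx (a * b)
    exact ⟨z, hz, by rw [← hxz, mul_smul]⟩

theorem mem_induced_iff (h : IsModuleCorner e t ι) (N : ∀ k, Submodule (B k) (Y k)) (k : K)
    (y : Y k) : ι k y ∈ induced (A := A) ι N ↔ y ∈ N k := by
  refine ⟨fun hy => ?_, mem_induced N⟩
  obtain ⟨a, ha⟩ := h.surjective k 1
  obtain ⟨z, hz, hyz⟩ := h.exists_mem_smul_smul_eq hy k a
  rw [h.smul_smul, ha, one_smul] at hyz
  rwa [h.injective k hyz]

theorem restrict_induced (h : IsModuleCorner e t ι) (N : ∀ k, Submodule (B k) (Y k)) (k : K) :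
    h.restrict (induced ι N) k = N k := by
  ext y
  exact h.mem_induced_iff N k y

theorem le_of_forall_mem (h : IsModuleCorner e t ι) {M M' : Submodule A X}
    (hM : ∀ k y, ι k y ∈ M → ι k y ∈ M') : M ≤ M' := by
  obtain ⟨u, hu, hux⟩ := h.unital
  intro x hx
  rw [← hux x]
  refine map_mem_of_mem_span (LinearMap.toSpanSingleton A X x).toAddMonoidHom M' ?_ hu
  rintro c _ ⟨k, rfl⟩ d
  obtain ⟨y, hy⟩ := h.exists_smul_eq k (d • x)
  change (c * e k * d) • x ∈ M'
  rw [mul_smul, mul_smul, hy]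
  exact M'.smul_mem _ (hM k y (hy ▸ M.smul_mem _ (M.smul_mem _ hx)))

theorem induced_restrict (h : IsModuleCorner e t ι) (M : Submodule A X) :
    induced ι (h.restrict M) = M := by
  refine le_antisymm (Submodule.span_le.2 ?_) (h.le_of_forall_mem fun k y hy => mem_induced _ hy)
  rintro _ ⟨k, y, hy, rfl⟩
  exact hy

theorem induced_mono {N N' : ∀ k, Submodule (B k) (Y k)} (hN : N ≤ N') :
    induced (A := A) ι N ≤ induced ι N' :=
  Submodule.span_mono fun _ ⟨k, y, hy, hx⟩ => ⟨k, y, hN k hy, hx⟩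

/-- The correspondence between the submodules of `X` and the families of submodules of the modules
`Y k` governing `X`. -/
def orderIso (h : IsModuleCorner e t ι) : Submodule A X ≃o ∀ k, Submodule (B k) (Y k) where
  toFun M := h.restrict M
  invFun N := induced ι N
  left_inv M := h.induced_restrict M
  right_inv N := funext fun k => h.restrict_induced N k
  map_rel_iff' {M M'} := by
    refine ⟨fun hM => ?_, fun hM k y hy => hM hy⟩
    rw [← h.induced_restrict M, ← h.induced_restrict M']
    exact induced_mono hM

theorem isSemisimpleModule (h : IsModuleCorner e t ι) (hY : ∀ k, IsSemisimpleModule (B k) (Y k)) :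
    IsSemisimpleModule A X := by
  rw [isSemisimpleModule_iff, h.orderIso.complementedLattice_iff]
  choose c hc using fun k => ((isSemisimpleModule_iff (B k) (Y k)).1 (hY k)).exists_isCompl
  exact ⟨fun N => ⟨fun k => c k (N k), Pi.isCompl_iff.2 fun k => hc k (N k)⟩⟩

theorem moduleSocle_eq_induced (h : IsModuleCorner e t ι) :
    moduleSocle A X = induced ι fun k => moduleSocle (B k) (Y k) := by
  apply h.orderIso.injective
  change _ = h.orderIso (h.orderIso.symm _)
  rw [OrderIso.apply_symm_apply, moduleSocle_eq_sSup_isAtom, orderIso_map_sSup_isAtom]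
  funext k
  rw [sSup_isAtom_pi_apply, moduleSocle_eq_sSup_isAtom]

theorem induced_range (h : IsModuleCorner e t ι) (φ : ∀ k, Y' k →ₗ[B k] Y k)
    (hφ : ∀ k, Function.Injective (φ k)) :
    IsModuleCorner e t (X := induced (A := A) ι fun k => LinearMap.range (φ k)) (fun k =>
      ((ι k).comp (φ k).toAddMonoidHom).codRestrict
        (induced (A := A) ι fun k => LinearMap.range (φ k))
        fun y => mem_induced _ ⟨y, rfl⟩) where
  injective k := fun y z hyz => hφ k (h.injective k (congrArg Subtype.val hyz))
  surjective := h.surjective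
  exists_smul_eq k x := by
    obtain ⟨y, hy⟩ := h.exists_smul_eq k x.1
    have hmem : y ∈ LinearMap.range (φ k) := by
      rw [← h.mem_induced_iff (fun k => LinearMap.range (φ k)), ← hy]
      exact Submodule.smul_mem _ _ x.2
    obtain ⟨z, rfl⟩ := hmem
    exact ⟨z, Subtype.ext hy⟩
  smul_smul k a y := Subtype.ext <| by
    change e k • a • ι k (φ k y) = ι k (φ k _)
    rw [h.smul_smul, (φ k).map_smul]
  smul_smul_of_ne k l hkl a y := Subtype.ext (h.smul_smul_of_ne k l hkl a (φ l y))
  unital := by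
    obtain ⟨u, hu, hux⟩ := h.unital
    exact ⟨u, hu, fun x => Subtype.ext (hux x)⟩

theorem prodMap (h : IsModuleCorner e t ι) (h' : IsModuleCorner e t ι') :
    IsModuleCorner e t (X := X × X') (Y := fun k => Y k × Y k)
      (fun k => (ι k).prodMap (ι' k)) where
  injective k := (h.injective k).prodMap (h'.injective k)
  surjective := h.surjective
  exists_smul_eq k x := by
    obtain ⟨y, hy⟩ := h.exists_smul_eq k x.1
    obtain ⟨z, hz⟩ := h'.exists_smul_eq k x.2
    exact ⟨(y, z), Prod.ext hy hz⟩
  smul_smul k a y := Prod.ext (h.smul_smul k a y.1) (h'.smul_smul k a y.2)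
  smul_smul_of_ne k l hkl a y :=
    Prod.ext (h.smul_smul_of_ne k l hkl a y.1) (h'.smul_smul_of_ne k l hkl a y.2)
  unital := by
    obtain ⟨a, ha, hax⟩ := h.unital
    obtain ⟨b, hb, hbx⟩ := h'.unital
    -- `1 - u = (1 - b) * (1 - a)` annihilates both factors.
    refine ⟨a + b - b * a, sub_mem (add_mem ha hb) (TwoSidedIdeal.mul_mem_left _ _ _ ha),
      fun x => Prod.ext ?_ ?_⟩
    · simp [sub_smul, add_smul, mul_smul, hax]
    · simp [sub_smul, add_smul, mul_smul, hbx]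

theorem bijective_of_forall_apply_eq (h : IsModuleCorner e t ι) (h' : IsModuleCorner e t ι')
    (f : X →ₗ[A] X') (hf : ∀ k y, f (ι k y) = ι' k y) : Function.Bijective f := by
  constructor
  · rw [← LinearMap.ker_eq_bot, eq_bot_iff]
    refine h.le_of_forall_mem fun k y hy => ?_
    rw [LinearMap.mem_ker, hf, map_eq_zero_iff _ (h'.injective k)] at hy
    simp [hy]
  · rw [← LinearMap.range_eq_top, eq_top_iff]
    exact h'.le_of_forall_mem fun k y _ => ⟨ι k y, hf k y⟩

theorem nonempty_linearEquiv (h : IsModuleCorner e t ι) (h' : IsModuleCorner e t ι') :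
    Nonempty (X ≃ₗ[A] X') := by
  -- The submodule of `X × X'` generated by the diagonals of `Y k × Y k` is the graph of an
  -- isomorphism.
  let diagonal (k : K) : Y k →ₗ[B k] Y k × Y k := LinearMap.id.prod LinearMap.id
  have hgraph := (h.prodMap h').induced_range diagonal fun k y z hyz => congrArg Prod.fst hyz
  have hfst := hgraph.bijective_of_forall_apply_eq h
    ((LinearMap.fst A X X').comp (Submodule.subtype _)) fun _ _ => rfl
  have hsnd := hgraph.bijective_of_forall_apply_eq h'
    ((LinearMap.snd A X X').comp (Submodule.subtype _)) fun _ _ => rfl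
  exact ⟨(LinearEquiv.ofBijective _ hfst).symm.trans (LinearEquiv.ofBijective _ hsnd)⟩

theorem nonempty_moduleSocle_linearEquiv (h : IsModuleCorner e t ι) (φ : ∀ k, Y' k →ₗ[B k] Y k)
    (hφ : ∀ k, Function.Injective (φ k))
    (hsoc : ∀ k, LinearMap.range (φ k) = moduleSocle (B k) (Y k)) {ι' : ∀ k, Y' k →+ X'}
    (h' : IsModuleCorner e t ι') : Nonempty (moduleSocle A X ≃ₗ[A] X') := by
  have hrange : moduleSocle A X = induced ι fun k => LinearMap.range (φ k) := by
    simp only [hsoc]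
    exact h.moduleSocle_eq_induced
  rw [hrange]
  exact (h.induced_range φ hφ).nonempty_linearEquiv h'

end IsModuleCorner

end Corner

section CornerRep

variable {F : Type*} [Field F] {Γ : Type*}

/-- The linear map between group algebras extending a map on group elements. -/
def groupAlgebraLift {Δ : Type*} (T : Γ → F[Δ]) : F[Γ] →ₗ[F] F[Δ] :=
  (Finsupp.linearCombination F T).comp (MonoidAlgebra.coeffLinearEquiv F).toLinearMap

@[simp]
theorem groupAlgebraLift_single {Δ : Type*} (T : Γ → F[Δ]) (g : Γ) (c : F) :
    groupAlgebraLift T (MonoidAlgebra.single g c) = c • T g := by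
  simp [groupAlgebraLift]

theorem groupAlgebraLift_surjective {Δ : Type*} {T : Γ → F[Δ]}
    (hT : ∀ σ, ∃ g, T g = MonoidAlgebra.single σ 1) : Function.Surjective (groupAlgebraLift T) := by
  intro b
  induction b using MonoidAlgebra.induction_linear with
  | zero => exact ⟨0, map_zero _⟩
  | add x y hx hy =>
    obtain ⟨a, rfl⟩ := hx
    obtain ⟨b, rfl⟩ := hy
    exact ⟨a + b, map_add _ _ _⟩
  | single σ c =>
    obtain ⟨g, hg⟩ := hT σ
    exact ⟨MonoidAlgebra.single g c, by simp [hg]⟩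

variable [Group Γ] {K : Type*}

theorem IsModuleCorner.of_rep {S : K → Type*} [∀ k, Group (S k)] {X : Type*}
    [AddCommGroup X] [Module F X] (ρ : Representation F Γ X) {Y : K → Type*}
    [∀ k, AddCommGroup (Y k)] [∀ k, Module F (Y k)] (τ : ∀ k, Representation F (S k) (Y k))
    (e : K → F[Γ]) (T : ∀ k, Γ → F[S k]) (ι : ∀ k, Y k →ₗ[F] X)
    (hinj : ∀ k, Function.Injective (ι k))
    (hsurj : ∀ k (σ : S k), ∃ g, T k g = MonoidAlgebra.single σ 1)
    (hrange : ∀ k x, ∃ y, ρ.asAlgebraHom (e k) x = ι k y)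
    (hsame : ∀ k g y, ρ.asAlgebraHom (e k) (ρ g (ι k y)) = ι k ((τ k).asAlgebraHom (T k g) y))
    (hne : ∀ k l, k ≠ l → ∀ g y, ρ.asAlgebraHom (e k) (ρ g (ι l y)) = 0)
    (hunital : ∃ u ∈ TwoSidedIdeal.span (Set.range e), ρ.asAlgebraHom u = 1) :
    IsModuleCorner e (fun k => groupAlgebraLift (T k)) (X := ρ.asModule)
      (Y := fun k => (τ k).asModule) (fun k => (ι k).toAddMonoidHom) where
  injective := hinj
  surjective k := groupAlgebraLift_surjective (hsurj k)
  exists_smul_eq := hrange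
  smul_smul k a := by
    suffices ∀ y : Y k, ρ.asAlgebraHom (e k) (ρ.asAlgebraHom a (ι k y)) =
        ι k ((τ k).asAlgebraHom (groupAlgebraLift (T k) a) y) from this
    intro y
    induction a using MonoidAlgebra.induction_linear with
    | zero => simp
    | add a b ha hb => simp only [map_add, LinearMap.add_apply, ha, hb]
    | single g c => simp [hsame]
  smul_smul_of_ne k l hkl a := by
    suffices ∀ y : Y l, ρ.asAlgebraHom (e k) (ρ.asAlgebraHom a (ι l y)) = 0 from this
    intro y
    induction a using MonoidAlgebra.induction_linear with
    | zero => simp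
    | add a b ha hb => simp only [map_add, LinearMap.add_apply, ha, hb, add_zero]
    | single g c => simp [hne k l hkl]
  unital := hunital.imp fun _ hu => ⟨hu.1, LinearMap.congr_fun hu.2⟩

theorem asAlgebraHom_eq_zero_of_mem_span {X : Type*} [AddCommGroup X] [Module F X]
    (ρ : Representation F Γ X) {a u : F[Γ]} (ha : ρ.asAlgebraHom a = 0)
    (hu : u ∈ TwoSidedIdeal.span {a}) : ρ.asAlgebraHom u = 0 := by
  have hker : TwoSidedIdeal.span {a} ≤ TwoSidedIdeal.ker ρ.asAlgebraHom :=
    TwoSidedIdeal.span_le.2 (by simpa [TwoSidedIdeal.mem_ker] using ha)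
  exact (TwoSidedIdeal.mem_ker _).1 (hker hu)

section DirectSum

variable {W : K → Type*} [∀ k, AddCommGroup (W k)] [∀ k, Module F (W k)]
  (Z : ∀ k, Representation F Γ (W k))

theorem asAlgebraHom_directSum_apply (a : F[Γ]) (x : ⨁ k, W k) (k : K) :
    (Representation.directSum Z).asAlgebraHom a x k = (Z k).asAlgebraHom a (x k) := by
  induction a using MonoidAlgebra.induction_linear with
  | zero => simp
  | add a b ha hb => simp [ha, hb]
  | single g c =>
    simp only [Representation.asAlgebraHom_single, LinearMap.smul_apply, DirectSum.smul_apply]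
    exact congrArg (c • ·) (DirectSum.lmap_apply _ x k)

theorem asAlgebraHom_directSum_of [DecidableEq K] (a : F[Γ]) {k : K} (x : W k) :
    (Representation.directSum Z).asAlgebraHom a (DirectSum.of W k x) =
      DirectSum.of W k ((Z k).asAlgebraHom a x) := by
  refine DFinsupp.ext fun l => ?_
  rw [asAlgebraHom_directSum_apply]
  obtain rfl | hkl := eq_or_ne k l
  · simp only [DirectSum.of_eq_same]
  · simp only [DirectSum.of_eq_of_ne _ _ _ hkl.symm, map_zero]

theorem IsModuleCorner.directSum [Finite K] [DecidableEq K] {B : K → Type*} [∀ k, Ring (B k)]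
    {Y : K → Type*} [∀ k, AddCommGroup (Y k)] [∀ k, Module (B k) (Y k)] {e : K → F[Γ]}
    {t : ∀ k, F[Γ] → B k} {ι : ∀ k, Y k →+ (Z k).asModule}
    (h : ∀ k, IsModuleCorner (K := Unit) (fun _ => e k) (fun _ => t k) (fun _ => ι k))
    (hne : ∀ k l, k ≠ l → (Z l).asAlgebraHom (e k) = 0) :
    IsModuleCorner e t (X := (Representation.directSum Z).asModule)
      fun k => (DirectSum.of W k).comp (ι k) where
  injective k := (DirectSum.of_injective k).comp ((h k).injective ())
  surjective k := (h k).surjective ()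
  exists_smul_eq k := by
    intro (x : ⨁ k, W k)
    obtain ⟨y, hy⟩ := (h k).exists_smul_eq () (x k)
    refine ⟨y, DFinsupp.ext fun l => (asAlgebraHom_directSum_apply Z _ x l).trans ?_⟩
    obtain rfl | hkl := eq_or_ne k l
    · exact hy.trans (DirectSum.of_eq_same (β := W) k (ι k y)).symm
    · rw [hne k l hkl]
      exact (DirectSum.of_eq_of_ne _ _ _ hkl.symm).symm
  smul_smul k a y :=
    (congrArg ((Representation.directSum Z).asAlgebraHom (e k))
      (asAlgebraHom_directSum_of Z a _)).trans <|
    (asAlgebraHom_directSum_of Z _ _).trans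
      (congrArg (DirectSum.of W k) ((h k).smul_smul () a y))
  smul_smul_of_ne k l hkl a y :=
    (congrArg ((Representation.directSum Z).asAlgebraHom (e k))
      (asAlgebraHom_directSum_of Z a _)).trans <|
    (asAlgebraHom_directSum_of Z _ _).trans <| by
      rw [hne k l hkl, LinearMap.zero_apply, map_zero]
      rfl
  unital := by
    cases nonempty_fintype K
    choose u hu hux using fun k => (h k).unital
    have hu' (k) : u k ∈ TwoSidedIdeal.span {e k} := Set.range_const (ι := Unit) ▸ hu k
    refine ⟨∑ k, u k, sum_mem fun k _ => TwoSidedIdeal.span_mono (by simp) (hu' k), ?_⟩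
    intro (x : ⨁ k, W k)
    refine DFinsupp.ext fun l => (asAlgebraHom_directSum_apply Z _ x l).trans ?_
    rw [map_sum, LinearMap.sum_apply, Finset.sum_eq_single_of_mem l (Finset.mem_univ l)]
    · exact hux l (x l)
    · intro k _ hkl
      rw [asAlgebraHom_eq_zero_of_mem_span _ (hne k l hkl) (hu' k), LinearMap.zero_apply]

end DirectSum

end CornerRep

/-! ### Pure tensors in group algebras of products -/

section PureElement

variable {F : Type*} [Field F] {κ : Type*} {Γ : κ → Type*}

theorem multilinearMap_ext_single [Finite κ] {W : Type*} [AddCommGroup W] [Module F W]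
    {f f' : MultilinearMap F (fun i => F[Γ i]) W}
    (h : ∀ g : ∀ i, Γ i, f (fun i => MonoidAlgebra.single (g i) 1) =
      f' (fun i => MonoidAlgebra.single (g i) 1)) : f = f' :=
  Module.Basis.ext_multilinear
    (fun _ => Module.Basis.ofRepr (MonoidAlgebra.coeffLinearEquiv F)) h

variable [Fintype κ] [∀ i, Finite (Γ i)]

/-- The pure tensor `⨂ a i` as an element of the group algebra of `∏ Γ i`, which for a finite
product is the tensor product of the group algebras of the `Γ i`. -/
def pureElement : MultilinearMap F (fun i => F[Γ i]) F[∀ i, Γ i] :=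
  ((Finsupp.linearEquivFunOnFinite F F (∀ i, Γ i)).symm ≪≫ₗ
    (MonoidAlgebra.coeffLinearEquiv F).symm).toLinearMap.compMultilinearMap <|
      MultilinearMap.pi fun g => (MultilinearMap.mkPiAlgebra F κ F).compLinearMap fun i =>
        Finsupp.lapply (g i) ∘ₗ (MonoidAlgebra.coeffLinearEquiv F).toLinearMap

theorem coeff_pureElement (a : ∀ i, F[Γ i]) (g : ∀ i, Γ i) :
    (pureElement a).coeff g = ∏ i, (a i).coeff (g i) := rfl

theorem pureElement_single (g : ∀ i, Γ i) :
    pureElement (fun i => MonoidAlgebra.single (g i) (1 : F)) = MonoidAlgebra.single g 1 := by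
  classical
  ext h
  simp only [coeff_pureElement, MonoidAlgebra.coeff_single, Finsupp.single_apply,
    Finset.prod_boole, Finset.mem_univ, true_imp_iff, funext_iff]

variable [∀ i, Group (Γ i)]

theorem pureElement_mul (a b : ∀ i, F[Γ i]) :
    pureElement (fun i => a i * b i) = pureElement a * pureElement b := by
  classical
  have hsingle (g : ∀ i, Γ i) : pureElement (fun i => MonoidAlgebra.single (g i) 1 * b i) =
      MonoidAlgebra.single g 1 * pureElement b := by
    ext h
    simp [coeff_pureElement, MonoidAlgebra.coeff_single_mul_apply]
  have hb : pureElement.compLinearMap (fun i => LinearMap.mulRight F (b i)) =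
      (LinearMap.mulRight F (pureElement b)).compMultilinearMap pureElement :=
    multilinearMap_ext_single fun g => by simp [pureElement_single, hsingle]
  exact congrArg (· a) hb

theorem pureElement_update_mul_mul [DecidableEq κ] (c : ∀ i, F[Γ i]) (i : κ) (x y z : F[Γ i]) :
    pureElement (Function.update c i (x * y * z)) =
      pureElement (Function.update 1 i x) * pureElement (Function.update c i y) *
        pureElement (Function.update 1 i z) := by
  rw [← pureElement_mul, ← pureElement_mul]
  congr 1
  ext1 j
  obtain rfl | hji := eq_or_ne j i
  · simp only [Function.update_self]
  · simp [Function.update_of_ne hji]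

theorem pureElement_mem_span {a b : ∀ i, F[Γ i]} (h : ∀ i, a i ∈ TwoSidedIdeal.span {b i}) :
    pureElement a ∈ TwoSidedIdeal.span {pureElement b} := by
  classical
  -- The coordinates of `b` are replaced by those of `a` one after the other.
  suffices ∀ s : Finset κ, pureElement (s.piecewise a b) ∈ TwoSidedIdeal.span {pureElement b} by
    simpa using this Finset.univ
  intro s
  induction s using Finset.induction_on with
  | empty =>
    rw [Finset.piecewise_empty]
    exact TwoSidedIdeal.subset_span rfl
  | insert i s hi ih =>
    rw [Finset.piecewise_insert]
    refine map_mem_of_mem_span (pureElement.toLinearMap (s.piecewise a b) i).toAddMonoidHom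
      (TwoSidedIdeal.span {pureElement b}) ?_ (h i)
    rintro x _ rfl z
    change pureElement (Function.update (s.piecewise a b) i (x * b i * z)) ∈ _
    rw [pureElement_update_mul_mul, ← Finset.piecewise_eq_of_notMem s a b hi,
      Function.update_eq_self]
    exact TwoSidedIdeal.mul_mem_right _ _ _ (TwoSidedIdeal.mul_mem_left _ _ _ ih)

theorem asAlgebraHom_outerPiTensor {W : κ → Type*} [∀ i, AddCommGroup (W i)] [∀ i, Module F (W i)]
    (τ : ∀ i, Representation F (Γ i) (W i)) (a : ∀ i, F[Γ i]) :
    (outerPiTensor τ).asAlgebraHom (pureElement a) =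
      PiTensorProduct.map fun i => (τ i).asAlgebraHom (a i) := by
  have h : (outerPiTensor τ).asAlgebraHom.toLinearMap.compMultilinearMap pureElement =
      (PiTensorProduct.mapMultilinear F W W).compLinearMap
        fun i => (τ i).asAlgebraHom.toLinearMap := by
    refine multilinearMap_ext_single fun g => ?_
    simp only [LinearMap.compMultilinearMap_apply, pureElement_single, AlgHom.toLinearMap_apply,
      Representation.asAlgebraHom_single_one, MultilinearMap.compLinearMap_apply]
    rfl
  exact congrArg (· a) h

end PureElement

section GroupAlgebraRep

variable {F : Type*} [Field F] {Γ Δ : Type*} [Group Γ] [Group Δ]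

theorem asAlgebraHom_comp {W : Type*} [AddCommGroup W] [Module F W]
    (τ : Representation F Δ W) (φ : Γ →* Δ) (a : F[Γ]) :
    Representation.asAlgebraHom (τ.comp φ : Representation F Γ W) a =
      τ.asAlgebraHom (MonoidAlgebra.mapDomainAlgHom F F φ a) := by
  induction a using MonoidAlgebra.induction_linear with
  | zero => simp
  | add a b ha hb => simp only [map_add, ha, hb]
  | single g c => simp

end GroupAlgebraRep

/-! ### Density and rank one elements -/

section Density

variable {F : Type u} [Field F] {G : Type v} [Group G]

theorem finiteDimensional_of_isIrreducible [Finite G] {W : Type*} [AddCommGroup W]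
    [Module F W] (ρ : Representation F G W) [ρ.IsIrreducible] : FiniteDimensional F W := by
  have : IsSimpleModule F[G] ρ.asModule := ρ.irreducible_iff_isSimpleModule_asModule.1 ‹_›
  have : Module.Finite F[G] ρ.asModule := inferInstance
  have : Module.Finite F F[G] := inferInstance
  have : Module.Finite F ρ.asModule := Module.Finite.trans F[G] ρ.asModule
  exact this

theorem exists_dual_apply_eq_one {W : Type*} [AddCommGroup W] [Module F W] {v : W} (hv : v ≠ 0) :
    ∃ f : Module.Dual F W, f v = 1 := by
  obtain ⟨f, hf⟩ : ∃ f : Module.Dual F W, f v ≠ 0 := by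
    by_contra! h
    exact hv ((Module.forall_dual_apply_eq_zero_iff F v).1 h)
  exact ⟨(f v)⁻¹ • f, by simp [hf]⟩

section Module

variable {R : Type*} [Ring R] [Algebra F R]

theorem exists_forall_smul_eq_of_forall_comm {M : Type*} [AddCommGroup M] [Module F M] [Module R M]
    [IsScalarTower F R M] [FiniteDimensional F M] [IsSemisimpleModule R M] (T : M →ₗ[F] M)
    (hT : ∀ (φ : Module.End R M) m, T (φ m) = φ (T m)) : ∃ a : R, ∀ m, a • m = T m := by
  let T' : Module.End (Module.End R M) M :=
    { toFun := T, map_add' := T.map_add, map_smul' := fun φ m => hT φ m }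
  obtain ⟨s, hs⟩ := (inferInstance : Module.Finite F M).fg_top
  obtain ⟨a, ha⟩ := jacobson_density T' s
  have hTa : T = Algebra.lsmul F F M a := LinearMap.ext_on hs fun m hm => ha m hm
  exact ⟨a, fun m => (LinearMap.congr_fun hTa m).symm⟩

variable {κ : Type*} {V : κ → Type*} [∀ i, AddCommGroup (V i)] [∀ i, Module R (V i)]
  [∀ i, IsSimpleModule R (V i)]

theorem end_pi_single_apply_of_ne [DecidableEq κ]
    (hne : Pairwise fun i j => IsEmpty (V i ≃ₗ[R] V j)) (φ : Module.End R (∀ i, V i)) {i j : κ}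
    (hij : i ≠ j) (x : V i) : φ (Pi.single i x) j = 0 := by
  have hzero : (LinearMap.proj j).comp (φ.comp (LinearMap.single R _ i)) = 0 :=
    (LinearMap.bijective_or_eq_zero _).resolve_left fun hb =>
      (hne hij).false (LinearEquiv.ofBijective _ hb)
  exact LinearMap.congr_fun hzero x

variable [IsAlgClosed F] [Finite κ] [∀ i, Module F (V i)] [∀ i, IsScalarTower F R (V i)]
  [∀ i, FiniteDimensional F (V i)]

theorem exists_forall_end_pi_apply_eq_smul (hne : Pairwise fun i j => IsEmpty (V i ≃ₗ[R] V j))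
    (φ : Module.End R (∀ i, V i)) (i : κ) : ∃ c : F, ∀ m, φ m i = c • m i := by
  classical
  cases nonempty_fintype κ
  obtain ⟨c, hc⟩ := (IsSimpleModule.algebraMap_end_bijective_of_isAlgClosed F (A := R)
    (V := V i)).2 ((LinearMap.proj i).comp (φ.comp (LinearMap.single R _ i)))
  refine ⟨c, fun m => ?_⟩
  conv_lhs => rw [← Finset.univ_sum_single m, map_sum, Finset.sum_apply]
  rw [Finset.sum_eq_single i (fun j _ hji => end_pi_single_apply_of_ne hne φ hji _) (by simp)]
  exact (LinearMap.congr_fun hc (m i)).symm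

theorem exists_smul_eq_of_pairwise_isEmpty (hne : Pairwise fun i j => IsEmpty (V i ≃ₗ[R] V j))
    (i : κ) (f : V i →ₗ[F] V i) :
    ∃ a : R, (∀ x : V i, a • x = f x) ∧ ∀ j, j ≠ i → ∀ x : V j, a • x = 0 := by
  classical
  let T : (∀ j, V j) →ₗ[F] ∀ j, V j := (LinearMap.single F V i).comp (f.comp (LinearMap.proj i))
  have hcomm (φ : Module.End R (∀ j, V j)) (m : ∀ j, V j) : T (φ m) = φ (T m) := by
    obtain ⟨c, hc⟩ := exists_forall_end_pi_apply_eq_smul (F := F) hne φ i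
    change Pi.single i (f (φ m i)) = φ (Pi.single i (f (m i)))
    rw [hc]
    ext1 j
    obtain rfl | hij := eq_or_ne i j
    · rw [hc, Pi.single_eq_same, Pi.single_eq_same, map_smul]
    · rw [end_pi_single_apply_of_ne hne φ hij, Pi.single_eq_of_ne hij.symm]
  obtain ⟨a, ha⟩ := exists_forall_smul_eq_of_forall_comm T hcomm
  refine ⟨a, fun x => ?_, fun j hj x => ?_⟩
  · simpa [T] using congrFun (ha (Pi.single i x)) i
  · simpa [T, hj] using congrFun (ha (Pi.single j x)) j

end Module

variable [IsAlgClosed F] {κ : Type*} [Finite κ] {V : κ → Type w} [∀ i, AddCommGroup (V i)]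
  [∀ i, Module F (V i)] [∀ i, FiniteDimensional F (V i)]

theorem exists_asAlgebraHom_eq (ρ : ∀ i, Representation F G (V i))
    (hirr : ∀ i, (ρ i).IsIrreducible) (hne : Pairwise fun i j => IsEmpty ((ρ i).Equiv (ρ j)))
    (i : κ) (f : V i →ₗ[F] V i) :
    ∃ a : F[G], (ρ i).asAlgebraHom a = f ∧ ∀ j, j ≠ i → (ρ j).asAlgebraHom a = 0 := by
  have hs (i) : IsSimpleModule F[G] (ρ i).asModule :=
    ((ρ i).irreducible_iff_isSimpleModule_asModule).1 (hirr i)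
  have hfd (i) : FiniteDimensional F (ρ i).asModule := inferInstance
  obtain ⟨a, ha, ha'⟩ := exists_smul_eq_of_pairwise_isEmpty (F := F) (R := F[G])
    (V := fun i => (ρ i).asModule) (fun j l hjl => ⟨fun e => (hne hjl).false
      (Representation.IntertwiningMap.ofBijective
        ((Representation.IntertwiningMap.equivLinearMapAsModule (ρ j) (ρ l)).symm e.toLinearMap)
        e.bijective)⟩) i f
  exact ⟨a, LinearMap.ext ha, fun j hj => LinearMap.ext (ha' j hj)⟩

end Density

section RankOne

variable {F : Type u} [Field F] {G : Type v} [Group G] {κ : Type*} {V : κ → Type w}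
  [∀ i, AddCommGroup (V i)] [∀ i, Module F (V i)]

/-- The elements `ε i` of the group algebra act on the representations `ρ i` as rank one idempotents
`x ↦ f i x • v i` and kill `ρ j` for `j ≠ i`, and the ideal generated by `ε i` contains an element
acting as the identity on `ρ i`. They play the role of primitive idempotents of the semisimple
quotient of `F[G]`. -/
structure IsRankOneSystem (ρ : ∀ i, Representation F G (V i)) (ε : κ → F[G]) (v : ∀ i, V i)
    (f : ∀ i, Module.Dual F (V i)) : Prop where
  dual_apply : ∀ i, f i (v i) = 1
  asAlgebraHom_apply : ∀ i x, (ρ i).asAlgebraHom (ε i) x = f i x • v i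
  asAlgebraHom_of_ne : ∀ i j, j ≠ i → (ρ j).asAlgebraHom (ε i) = 0
  exists_asAlgebraHom_eq_one : ∀ i, ∃ u ∈ TwoSidedIdeal.span {ε i}, (ρ i).asAlgebraHom u = 1

theorem exists_isRankOneSystem [IsAlgClosed F] [Finite κ] [∀ i, FiniteDimensional F (V i)]
    (ρ : ∀ i, Representation F G (V i)) (hirr : ∀ i, (ρ i).IsIrreducible)
    (hne : Pairwise fun i j => IsEmpty ((ρ i).Equiv (ρ j))) :
    ∃ ε v f, IsRankOneSystem ρ ε v f := by
  have hnt (i) : Nontrivial (V i) := by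
    have : IsSimpleModule F[G] (ρ i).asModule :=
      ((ρ i).irreducible_iff_isSimpleModule_asModule).1 (hirr i)
    exact IsSimpleModule.nontrivial F[G] (ρ i).asModule
  choose v hv using fun i => exists_ne (0 : V i)
  choose f hf using fun i => exists_dual_apply_eq_one (F := F) (hv i)
  choose a ha ha' using exists_asAlgebraHom_eq ρ hirr hne
  let ε (i : κ) : F[G] := a i ((f i).smulRight (v i))
  refine ⟨ε, v, f, hf, fun i x => by simp [ε, ha], fun i j hj => ha' _ _ j hj, fun i => ?_⟩
  let b := Module.finBasis F (V i)
  -- The identity is a sum of rank one operators, each of which factors through `v i`.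
  refine ⟨∑ s, a i ((f i).smulRight (b s)) * ε i * a i ((b.coord s).smulRight (v i)),
    sum_mem fun s _ => TwoSidedIdeal.mul_mem_right _ _ _
      (TwoSidedIdeal.mul_mem_left _ _ _ (TwoSidedIdeal.subset_span rfl)), LinearMap.ext fun x => ?_⟩
  simp only [ε, map_sum, map_mul, ha, LinearMap.sum_apply, Module.End.mul_apply,
    LinearMap.smulRight_apply, map_smul, hf, one_smul]
  exact b.sum_repr x

end RankOne

/-! ### Functionals on tensor products -/

section PiTensor

variable {F : Type*} [Field F] {κ : Type*} {W : κ → Type*} [∀ i, AddCommGroup (W i)]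
  [∀ i, Module F (W i)] {W' : κ → Type*} [∀ i, AddCommGroup (W' i)] [∀ i, Module F (W' i)]

theorem mem_of_forall_tprod_mem (P : Submodule F (⨂[F] i, W i))
    (h : ∀ x, PiTensorProduct.tprod F x ∈ P) (z : ⨂[F] i, W i) : z ∈ P := by
  have htop : P = ⊤ := by
    rw [eq_top_iff, ← PiTensorProduct.span_tprod_eq_top, Submodule.span_le]
    rintro _ ⟨x, rfl⟩
    exact h x
  exact htop ▸ Submodule.mem_top

theorem piTensorMap_injective (φ : ∀ i, W' i →ₗ[F] W i) (hφ : ∀ i, Function.Injective (φ i)) :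
    Function.Injective (PiTensorProduct.map φ) := by
  choose ψ hψ using fun i => (φ i).exists_leftInverse_of_injective (LinearMap.ker_eq_bot.2 (hφ i))
  refine Function.LeftInverse.injective (g := PiTensorProduct.map ψ) fun x => ?_
  rw [← LinearMap.comp_apply, ← PiTensorProduct.map_comp]
  simp [hψ, PiTensorProduct.map_id]

theorem tprod_mem_of_forall_mem [Finite κ] (P : Submodule F (⨂[F] i, W i))
    {s : ∀ i, Set (W i)} (h : ∀ x, (∀ i, x i ∈ s i) → PiTensorProduct.tprod F x ∈ P) {x : ∀ i, W i}
    (hx : ∀ i, x i ∈ Submodule.span F (s i)) : PiTensorProduct.tprod F x ∈ P := by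
  classical
  cases nonempty_fintype κ
  -- The coordinates are extended from `s i` to its span one after the other.
  suffices ∀ (t : Finset κ) (x : ∀ i, W i), (∀ i, x i ∈ Submodule.span F (s i)) →
      (∀ i, i ∉ t → x i ∈ s i) → PiTensorProduct.tprod F x ∈ P from
    this Finset.univ x hx fun i hi => absurd (Finset.mem_univ i) hi
  intro t
  induction t using Finset.induction_on with
  | empty => exact fun x _ hxs => h x fun i => hxs i (Finset.notMem_empty i)
  | insert k t _ ih =>
    intro x hx hxs
    suffices Submodule.span F (s k) ≤ P.comap ((PiTensorProduct.tprod F).toLinearMap x k) by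
      simpa using this (hx k)
    rw [Submodule.span_le]
    intro y hy
    refine ih _ (fun i => ?_) fun i hi => ?_
    · obtain rfl | hik := eq_or_ne i k
      · simpa using Submodule.subset_span hy
      · simpa [hik] using hx i
    · obtain rfl | hik := eq_or_ne i k
      · simpa using hy
      · simpa [hik] using hxs i (by simp [hik, hi])

theorem prod_dual_update_of_notMem [DecidableEq κ] (f : ∀ i, Module.Dual F (W i))
    (x : ∀ i, W i) {k : κ} (a : W k) {s : Finset κ} (hk : k ∉ s) :
    ∏ j ∈ s, f j (Function.update x k a j) = ∏ j ∈ s, f j (x j) :=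
  Finset.prod_congr rfl fun j hj => by rw [Function.update_of_ne (ne_of_mem_of_not_mem hj hk)]

variable [Fintype κ]

/-- The functional `⨂ xᵢ ↦ ∏ fᵢ xᵢ` on a tensor product. -/
def piTensorDual : MultilinearMap F (fun i => Module.Dual F (W i)) (Module.Dual F (⨂[F] i, W i)) :=
  PiTensorProduct.dualDistrib.compMultilinearMap (PiTensorProduct.tprod F)

@[simp]
theorem piTensorDual_tprod (f : ∀ i, Module.Dual F (W i)) (x : ∀ i, W i) :
    piTensorDual f (PiTensorProduct.tprod F x) = ∏ i, f i (x i) :=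
  PiTensorProduct.dualDistrib_apply f x

theorem piTensorDual_comp_map (f : ∀ i, Module.Dual F (W i)) (φ : ∀ i, W' i →ₗ[F] W i) :
    piTensorDual f ∘ₗ PiTensorProduct.map φ = piTensorDual fun i => f i ∘ₗ φ i := by
  ext x
  simp

theorem eq_zero_of_forall_piTensorDual_eq_zero {x : ⨂[F] i, W i}
    (h : ∀ f, piTensorDual f x = 0) : x = 0 := by
  let b (i) := Module.Basis.ofVectorSpace F (W i)
  refine (Basis.piTensorProduct b).ext_elem fun p => ?_
  have hcoord : (Basis.piTensorProduct b).coord p = piTensorDual fun i => (b i).coord (p i) := by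
    ext y
    simp
  simpa [h] using LinearMap.congr_fun hcoord x

theorem mem_range_map_of_forall_piTensorDual_eq_zero {φ : ∀ i, W' i →ₗ[F] W i}
    (hφ : ∀ i, Function.Injective (φ i)) {x : ⨂[F] i, W i}
    (h : ∀ f, (∃ i, f i ∘ₗ φ i = 0) → piTensorDual f x = 0) :
    x ∈ LinearMap.range (PiTensorProduct.map φ) := by
  classical
  choose ψ hψ using fun i => (φ i).exists_leftInverse_of_injective (LinearMap.ker_eq_bot.2 (hφ i))
  -- `x` is fixed by the projection `⨂ (φ i ∘ ψ i)`, which differs from the identity by a sum of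
  -- tensor products of maps one of which is `1 - φ i ∘ ψ i`.
  have hfix (f : ∀ i, Module.Dual F (W i)) (s : Finset κ) :
      piTensorDual (s.piecewise (fun i => f i ∘ₗ φ i ∘ₗ ψ i) f) x = piTensorDual f x := by
    induction s using Finset.induction_on with
    | empty => rw [Finset.piecewise_empty]
    | insert i s hi ih =>
      rw [← ih, Finset.piecewise_insert, ← sub_eq_zero, ← LinearMap.sub_apply]
      nth_rewrite 2 [← Function.update_eq_self i (s.piecewise _ f)]
      rw [← MultilinearMap.map_update_sub]
      refine h _ ⟨i, ?_⟩
      rw [Function.update_self, Finset.piecewise_eq_of_notMem _ _ _ hi, LinearMap.sub_comp,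
        LinearMap.comp_assoc, LinearMap.comp_assoc, hψ, LinearMap.comp_id, sub_self]
  refine ⟨PiTensorProduct.map ψ x, sub_eq_zero.1 ?_⟩
  refine eq_zero_of_forall_piTensorDual_eq_zero fun f => ?_
  rw [map_sub, sub_eq_zero, ← LinearMap.comp_apply, ← LinearMap.comp_apply,
    piTensorDual_comp_map, piTensorDual_comp_map]
  simpa [LinearMap.comp_assoc] using hfix f Finset.univ

/-- The contraction `⨂ xⱼ ↦ (∏_{j ≠ i} fⱼ xⱼ) • xᵢ` of a tensor product to its `i`-th factor. -/
def piTensorContract [DecidableEq κ] (f : ∀ i, Module.Dual F (W i)) (i : κ) :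
    (⨂[F] i, W i) →ₗ[F] W i :=
  PiTensorProduct.lift <| MultilinearMap.mk'
    (fun x => (∏ j ∈ Finset.univ.erase i, f j (x j)) • x i)
    (fun x k a b => by
      obtain rfl | hik := eq_or_ne i k
      · simp [prod_dual_update_of_notMem]
      · simp [← Finset.mul_prod_erase _ _ (show k ∈ Finset.univ.erase i by simp [hik.symm]),
          prod_dual_update_of_notMem, hik, add_mul, add_smul])
    (fun x k c a => by
      obtain rfl | hik := eq_or_ne i k
      · simp [prod_dual_update_of_notMem, smul_comm c]
      · simp [← Finset.mul_prod_erase _ _ (show k ∈ Finset.univ.erase i by simp [hik.symm]),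
          prod_dual_update_of_notMem, hik, mul_assoc, mul_smul])

@[simp]
theorem piTensorContract_tprod [DecidableEq κ] (f : ∀ i, Module.Dual F (W i)) (i : κ)
    (x : ∀ i, W i) : piTensorContract f i (PiTensorProduct.tprod F x) =
      (∏ j ∈ Finset.univ.erase i, f j (x j)) • x i :=
  PiTensorProduct.lift.tprod x

theorem dual_comp_piTensorContract [DecidableEq κ] (f : ∀ i, Module.Dual F (W i)) (i : κ) :
    f i ∘ₗ piTensorContract f i = piTensorDual f := by
  ext x
  simp [Finset.prod_erase_mul]

end PiTensor

/-! ### Socles of outer tensor products -/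

section Clifford

variable {F : Type*} [Field F] {Γ Δ : Type*} [Group Γ] [Group Δ] {X : Type*} [AddCommGroup X]
  [Module F X]

theorem exists_isSimpleModule_le {R M : Type*} [Ring R] [IsArtinianRing R] [AddCommGroup M]
    [Module R M] {N : Submodule R M} (hN : N ≠ ⊥) : ∃ S ≤ N, IsSimpleModule R S := by
  obtain ⟨x, hxN, hx⟩ := N.exists_mem_ne_zero_of_ne_bot hN
  have : IsAtomic (Submodule R (R ∙ x)) := isAtomic_of_orderBot_wellFounded_lt wellFounded_lt
  have : Nontrivial (R ∙ x) := Submodule.nontrivial_iff_ne_bot.2 (by simpa using hx)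
  obtain ⟨S, hS⟩ := IsAtomic.exists_atom (Submodule R (R ∙ x))
  refine ⟨S.map (R ∙ x).subtype, (Submodule.map_subtype_le _ _).trans (by simpa using hxN), ?_⟩
  have := isSimpleModule_iff_isAtom.2 hS
  exact IsSimpleModule.congr (S.equivMapOfInjective _ (Submodule.injective_subtype _)).symm

theorem map_moduleSocle_le {R M N : Type*} [Ring R] [AddCommGroup M] [Module R M]
    [AddCommGroup N] [Module R N] (f : M →ₗ[R] N) :
    (moduleSocle R M).map f ≤ moduleSocle R N := by
  rw [Submodule.map_le_iff_le_comap]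
  refine sSup_le fun S (hS : IsSimpleModule R S) => ?_
  rw [← Submodule.map_le_iff_le_comap, ← LinearMap.range_domRestrict]
  obtain h | h := (f.domRestrict S).injective_or_eq_zero
  · exact le_sSup (IsSimpleModule.congr (LinearEquiv.ofInjective _ h).symm)
  · simp [h]

/-- The automorphism of the lattice of subrepresentations of the restriction to a normal subgroup
which is given by the action of an element of the whole group. -/
def conjSubrepresentation (ρ : Representation F Γ X) (φ : Δ →* Γ) [φ.range.Normal] :
    Γ → Subrepresentation (ρ.comp φ : Representation F Δ X) ≃o
      Subrepresentation (ρ.comp φ : Representation F Δ X) := fun g =>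
  have hconj (g : Γ) (U : Subrepresentation (ρ.comp φ : Representation F Δ X)) (d : Δ) ⦃x : X⦄
      (hx : ρ g x ∈ U) : ρ g (ρ (φ d) x) ∈ U := by
    obtain ⟨d', hd'⟩ := (inferInstance : φ.range.Normal).conj_mem (φ d) ⟨d, rfl⟩ g
    rw [← Module.End.mul_apply, ← map_mul, ← inv_mul_cancel_right (g * φ d) g, ← hd', map_mul]
    exact U.apply_mem_toSubmodule d' hx
  { toFun U := ⟨U.toSubmodule.comap (ρ g), hconj g U⟩
    invFun U := ⟨U.toSubmodule.comap (ρ g⁻¹), hconj g⁻¹ U⟩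
    left_inv U := by ext x; simp
    right_inv U := by ext x; simp
    map_rel_iff' {U U'} := by
      refine ⟨fun h x hx => ?_, fun h x hx => h hx⟩
      have hx' : ρ g (ρ g⁻¹ x) ∈ U' := h (show ρ g (ρ g⁻¹ x) ∈ U by simpa using hx)
      simpa using hx' }

theorem apply_mem_socle_comp (ρ : Representation F Γ X) (φ : Δ →* Γ) [φ.range.Normal] (g : Γ)
    {x : X} (hx : ρ g x ∈ socle (ρ.comp φ : Representation F Δ X)) :
    x ∈ socle (ρ.comp φ : Representation F Δ X) := by
  let f := Subrepresentation.subrepresentationSubmoduleOrderIso.symm.trans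
    ((conjSubrepresentation ρ φ g).trans Subrepresentation.subrepresentationSubmoduleOrderIso)
  have hf := orderIso_map_sSup_isAtom f
  rw [← moduleSocle_eq_sSup_isAtom] at hf
  exact hf.le hx

theorem socle_le_socle_comp [Finite Δ] (ρ : Representation F Γ X) (φ : Δ →* Γ) [φ.range.Normal] :
    (socle ρ).toSubmodule ≤ (socle (ρ.comp φ : Representation F Δ X)).toSubmodule := by
  let S : Subrepresentation ρ :=
    { toSubmodule := (socle (ρ.comp φ : Representation F Δ X)).toSubmodule
      apply_mem_toSubmodule g x hx := by
        refine apply_mem_socle_comp ρ φ g⁻¹ ?_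
        rwa [Representation.inv_self_apply] }
  suffices moduleSocle F[Γ] ρ.asModule ≤ S.asSubmodule from this
  refine sSup_le fun N (hN : IsSimpleModule F[Γ] N) => ?_
  have hN := isSimpleModule_iff_isAtom.1 hN
  rw [← hN.not_disjoint_iff_le]
  intro hdisj
  let N' : Subrepresentation (ρ.comp φ : Representation F Δ X) :=
    { toSubmodule := (Subrepresentation.ofSubmodule' N).toSubmodule
      apply_mem_toSubmodule d := (Subrepresentation.ofSubmodule' N).apply_mem_toSubmodule (φ d) }
  have hN' : N'.asSubmodule ≠ ⊥ := by
    obtain ⟨x, hxN, hx⟩ := N.exists_mem_ne_zero_of_ne_bot hN.1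
    exact (Submodule.ne_bot_iff _).2 ⟨x, hxN, hx⟩
  have : IsArtinianRing F[Δ] := IsArtinianRing.of_finite F F[Δ]
  obtain ⟨T, hTN, hT⟩ := exists_isSimpleModule_le hN'
  obtain ⟨x, hxT, hx⟩ := T.exists_mem_ne_zero_of_ne_bot (isSimpleModule_iff_isAtom.1 hT).1
  exact hx (Submodule.disjoint_def.1 hdisj x (hTN hxT) (le_sSup (a := T) hT hxT))

end Clifford

section OuterSocle

variable {F : Type*} [Field F]

theorem apply_mem_socle {Γ X X' : Type*} [Group Γ] [AddCommGroup X] [Module F X] [AddCommGroup X']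
    [Module F X'] {ρ : Representation F Γ X} {ρ' : Representation F Γ X'}
    (φ : ρ.IntertwiningMap ρ') {x : X} (hx : x ∈ socle ρ) : φ x ∈ socle ρ' :=
  map_moduleSocle_le (Representation.IntertwiningMap.equivLinearMapAsModule ρ ρ' φ) ⟨x, hx, rfl⟩

theorem mem_socle_of_isIrreducible {Γ X : Type*} [Group Γ] [AddCommGroup X] [Module F X]
    (ρ : Representation F Γ X) [ρ.IsIrreducible] (x : X) : x ∈ socle ρ := by
  have : IsSimpleModule F[Γ] ρ.asModule := ρ.irreducible_iff_isSimpleModule_asModule.1 ‹_›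
  have hle : (⊤ : Submodule F[Γ] ρ.asModule) ≤ moduleSocle F[Γ] ρ.asModule :=
    le_sSup (isSimpleModule_iff_isAtom.2 isAtom_top)
  exact hle trivial

theorem mem_span_of_mem_socle {Γ X : Type*} [Group Γ] [AddCommGroup X] [Module F X]
    (ρ : Representation F Γ X) {x : X} (hx : x ∈ socle ρ) :
    x ∈ Submodule.span F
      {y : X | ∃ N : Submodule F[Γ] ρ.asModule, IsSimpleModule F[Γ] N ∧ y ∈ N} := by
  change x ∈ moduleSocle F[Γ] ρ.asModule at hx
  rw [moduleSocle, sSup_eq_iSup'] at hx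
  induction hx using Submodule.iSup_induction' with
  | mem N y hy => exact Submodule.subset_span ⟨N, N.2, hy⟩
  | zero => exact zero_mem _
  | add y z _ _ hy hz => exact add_mem hy hz

/-- The inclusion of a subrepresentation, as an intertwining map. -/
def subrepresentationSubtype {Γ X : Type*} [Group Γ] [AddCommGroup X] [Module F X]
    {ρ : Representation F Γ X} (U : Subrepresentation ρ) :
    U.toRepresentation.IntertwiningMap ρ where
  toLinearMap := U.toSubmodule.subtype
  isIntertwining' _ := rfl

theorem isIrreducible_toRepresentation_ofSubmodule' {Γ X : Type*} [Group Γ] [AddCommGroup X]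
    [Module F X] (ρ : Representation F Γ X) (N : Submodule F[Γ] ρ.asModule)
    [IsSimpleModule F[Γ] N] :
    (Subrepresentation.ofSubmodule' N).toRepresentation.IsIrreducible := by
  rw [Representation.irreducible_iff_isSimpleModule_asModule]
  let f := Representation.IntertwiningMap.equivLinearMapAsModule _ _
    (subrepresentationSubtype (Subrepresentation.ofSubmodule' N))
  have hf : Function.Injective f := Subtype.val_injective
  have hrange : LinearMap.range f = N := by
    ext x
    exact ⟨fun ⟨y, hy⟩ => hy ▸ y.2, fun hx => ⟨⟨x, hx⟩, rfl⟩⟩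
  exact IsSimpleModule.congr ((LinearEquiv.ofInjective f hf).trans (LinearEquiv.ofEq _ _ hrange))

variable {κ : Type*} {S : κ → Type*} [∀ i, Group (S i)] {W W' : κ → Type*}
  [∀ i, AddCommGroup (W i)] [∀ i, Module F (W i)] [∀ i, AddCommGroup (W' i)]
  [∀ i, Module F (W' i)] {τ : ∀ i, Representation F (S i) (W i)}
  {τ' : ∀ i, Representation F (S i) (W' i)}

/-- The outer tensor product of intertwining maps. -/
def outerPiMap (φ : ∀ i, (τ i).IntertwiningMap (τ' i)) :
    (outerPiTensor τ).IntertwiningMap (outerPiTensor τ') where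
  toLinearMap := PiTensorProduct.map fun i => (φ i).toLinearMap
  isIntertwining' g := by
    change _ ∘ₗ PiTensorProduct.map _ = PiTensorProduct.map _ ∘ₗ _
    rw [← PiTensorProduct.map_comp, ← PiTensorProduct.map_comp]
    congr 1
    funext i
    exact (φ i).isIntertwining' (g i)

@[simp]
theorem outerPiMap_tprod (φ : ∀ i, (τ i).IntertwiningMap (τ' i)) (x : ∀ i, W i) :
    outerPiMap φ (PiTensorProduct.tprod F x) = PiTensorProduct.tprod F fun i => φ i (x i) :=
  PiTensorProduct.map_tprod _ x

variable (τ) in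
/-- A contraction of an outer tensor product to one of its factors, as an intertwining map. -/
def outerPiContract [Fintype κ] [DecidableEq κ] (f : ∀ i, Module.Dual F (W i)) (i : κ) :
    Representation.IntertwiningMap
      ((outerPiTensor τ).comp (MonoidHom.mulSingle S i) : Representation F (S i) _) (τ i) where
  toLinearMap := piTensorContract f i
  isIntertwining' g := by
    ext x
    have hprod : ∏ j ∈ Finset.univ.erase i, f j (τ j (Pi.mulSingle i g j) (x j)) =
        ∏ j ∈ Finset.univ.erase i, f j (x j) := Finset.prod_congr rfl fun j hj => by
      rw [Pi.mulSingle_eq_of_ne (Finset.ne_of_mem_erase hj), map_one, Module.End.one_apply]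
    change piTensorContract f i (PiTensorProduct.map _ (PiTensorProduct.tprod F x)) =
      τ i g (piTensorContract f i (PiTensorProduct.tprod F x))
    simp [hprod]

variable [Finite κ] [∀ i, Finite (S i)]

theorem isIrreducible_outerPiTensor [IsAlgClosed F] (h : ∀ i, (τ i).IsIrreducible) :
    (outerPiTensor τ).IsIrreducible := by
  cases nonempty_fintype κ
  have hfd (i) : FiniteDimensional F (W i) :=
    have := h i
    finiteDimensional_of_isIrreducible (τ i)
  have hnt (i) : Nontrivial (W i) := by
    have : IsSimpleModule F[S i] (τ i).asModule :=
      ((τ i).irreducible_iff_isSimpleModule_asModule).1 (h i)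
    exact IsSimpleModule.nontrivial F[S i] (τ i).asModule
  choose v hv using fun i => exists_ne (0 : W i)
  choose f hf using fun i => exists_dual_apply_eq_one (F := F) (hv i)
  have hne : PiTensorProduct.tprod F v ≠ 0 := fun h0 => by
    simpa [hf] using congrArg (piTensorDual f) h0
  have : Nontrivial (Subrepresentation (outerPiTensor τ)) :=
    ⟨⊥, ⊤, fun h0 => hne ((Submodule.mem_bot F).1 <|
      (congrArg Subrepresentation.toSubmodule h0).ge (Submodule.mem_top (R := F)))⟩
  refine { eq_bot_or_eq_top := fun U => or_iff_not_imp_left.2 fun hU => ?_ }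
  obtain ⟨x, hxU, hx⟩ := (Submodule.ne_bot_iff U.toSubmodule).1 fun h0 =>
    hU (Subrepresentation.ext h0)
  obtain ⟨f, hfx⟩ : ∃ f, piTensorDual f x ≠ 0 := by
    contrapose! hx
    exact eq_zero_of_forall_piTensorDual_eq_zero hx
  -- By density some element of the group algebra acts as `y ↦ piTensorDual f y • ⨂ vᵢ`.
  have hmem (v : ∀ i, W i) : PiTensorProduct.tprod F v ∈ U.toSubmodule := by
    choose a ha _ using fun i => exists_asAlgebraHom_eq (κ := Unit) (fun _ => τ i) (fun _ => h i)
      (fun a b hab => absurd (Subsingleton.elim a b) hab) () ((f i).smulRight (v i))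
    have hrank : PiTensorProduct.map (fun i => (f i).smulRight (v i)) =
        (piTensorDual f).smulRight (PiTensorProduct.tprod F v) := by
      ext y
      simp [MultilinearMap.map_smul_univ]
    have hax : (outerPiTensor τ).asAlgebraHom (pureElement a) x ∈ U :=
      U.asSubmodule.smul_mem (pureElement a) hxU
    rw [asAlgebraHom_outerPiTensor] at hax
    simp only [ha, hrank, LinearMap.smulRight_apply] at hax
    exact (U.toSubmodule.smul_mem_iff hfx).1 hax
  exact SetLike.ext fun y => ⟨fun _ => Submodule.mem_top, fun _ =>
    mem_of_forall_tprod_mem U.toSubmodule hmem y⟩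

theorem tprod_mem_socle [IsAlgClosed F] {x : ∀ i, W i} (hx : ∀ i, x i ∈ socle (τ i)) :
    PiTensorProduct.tprod F x ∈ socle (outerPiTensor τ) := by
  refine tprod_mem_of_forall_mem (socle (outerPiTensor τ)).toSubmodule
    (s := fun i => {y | ∃ N : Submodule F[S i] (τ i).asModule, IsSimpleModule F[S i] N ∧ y ∈ N})
    (fun y hy => ?_) fun i => ?_
  · choose N hN hyN using hy
    let U (i) := Subrepresentation.ofSubmodule' (N i)
    have : (outerPiTensor fun i => (U i).toRepresentation).IsIrreducible :=
      isIrreducible_outerPiTensor fun i => isIrreducible_toRepresentation_ofSubmodule' (τ i) (N i)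
    have hmem := apply_mem_socle (outerPiMap fun i => subrepresentationSubtype (U i))
      (mem_socle_of_isIrreducible (outerPiTensor fun i => (U i).toRepresentation)
        (PiTensorProduct.tprod F fun i => ⟨y i, hyN i⟩))
    rwa [outerPiMap_tprod] at hmem
  · exact mem_span_of_mem_socle (τ i) (hx i)

theorem range_outerPiMap_eq_socle [IsAlgClosed F] (φ : ∀ i, (τ' i).IntertwiningMap (τ i))
    (hφ : ∀ i, Function.Injective (φ i)) (hsoc : ∀ i, (φ i).range = socle (τ i)) :
    (outerPiMap φ).range = socle (outerPiTensor τ) := by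
  classical
  cases nonempty_fintype κ
  refine SetLike.ext fun x => ⟨?_, fun hx => ?_⟩
  · rintro ⟨y, rfl⟩
    refine mem_of_forall_tprod_mem ((socle (outerPiTensor τ)).toSubmodule.comap
      (outerPiMap φ).toLinearMap) (fun y => ?_) y
    change outerPiMap φ _ ∈ socle _
    rw [outerPiMap_tprod]
    exact tprod_mem_socle fun i => (hsoc i).le ⟨y i, rfl⟩
  · refine mem_range_map_of_forall_piTensorDual_eq_zero hφ fun f ⟨i, hfi⟩ => ?_
    have : (MonoidHom.mulSingle S i).range.Normal := ⟨by
      rintro _ ⟨d, rfl⟩ g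
      exact ⟨g i * d * (g i)⁻¹, by ext j; obtain rfl | hij := eq_or_ne i j <;> simp [*]⟩⟩
    obtain ⟨y, hy⟩ : piTensorContract f i x ∈ (φ i).range := by
      rw [hsoc]
      exact apply_mem_socle (outerPiContract τ f i)
        (socle_le_socle_comp (outerPiTensor τ) (MonoidHom.mulSingle S i) hx)
    rw [← dual_comp_piTensorContract f i, LinearMap.comp_apply, ← hy]
    exact LinearMap.congr_fun hfi y

end OuterSocle

/-! ### Induced modules -/

section Ind

variable {k G H A : Type*} [CommRing k] [Group G] [Group H] {φ : G →* H} [AddCommGroup A]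
  [Module k A] (ρ : Representation k G A)

theorem ind_mk_one (g : G) (x : A) :
    Representation.ind φ ρ (φ g) (Representation.IndV.mk φ ρ 1 x) =
      Representation.IndV.mk φ ρ 1 (ρ g x) := by
  have h := Representation.Coinvariants.mk_self_apply
    (Representation.tprod ((Representation.leftRegular k H).comp φ) ρ) g
    (MonoidAlgebra.single (φ g)⁻¹ 1 ⊗ₜ x)
  rw [Representation.tprod_apply, TensorProduct.map_tmul] at h
  rw [Representation.ind_mk, one_mul]
  simpa using h.symm

theorem mem_of_forall_ind_mk_one_mem (p : Submodule k (Representation.IndV φ ρ))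
    (h : ∀ g x, Representation.ind φ ρ g (Representation.IndV.mk φ ρ 1 x) ∈ p)
    (z : Representation.IndV φ ρ) : z ∈ p := by
  have hp : p.mkQ = 0 := by
    refine Representation.IndV.hom_ext φ ρ fun g => LinearMap.ext fun x => ?_
    have hx := h g⁻¹ x
    rw [Representation.ind_mk, one_mul, inv_inv] at hx
    simpa [Submodule.Quotient.mk_eq_zero] using hx
  simpa [Submodule.Quotient.mk_eq_zero] using LinearMap.congr_fun hp z

variable {ρ} in
theorem indV_mk_one_injective_of_retraction (c : H → A →ₗ[k] A)
    (hc : ∀ g x, c (φ g * x) ∘ₗ ρ g = c x) (hc1 : c 1 = LinearMap.id) :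
    Function.Injective (Representation.IndV.mk φ ρ 1) := by
  let R : k[H] ⊗[k] A →ₗ[k] A := TensorProduct.lift
    ((Finsupp.linearCombination k c).comp (MonoidAlgebra.coeffLinearEquiv k).toLinearMap)
  have hR (x : H) (a : A) : R (MonoidAlgebra.single x 1 ⊗ₜ a) = c x a := by simp [R]
  let R' := Representation.Coinvariants.lift
    (Representation.tprod ((Representation.leftRegular k H).comp φ) ρ) R fun g =>
      TensorProduct.ext (MonoidAlgebra.lhom_ext' fun x => LinearMap.ext_ring
        (LinearMap.ext fun a => by simpa [hR] using LinearMap.congr_fun (hc g x) a))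
  refine Function.LeftInverse.injective (g := R') fun a => ?_
  change R (MonoidAlgebra.single 1 1 ⊗ₜ a) = a
  rw [hR, hc1, LinearMap.id_apply]

theorem indV_mk_one_injective (hφ : Function.Injective φ) :
    Function.Injective (Representation.IndV.mk φ ρ 1) := by
  let c : H → A →ₗ[k] A := Function.extend φ (fun g => ρ g⁻¹) 0
  have hc (g : G) : c (φ g) = ρ g⁻¹ := hφ.extend_apply _ _ _
  refine indV_mk_one_injective_of_retraction c (fun g x => ?_)
    (by rw [← map_one φ, hc, inv_one, map_one, Module.End.one_eq_id])
  by_cases hx : ∃ g', φ g' = x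
  · obtain ⟨g', rfl⟩ := hx
    rw [← map_mul, hc, hc, ← Module.End.mul_eq_comp, ← map_mul, mul_inv_rev, inv_mul_cancel_right]
  · have hx' : ¬ ∃ g', φ g' = φ g * x := fun ⟨g', hg'⟩ =>
      hx ⟨g⁻¹ * g', by rw [map_mul, hg', map_inv, inv_mul_cancel_left]⟩
    rw [show c x = 0 from Function.extend_apply' _ _ _ hx,
      show c (φ g * x) = 0 from Function.extend_apply' _ _ _ hx', LinearMap.zero_comp]

end Ind

theorem coeff_mapDomainAlgHom_apply {F Γ Δ : Type*} [Field F] [Group Γ] [Group Δ] {φ : Γ →* Δ}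
    (hφ : Function.Injective φ) (x : F[Γ]) (g : Γ) :
    (MonoidAlgebra.mapDomainAlgHom F F φ x).coeff (φ g) = x.coeff g :=
  Finsupp.mapDomain_apply hφ x.coeff g

section PureElementSigma

variable {F G ι κ : Type*} [Field F] [Group G] [Finite G] [Fintype κ] {β : ι → Type*}
  [∀ i, Fintype (β i)] (e : (Σ i, β i) ≃ κ) (c : (κ → G) →* ∀ i, β i → G)

theorem mapDomainAlgHom_pureElement_sigma [Fintype ι] (hc : ∀ g i x, c g i x = g (e ⟨i, x⟩))
    (a : κ → F[G]) :
    MonoidAlgebra.mapDomainAlgHom F F c (pureElement a) =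
      pureElement fun i => pureElement fun x => a (e ⟨i, x⟩) := by
  have hinj : Function.Injective c := fun g g' hg => funext fun j => by
    obtain ⟨⟨i, x⟩, rfl⟩ := e.surjective j
    rw [← hc g, hg, hc]
  ext g
  obtain ⟨g, rfl⟩ : ∃ g', c g' = g :=
    ⟨fun j => g (e.symm j).1 (e.symm j).2, funext fun i => funext fun x => by
      rw [hc, e.symm_apply_apply]⟩
  rw [coeff_mapDomainAlgHom_apply hinj]
  simp only [coeff_pureElement, hc]
  rw [← e.prod_comp, Fintype.prod_sigma]

theorem asAlgebraHom_outerPiTensor_comp_sigma [Finite ι] {W : ι → Type*}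
    [∀ i, AddCommGroup (W i)] [∀ i, Module F (W i)] (τ : ∀ i, Representation F (β i → G) (W i))
    (hc : ∀ g i x, c g i x = g (e ⟨i, x⟩)) (a : κ → F[G]) :
    Representation.asAlgebraHom ((outerPiTensor τ).comp c : Representation F (κ → G) _)
        (pureElement a) =
      PiTensorProduct.map fun i => (τ i).asAlgebraHom (pureElement fun x => a (e ⟨i, x⟩)) := by
  cases nonempty_fintype ι
  rw [asAlgebraHom_comp, mapDomainAlgHom_pureElement_sigma e c hc, asAlgebraHom_outerPiTensor]

end PureElementSigma

/-! ### Tensor products over the blocks -/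

section Blocks

variable {F : Type u} [Field F] {G : Type v} [Group G]

section Block

variable {V : Type w} [AddCommGroup V] [Module F V] (ρ : Representation F G V) {ι : Type}

theorem wreathPower_inl (g : ι → G) :
    wreathPower ρ ι (SemidirectProduct.inl g) = PiTensorProduct.map fun i => ρ (g i) := by
  refine PiTensorProduct.ext (MultilinearMap.ext fun x => ?_)
  change PiTensorProduct.map _ (PiTensorProduct.reindex F _ _ (PiTensorProduct.tprod F x)) = _
  rw [PiTensorProduct.reindex_tprod]
  rfl

theorem wreathPower_inr_tprod (w : Equiv.Perm ι) (x : ι → V) :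
    wreathPower ρ ι (SemidirectProduct.inr w) (PiTensorProduct.tprod F x) =
      PiTensorProduct.tprod F fun i => x (w.symm i) := by
  change PiTensorProduct.map _ (PiTensorProduct.reindex F _ _ (PiTensorProduct.tprod F x)) = _
  rw [PiTensorProduct.reindex_tprod, PiTensorProduct.map_tprod]
  simp

variable {L : Type*} [AddCommGroup L] [Module F L] (τ : Representation F (Equiv.Perm ι) L)

theorem wreathTensor_inl (g : ι → G) : wreathTensor ρ τ (SemidirectProduct.inl g) =
    TensorProduct.map (PiTensorProduct.map fun i => ρ (g i)) LinearMap.id := by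
  change TensorProduct.map (wreathPower ρ ι (SemidirectProduct.inl g))
    (τ (SemidirectProduct.rightHom (SemidirectProduct.inl g))) = _
  rw [wreathPower_inl, SemidirectProduct.rightHom_inl, map_one]
  rfl

theorem wreathTensor_inr_tmul (w : Equiv.Perm ι) (x : ι → V) (l : L) :
    wreathTensor ρ τ (SemidirectProduct.inr w) (PiTensorProduct.tprod F x ⊗ₜ l) =
      (PiTensorProduct.tprod F fun i => x (w.symm i)) ⊗ₜ τ w l := by
  rw [← wreathPower_inr_tprod ρ]
  rfl

theorem asAlgebraHom_wreathTensor_inl [Finite G] [Fintype ι] (a : ι → F[G]) :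
    Representation.asAlgebraHom ((wreathTensor ρ τ).comp SemidirectProduct.inl :
      Representation F (ι → G) _) (pureElement a) =
        TensorProduct.map (PiTensorProduct.map fun i => ρ.asAlgebraHom (a i)) LinearMap.id := by
  have hmap (z : F[ι → G]) : Representation.asAlgebraHom ((wreathTensor ρ τ).comp
      SemidirectProduct.inl : Representation F (ι → G) _) z =
        TensorProduct.map ((outerPiTensor fun _ : ι => ρ).asAlgebraHom z) LinearMap.id := by
    induction z using MonoidAlgebra.induction_linear with
    | zero => simp
    | add x y hx hy => rw [map_add, hx, hy, map_add, TensorProduct.map_add_left]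
    | single g c =>
      rw [Representation.asAlgebraHom_single, Representation.asAlgebraHom_single,
        TensorProduct.map_smul_left]
      exact congrArg (c • ·) (wreathTensor_inl ρ τ g)
  rw [hmap, asAlgebraHom_outerPiTensor]

end Block

variable {r : ℕ} {V : Fin r → Type w} [∀ i, AddCommGroup (V i)] [∀ i, Module F (V i)]

variable (G) in
/-- The base group `G^n` as a subgroup of `∏ G_{n_i}`, for a bijection of the letters of the
blocks with the `n` letters. -/
def blockBase {d : Fin r → ℕ} {n : ℕ} (e : (Σ i, Fin (d i)) ≃ Fin n) :
    (Fin n → G) →* ∀ i, Wreath G (Fin (d i)) where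
  toFun g i := SemidirectProduct.inl fun x => g (e ⟨i, x⟩)
  map_one' := rfl
  map_mul' g g' := funext fun i =>
    map_mul SemidirectProduct.inl (fun x => g (e ⟨i, x⟩)) (fun x => g' (e ⟨i, x⟩))

theorem blockBase_apply {d : Fin r → ℕ} {n : ℕ} (e : (Σ i, Fin (d i)) ≃ Fin n) (g : Fin n → G)
    (i : Fin r) : blockBase G e g i = SemidirectProduct.inl fun x => g (e ⟨i, x⟩) := rfl

variable (G) in
/-- The subgroup `∏ S_{n_i}` of `∏ G_{n_i}`. -/
def blockPerm (d : Fin r → ℕ) :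
    (∀ i, Equiv.Perm (Fin (d i))) →* ∀ i, Wreath G (Fin (d i)) where
  toFun w i := SemidirectProduct.inr (w i)
  map_one' := rfl
  map_mul' w w' := funext fun i => map_mul SemidirectProduct.inr (w i) (w' i)

theorem blockPerm_apply (d : Fin r → ℕ) (w : ∀ i, Equiv.Perm (Fin (d i))) (i : Fin r) :
    blockPerm G d w i = SemidirectProduct.inr (w i) := rfl

variable (ρ : ∀ i, Representation F G (V i)) {L : Fin r → SymRep F}

/-- The pure tensors `⨂ zᵢ` in `YoungSpace V L`. -/
def youngTprod (z : ∀ i, (⨂[F] _ : Fin (L i).deg, V i) ⊗[F] (L i).carrier) : YoungSpace V L :=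
  PiTensorProduct.tprod F z

theorem youngSpace_hom_ext {W : Type*} [AddCommGroup W] [Module F W]
    {φ φ' : YoungSpace V L →ₗ[F] W} (h : ∀ z, φ (youngTprod z) = φ' (youngTprod z)) : φ = φ' :=
  PiTensorProduct.ext (R := F) (MultilinearMap.ext h)

theorem youngRep_youngTprod (g : ∀ i, Wreath G (Fin (L i).deg))
    (z : ∀ i, (⨂[F] _ : Fin (L i).deg, V i) ⊗[F] (L i).carrier) :
    youngRep ρ L g (youngTprod z) =
      youngTprod fun i => wreathTensor (ρ i) (L i).rep (g i) (z i) :=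
  PiTensorProduct.map_tprod _ _

theorem asAlgebraHom_youngRep_blockBase [Finite G] {n : ℕ} (e : (Σ i, Fin (L i).deg) ≃ Fin n)
    (a : Fin n → F[G]) (z : ∀ i, (⨂[F] _ : Fin (L i).deg, V i) ⊗[F] (L i).carrier) :
    Representation.asAlgebraHom ((youngRep ρ L).comp (blockBase G e) :
      Representation F (Fin n → G) _) (pureElement a) (youngTprod z) =
      youngTprod fun i => TensorProduct.map
        (PiTensorProduct.map fun x => (ρ i).asAlgebraHom (a (e ⟨i, x⟩))) LinearMap.id (z i) := by
  let c : (Fin n → G) →* ∀ i, Fin (L i).deg → G :=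
    { toFun := fun g i x => g (e ⟨i, x⟩), map_one' := rfl, map_mul' := fun _ _ => rfl }
  have hc := LinearMap.congr_fun (asAlgebraHom_outerPiTensor_comp_sigma e c (fun i =>
    ((wreathTensor (ρ i) (L i).rep).comp SemidirectProduct.inl :
      Representation F (Fin (L i).deg → G) _)) (fun _ _ _ => rfl) a) (PiTensorProduct.tprod F z)
  rw [PiTensorProduct.map_tprod] at hc
  exact hc.trans (congrArg (PiTensorProduct.tprod F) (funext fun i =>
    LinearMap.congr_fun (asAlgebraHom_wreathTensor_inl (ρ i) (L i).rep _) (z i)))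

/-- The embedding `⨂ lᵢ ↦ ⨂ (vᵢ^{⊗ nᵢ} ⊗ lᵢ)` of the multiplicity space. -/
def blockEmb (v : ∀ i, V i) : (⨂[F] i, (L i).carrier) →ₗ[F] YoungSpace V L :=
  PiTensorProduct.map fun i => TensorProduct.mk F (⨂[F] _ : Fin (L i).deg, V i) (L i).carrier
    (PiTensorProduct.tprod F fun _ => v i)

/-- The projection `⨂ (xᵢ ⊗ lᵢ) ↦ (∏ fᵢ^{⊗ nᵢ} xᵢ) • ⨂ lᵢ` to the multiplicity space. -/
def blockProj (f : ∀ i, Module.Dual F (V i)) : YoungSpace V L →ₗ[F] ⨂[F] i, (L i).carrier :=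
  PiTensorProduct.map fun i => (TensorProduct.lid F (L i).carrier).toLinearMap ∘ₗ
    TensorProduct.map (piTensorDual fun _ : Fin (L i).deg => f i) LinearMap.id

theorem blockEmb_tprod (v : ∀ i, V i) (l : ∀ i, (L i).carrier) :
    blockEmb v (PiTensorProduct.tprod F l) =
      youngTprod (V := V) (L := L) fun i => (PiTensorProduct.tprod F fun _ => v i) ⊗ₜ[F] l i :=
  PiTensorProduct.map_tprod (R := F) _ _

theorem blockProj_youngTprod (f : ∀ i, Module.Dual F (V i))
    (z : ∀ i, (⨂[F] _ : Fin (L i).deg, V i) ⊗[F] (L i).carrier) :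
    blockProj f (youngTprod z) = PiTensorProduct.tprod F fun i =>
      TensorProduct.lid F (L i).carrier
        (TensorProduct.map (piTensorDual fun _ => f i) LinearMap.id (z i)) :=
  PiTensorProduct.map_tprod (R := F) _ _

theorem blockProj_blockBase_blockEmb {n : ℕ} (e : (Σ i, Fin (L i).deg) ≃ Fin n) (v : ∀ i, V i)
    (f : ∀ i, Module.Dual F (V i)) (g : Fin n → G) (y : ⨂[F] i, (L i).carrier) :
    blockProj f (youngRep ρ L (blockBase G e g) (blockEmb v y)) =
      (∏ q : Σ i, Fin (L i).deg, f q.1 (ρ q.1 (g (e q)) (v q.1))) • y := by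
  suffices (blockProj f ∘ₗ youngRep ρ L (blockBase G e g)) ∘ₗ blockEmb v =
      (∏ q : Σ i, Fin (L i).deg, f q.1 (ρ q.1 (g (e q)) (v q.1))) • LinearMap.id from
    LinearMap.congr_fun this y
  refine PiTensorProduct.ext (MultilinearMap.ext fun l => ?_)
  simp only [LinearMap.compMultilinearMap_apply, LinearMap.comp_apply, blockEmb_tprod,
    youngRep_youngTprod, blockProj_youngTprod, LinearMap.smul_apply, LinearMap.id_apply,
    blockBase_apply, wreathTensor_inl, TensorProduct.map_tmul, PiTensorProduct.map_tprod,
    piTensorDual_tprod, TensorProduct.lid_tmul]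
  rw [MultilinearMap.map_smul_univ, Fintype.prod_sigma]

theorem youngRep_blockPerm_blockEmb (v : ∀ i, V i) (w : ∀ i, Equiv.Perm (Fin (L i).deg))
    (y : ⨂[F] i, (L i).carrier) :
    youngRep ρ L (blockPerm G (fun i => (L i).deg) w) (blockEmb v y) =
      blockEmb v (outerPiTensor (fun i => (L i).rep) w y) := by
  suffices youngRep ρ L (blockPerm G (fun i => (L i).deg) w) ∘ₗ blockEmb v =
      blockEmb v ∘ₗ outerPiTensor (fun i => (L i).rep) w from LinearMap.congr_fun this y
  refine PiTensorProduct.ext (MultilinearMap.ext fun l => ?_)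
  have hw : outerPiTensor (fun i => (L i).rep) w (PiTensorProduct.tprod F l) =
    PiTensorProduct.tprod F fun i => (L i).rep (w i) (l i) := PiTensorProduct.map_tprod _ _
  simp only [LinearMap.compMultilinearMap_apply, LinearMap.comp_apply, hw, blockEmb_tprod,
    youngRep_youngTprod, blockPerm_apply, wreathTensor_inr_tmul]

theorem asAlgebraHom_blockBase_eq_blockEmb_blockProj [Finite G] {n : ℕ}
    (e : (Σ i, Fin (L i).deg) ≃ Fin n) {a : Fin n → F[G]} {v : ∀ i, V i}
    {f : ∀ i, Module.Dual F (V i)}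
    (ha : ∀ q x, (ρ q.1).asAlgebraHom (a (e q)) x = f q.1 x • v q.1) (m : YoungSpace V L) :
    Representation.asAlgebraHom ((youngRep ρ L).comp (blockBase G e) :
      Representation F (Fin n → G) _) (pureElement a) m = blockEmb v (blockProj f m) := by
  refine LinearMap.congr_fun (g := blockEmb v ∘ₗ blockProj f)
    (youngSpace_hom_ext fun z => ?_) m
  rw [asAlgebraHom_youngRep_blockBase, LinearMap.comp_apply, blockProj_youngTprod, blockEmb_tprod]
  refine congrArg youngTprod (funext fun i => LinearMap.congr_fun (g := TensorProduct.mk F _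
    (L i).carrier (PiTensorProduct.tprod F fun _ => v i) ∘ₗ
      (TensorProduct.lid F (L i).carrier).toLinearMap ∘ₗ
        TensorProduct.map (piTensorDual fun _ => f i) LinearMap.id) ?_ (z i))
  refine TensorProduct.ext (PiTensorProduct.ext (MultilinearMap.ext fun x =>
    LinearMap.ext fun l => ?_))
  have hx (j : Fin (L i).deg) : (ρ i).asAlgebraHom (a (e ⟨i, j⟩)) (x j) = f i (x j) • v i :=
    ha ⟨i, j⟩ (x j)
  simp [hx, MultilinearMap.map_smul_univ, TensorProduct.smul_tmul']

end Blocks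

/-! ### Permutations of the blocks -/

section YoungPerm

variable {r n : ℕ} (d : Fin r → ℕ) (h : ∑ i, d i = n)

/-- The decomposition of `Fin n` into consecutive blocks of lengths `d i`, as in
`Wreath.youngHom`. -/
def youngEquiv : (Σ i, Fin (d i)) ≃ Fin n := finSigmaFinEquiv.trans (finCongr h)

/-- The block containing a letter, as a colouring of `Fin n`. -/
def youngColour (j : Fin n) : Fin r := ((youngEquiv d h).symm j).1

/-- The embedding of the Young subgroup `∏ S_{d i}` in `S_n`. -/
def youngPerm : (∀ i, Equiv.Perm (Fin (d i))) →* Equiv.Perm (Fin n) :=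
  (youngEquiv d h).permCongrHom.toMonoidHom.comp
    (Equiv.Perm.sigmaCongrRightHom fun i => Fin (d i))

variable {d}

@[simp]
theorem youngColour_youngEquiv (q : Σ i, Fin (d i)) :
    youngColour d h (youngEquiv d h q) = q.1 := by
  simp [youngColour]

theorem youngPerm_youngEquiv (w : ∀ i, Equiv.Perm (Fin (d i))) (q : Σ i, Fin (d i)) :
    youngPerm d h w (youngEquiv d h q) = youngEquiv d h ⟨q.1, w q.1 q.2⟩ :=
  congrArg (fun q => youngEquiv d h (Equiv.Perm.sigmaCongrRight w q))
    ((youngEquiv d h).symm_apply_apply q)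

@[simp]
theorem youngColour_youngPerm (w : ∀ i, Equiv.Perm (Fin (d i))) (j : Fin n) :
    youngColour d h (youngPerm d h w j) = youngColour d h j := by
  obtain ⟨q, rfl⟩ := (youngEquiv d h).surjective j
  rw [youngPerm_youngEquiv, youngColour_youngEquiv, youngColour_youngEquiv]

theorem youngPerm_injective : Function.Injective (youngPerm d h) :=
  (youngEquiv d h).permCongrHom.injective.comp Equiv.Perm.sigmaCongrRightHom_injective

theorem exists_youngPerm_eq {w : Equiv.Perm (Fin n)}
    (hw : ∀ j, youngColour d h (w j) = youngColour d h j) : ∃ w', w = youngPerm d h w' := by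
  have hy (i) (x : Fin (d i)) : ∃ y : Fin (d i),
      w (youngEquiv d h ⟨i, x⟩) = youngEquiv d h ⟨i, y⟩ := by
    obtain ⟨⟨i', y⟩, hq⟩ := (youngEquiv d h).surjective (w (youngEquiv d h ⟨i, x⟩))
    obtain rfl : i' = i := by
      simpa [← hq] using hw (youngEquiv d h ⟨i, x⟩)
    exact ⟨y, hq.symm⟩
  choose y hy using hy
  have hinj (i) : Function.Injective (y i) := fun x x' hx => by
    have hxx' : w (youngEquiv d h ⟨i, x⟩) = w (youngEquiv d h ⟨i, x'⟩) := by rw [hy, hy, hx]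
    simpa using hxx'
  refine ⟨fun i => Equiv.ofBijective (y i) (Finite.injective_iff_bijective.1 (hinj i)),
    Equiv.ext fun j => ?_⟩
  obtain ⟨⟨i, x⟩, rfl⟩ := (youngEquiv d h).surjective j
  rw [youngPerm_youngEquiv, hy]
  rfl

variable {G : Type v} [Group G]

theorem youngHom_blockBase (g : Fin n → G) :
    Wreath.youngHom d h (blockBase G (youngEquiv d h) g) = SemidirectProduct.inl g :=
  SemidirectProduct.ext (funext fun j => congrArg g ((youngEquiv d h).apply_symm_apply j))
    (map_one (youngPerm d h))

theorem youngHom_blockPerm (w : ∀ i, Equiv.Perm (Fin (d i))) :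
    Wreath.youngHom d h (blockPerm G d w) = SemidirectProduct.inr (youngPerm d h w) := rfl

theorem youngHom_injective : Function.Injective (Wreath.youngHom (G := G) d h) := by
  intro x y hxy
  have hright : (fun i => (x i).right) = fun i => (y i).right :=
    youngPerm_injective h (congrArg SemidirectProduct.right hxy)
  have hleft (q : Σ i, Fin (d i)) : (x q.1).left q.2 = (y q.1).left q.2 := by
    have hq : (x ((youngEquiv d h).symm (youngEquiv d h q)).1).left
        ((youngEquiv d h).symm (youngEquiv d h q)).2 =
      (y ((youngEquiv d h).symm (youngEquiv d h q)).1).left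
        ((youngEquiv d h).symm (youngEquiv d h q)).2 :=
      congrFun (congrArg SemidirectProduct.left hxy) (youngEquiv d h q)
    rwa [Equiv.symm_apply_apply] at hq
  exact funext fun i => SemidirectProduct.ext (funext fun a => hleft ⟨i, a⟩) (congrFun hright i)

theorem Wreath.inl_mul_inr {ι : Type} (g : ι → G) (w : Equiv.Perm ι) :
    (SemidirectProduct.inl g * SemidirectProduct.inr w : Wreath G ι) =
      SemidirectProduct.inr w * SemidirectProduct.inl (g ∘ w) := by
  refine SemidirectProduct.ext (funext fun i => ?_) (by simp)
  simp [Wreath.mul_left_apply]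

end YoungPerm

/-! ### Corners of induced modules -/

theorem map_mem_span_image {A B : Type*} [Ring A] [Ring B] (f : A →+* B) {s : Set A} {u : A}
    (hu : u ∈ TwoSidedIdeal.span s) : f u ∈ TwoSidedIdeal.span (f '' s) :=
  map_mem_of_mem_span f.toAddMonoidHom (TwoSidedIdeal.span (f '' s)) (fun c a ha d => by
    simpa using TwoSidedIdeal.mul_mem_right _ _ _ (TwoSidedIdeal.mul_mem_left _ _ _
      (TwoSidedIdeal.subset_span (Set.mem_image_of_mem f ha)))) hu

section WreathCorner

variable {F : Type u} [Field F] {G : Type v} [Group G] {r : ℕ}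

/-- The pure tensor `⨂ⱼ ε_{c j}` in `F[G^ι]` given by elements `εᵢ` of `F[G]` and a colouring `c`
of the letters. -/
def colourElement {ι : Type*} [Finite G] [Fintype ι] (ε : Fin r → F[G]) (c : ι → Fin r) :
    F[ι → G] :=
  pureElement fun j => ε (c j)

variable {V : Fin r → Type w} [∀ i, AddCommGroup (V i)] [∀ i, Module F (V i)]
  (ρ : ∀ i, Representation F G (V i)) (L : Fin r → SymRep F) {n : ℕ} (h : ∑ i, (L i).deg = n)

/-- The canonical map from the module over `∏ G_{n_i}` to the induced module over `G_n`. -/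
def wreathEmb : YoungSpace V L →ₗ[F]
    Representation.IndV (Wreath.youngHom (G := G) (fun i => (L i).deg) h) (youngRep ρ L) :=
  Representation.IndV.mk _ _ 1

theorem wreathInd_inl_wreathEmb (g : Fin n → G) (m : YoungSpace V L) :
    wreathInd ρ L h (SemidirectProduct.inl g) (wreathEmb ρ L h m) =
      wreathEmb ρ L h (youngRep ρ L (blockBase G (youngEquiv _ h) g) m) := by
  rw [← youngHom_blockBase]
  exact ind_mk_one _ _ _

theorem wreathInd_inr_youngPerm_wreathEmb (w : ∀ i, Equiv.Perm (Fin (L i).deg))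
    (m : YoungSpace V L) :
    wreathInd ρ L h (SemidirectProduct.inr (youngPerm _ h w)) (wreathEmb ρ L h m) =
      wreathEmb ρ L h (youngRep ρ L (blockPerm G _ w) m) := by
  rw [← youngHom_blockPerm]
  exact ind_mk_one _ _ _

theorem wreathInd_inr_inr (τ w : Equiv.Perm (Fin n))
    (x : Representation.IndV (Wreath.youngHom (G := G) (fun i => (L i).deg) h) (youngRep ρ L)) :
    wreathInd ρ L h (SemidirectProduct.inr τ) (wreathInd ρ L h (SemidirectProduct.inr w) x) =
      wreathInd ρ L h (SemidirectProduct.inr (τ * w)) x := by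
  rw [map_mul, map_mul, Module.End.mul_apply]

theorem wreathInd_inl_inr_wreathEmb (g : Fin n → G) (w : Equiv.Perm (Fin n))
    (m : YoungSpace V L) :
    wreathInd ρ L h (SemidirectProduct.inl g)
        (wreathInd ρ L h (SemidirectProduct.inr w) (wreathEmb ρ L h m)) =
      wreathInd ρ L h (SemidirectProduct.inr w)
        (wreathEmb ρ L h (youngRep ρ L (blockBase G (youngEquiv _ h) (g ∘ w)) m)) := by
  rw [← wreathInd_inl_wreathEmb, ← Module.End.mul_apply, ← map_mul, Wreath.inl_mul_inr, map_mul,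
    Module.End.mul_apply]

theorem wreathInd_inr_wreathEmb (γ : Wreath G (Fin n)) (w : Equiv.Perm (Fin n))
    (m : YoungSpace V L) :
    wreathInd ρ L h γ (wreathInd ρ L h (SemidirectProduct.inr w) (wreathEmb ρ L h m)) =
      wreathInd ρ L h (SemidirectProduct.inr (γ.right * w)) (wreathEmb ρ L h
        (youngRep ρ L (blockBase G (youngEquiv _ h) (γ.left ∘ ⇑(γ.right * w))) m)) := by
  conv_lhs => rw [← SemidirectProduct.inl_left_mul_inr_right γ, map_mul]
  rw [← wreathInd_inl_inr_wreathEmb, ← wreathInd_inr_inr, Module.End.mul_apply]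

theorem mem_of_forall_wreathInd_inr_wreathEmb_mem
    (p : Submodule F (Representation.IndV (Wreath.youngHom (G := G) (fun i => (L i).deg) h)
      (youngRep ρ L)))
    (hp : ∀ w m, wreathInd ρ L h (SemidirectProduct.inr w) (wreathEmb ρ L h m) ∈ p)
    (x : Representation.IndV (Wreath.youngHom (G := G) (fun i => (L i).deg) h)
      (youngRep ρ L)) : x ∈ p := by
  refine mem_of_forall_ind_mk_one_mem _ p (fun γ m => ?_) x
  have hγ := wreathInd_inr_wreathEmb ρ L h γ 1 m
  rw [map_one, map_one, Module.End.one_apply] at hγ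
  exact hγ ▸ hp _ _

/-- The action of the group algebra of the base group `G^n` on the induced module. -/
def baseAction : F[Fin n → G] →ₐ[F] Module.End F
    (Representation.IndV (Wreath.youngHom (G := G) (fun i => (L i).deg) h) (youngRep ρ L)) :=
  Representation.asAlgebraHom
    ((wreathInd ρ L h).comp SemidirectProduct.inl : Representation F (Fin n → G) _)

/-- The embedding in the induced module of the multiplicity space `⨂ Lᵢ`, translated by a
permutation. -/
def wreathCornerEmb (v : ∀ i, V i) (s : Equiv.Perm (Fin n)) : (⨂[F] i, (L i).carrier) →ₗ[F]
    Representation.IndV (Wreath.youngHom (G := G) (fun i => (L i).deg) h) (youngRep ρ L) :=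
  wreathInd ρ L h (SemidirectProduct.inr s) ∘ₗ wreathEmb ρ L h ∘ₗ blockEmb v

theorem mapDomainAlgHom_pureElement_comp [Finite G] {ι : Type*} [Fintype ι] (w : Equiv.Perm ι)
    {c : (ι → G) →* (ι → G)} (hc : ∀ g, c g = g ∘ w) (a : ι → F[G]) :
    MonoidAlgebra.mapDomainAlgHom F F c (pureElement a) = pureElement (a ∘ w) := by
  have hinj : Function.Injective c := fun g g' hg =>
    w.surjective.injective_comp_right (by rwa [hc, hc] at hg)
  ext g
  obtain ⟨g, rfl⟩ : ∃ g', c g' = g := ⟨g ∘ w.symm, by rw [hc]; ext; simp⟩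
  rw [coeff_mapDomainAlgHom_apply hinj, coeff_pureElement, coeff_pureElement, hc]
  exact (Equiv.prod_comp w fun j => (a j).coeff (g j)).symm

variable {ρ L}

theorem wreathCornerEmb_injective {v : ∀ i, V i} {f : ∀ i, Module.Dual F (V i)}
    (hf : ∀ i, f i (v i) = 1) (s : Equiv.Perm (Fin n)) :
    Function.Injective (wreathCornerEmb ρ L h v s) := by
  have hblock : blockProj f ∘ₗ blockEmb (L := L) v = LinearMap.id :=
    PiTensorProduct.ext (MultilinearMap.ext fun l => by
      simp [blockEmb_tprod, blockProj_youngTprod, hf])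
  exact (((wreathInd ρ L h).apply_bijective _).1.comp
    (indV_mk_one_injective _ (youngHom_injective h))).comp
      (Function.LeftInverse.injective (LinearMap.congr_fun hblock))

theorem asAlgebraHom_comp_mapDomainAlgHom {Γ : Type*} [Group Γ] {θ : Γ →* Wreath G (Fin n)}
    {b : (Fin n → G) →* Γ} (hb : θ.comp b = SemidirectProduct.inl) (z : F[Fin n → G]) :
    Representation.asAlgebraHom ((wreathInd ρ L h).comp θ : Representation F Γ _)
      (MonoidAlgebra.mapDomainAlgHom F F b z) = baseAction ρ L h z := by
  rw [← asAlgebraHom_comp, baseAction, ← hb]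
  rfl

variable [Finite G]

theorem baseAction_pureElement_apply (a : Fin n → F[G]) (w : Equiv.Perm (Fin n))
    (m : YoungSpace V L) :
    baseAction ρ L h (pureElement a)
        (wreathInd ρ L h (SemidirectProduct.inr w) (wreathEmb ρ L h m)) =
      wreathInd ρ L h (SemidirectProduct.inr w) (wreathEmb ρ L h
        (Representation.asAlgebraHom ((youngRep ρ L).comp (blockBase G (youngEquiv _ h)) :
          Representation F (Fin n → G) _) (pureElement (a ∘ w)) m)) := by
  let c : (Fin n → G) →* (Fin n → G) :=
    { toFun := fun g => g ∘ w, map_one' := rfl, map_mul' := fun _ _ => rfl }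
  rw [← mapDomainAlgHom_pureElement_comp w (c := c) fun _ => rfl]
  generalize pureElement a = z
  induction z using MonoidAlgebra.induction_linear with
  | zero => simp
  | add x y hx hy => simp only [map_add, LinearMap.add_apply, hx, hy]
  | single g s =>
    rw [MonoidAlgebra.mapDomainAlgHom_apply, MonoidAlgebra.mapDomain_single, baseAction,
      Representation.asAlgebraHom_single, Representation.asAlgebraHom_single,
      LinearMap.smul_apply, LinearMap.smul_apply, map_smul, map_smul]
    exact congrArg (s • ·) (wreathInd_inl_inr_wreathEmb ρ L h g w m)

theorem baseAction_pureElement_apply_eq_zero {a : Fin n → F[G]} {w : Equiv.Perm (Fin n)}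
    {q : Σ i, Fin (L i).deg} (hq : (ρ q.1).asAlgebraHom (a (w (youngEquiv _ h q))) = 0)
    (m : YoungSpace V L) :
    baseAction ρ L h (pureElement a)
      (wreathInd ρ L h (SemidirectProduct.inr w) (wreathEmb ρ L h m)) = 0 := by
  rw [baseAction_pureElement_apply]
  have hblock : (PiTensorProduct.map fun x => (ρ q.1).asAlgebraHom
      ((a ∘ w) (youngEquiv _ h ⟨q.1, x⟩))) = 0 :=
    PiTensorProduct.ext (MultilinearMap.ext fun z => by
      simp only [LinearMap.compMultilinearMap_apply, PiTensorProduct.map_tprod]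
      exact MultilinearMap.map_coord_zero _ q.2 (LinearMap.congr_fun hq (z q.2)))
  suffices Representation.asAlgebraHom ((youngRep ρ L).comp (blockBase G (youngEquiv _ h)) :
      Representation F (Fin n → G) _) (pureElement (a ∘ w)) = 0 by simp [this]
  refine youngSpace_hom_ext fun z => ?_
  rw [asAlgebraHom_youngRep_blockBase, LinearMap.zero_apply]
  refine MultilinearMap.map_coord_zero (PiTensorProduct.tprod F) q.1 ?_
  rw [hblock, TensorProduct.map_zero_left, LinearMap.zero_apply]

theorem baseAction_pureElement_apply_eq_self {a : Fin n → F[G]} {w : Equiv.Perm (Fin n)}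
    (ha : ∀ q : Σ i, Fin (L i).deg, (ρ q.1).asAlgebraHom (a (w (youngEquiv _ h q))) = 1)
    (m : YoungSpace V L) :
    baseAction ρ L h (pureElement a)
        (wreathInd ρ L h (SemidirectProduct.inr w) (wreathEmb ρ L h m)) =
      wreathInd ρ L h (SemidirectProduct.inr w) (wreathEmb ρ L h m) := by
  rw [baseAction_pureElement_apply]
  suffices Representation.asAlgebraHom ((youngRep ρ L).comp (blockBase G (youngEquiv _ h)) :
      Representation F (Fin n → G) _) (pureElement (a ∘ w)) = LinearMap.id by
    rw [this, LinearMap.id_apply]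
  refine youngSpace_hom_ext fun z => ?_
  rw [asAlgebraHom_youngRep_blockBase, LinearMap.id_apply]
  refine congrArg youngTprod (funext fun i => ?_)
  have hx (x) : (ρ i).asAlgebraHom ((a ∘ w) (youngEquiv _ h ⟨i, x⟩)) = LinearMap.id := ha ⟨i, x⟩
  simp only [hx, PiTensorProduct.map_id, TensorProduct.map_id, LinearMap.id_apply]

theorem wreathInd_inr_mul_baseAction_mul (a : Fin n → F[G]) (τ : Equiv.Perm (Fin n)) :
    wreathInd ρ L h (SemidirectProduct.inr τ) * baseAction ρ L h (pureElement a) *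
        wreathInd ρ L h (SemidirectProduct.inr τ⁻¹) =
      baseAction ρ L h (pureElement (a ∘ τ.symm)) := by
  refine LinearMap.ext fun x => ?_
  refine mem_of_forall_wreathInd_inr_wreathEmb_mem ρ L h (LinearMap.eqLocus _ _)
    (fun w m => ?_) x
  rw [LinearMap.mem_eqLocus, Module.End.mul_apply, Module.End.mul_apply, wreathInd_inr_inr,
    baseAction_pureElement_apply, wreathInd_inr_inr, mul_inv_cancel_left,
    baseAction_pureElement_apply]
  rfl

/-- The pure tensor belonging to a colouring is the projection to the summand belonging to this
colouring in the Mackey decomposition of the restriction to the base group. -/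
theorem baseAction_sum_colourElement {u : Fin r → F[G]} (hu : ∀ i, (ρ i).asAlgebraHom (u i) = 1)
    (hu0 : ∀ i j, j ≠ i → (ρ j).asAlgebraHom (u i) = 0) :
    baseAction ρ L h (∑ c ∈ Finset.univ.image
      fun w : Equiv.Perm (Fin n) => youngColour _ h ∘ w.symm, colourElement u c) = 1 := by
  refine LinearMap.ext fun x => mem_of_forall_wreathInd_inr_wreathEmb_mem ρ L h
    (LinearMap.eqLocus _ 1) (fun w m => ?_) x
  have hw := Finset.mem_image_of_mem (fun w : Equiv.Perm (Fin n) =>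
    youngColour (fun i => (L i).deg) h ∘ w.symm) (Finset.mem_univ w)
  rw [LinearMap.mem_eqLocus, map_sum, LinearMap.sum_apply, Module.End.one_apply,
    Finset.sum_eq_single_of_mem _ hw]
  · exact baseAction_pureElement_apply_eq_self h
      (a := fun j => u (youngColour _ h (w.symm j))) (fun q => by simp [hu]) m
  · intro c _ hc
    obtain ⟨j, hj⟩ := Function.ne_iff.1 hc
    obtain ⟨q, hq⟩ := (youngEquiv (fun i => (L i).deg) h).surjective (w.symm j)
    have hwq : w (youngEquiv _ h q) = j := by rw [hq, Equiv.apply_symm_apply]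
    rw [Function.comp_apply, ← hq, youngColour_youngEquiv] at hj
    exact baseAction_pureElement_apply_eq_zero h (a := fun j => u (c j)) (q := q)
      (hwq ▸ hu0 _ _ hj.symm) m

section RankOne

variable {ε : Fin r → F[G]} {v : ∀ i, V i} {f : ∀ i, Module.Dual F (V i)}

namespace IsRankOneSystem

theorem baseAction_apply (H : IsRankOneSystem ρ ε v f) (s : Equiv.Perm (Fin n))
    (m : YoungSpace V L) :
    baseAction ρ L h (colourElement ε (youngColour _ h ∘ s.symm))
        (wreathInd ρ L h (SemidirectProduct.inr s) (wreathEmb ρ L h m)) =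
      wreathCornerEmb ρ L h v s (blockProj f m) := by
  rw [colourElement, baseAction_pureElement_apply, asAlgebraHom_blockBase_eq_blockEmb_blockProj
    (v := v) (f := f) _ _ fun q x => ?_]
  · rfl
  · simpa using H.asAlgebraHom_apply q.1 x

theorem baseAction_apply_eq_zero (H : IsRankOneSystem ρ ε v f) {s w : Equiv.Perm (Fin n)}
    (hw : ∀ w', w ≠ s * youngPerm _ h w') (m : YoungSpace V L) :
    baseAction ρ L h (colourElement ε (youngColour _ h ∘ s.symm))
      (wreathInd ρ L h (SemidirectProduct.inr w) (wreathEmb ρ L h m)) = 0 := by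
  obtain ⟨j, hj⟩ : ∃ j, youngColour _ h ((s⁻¹ * w) j) ≠ youngColour _ h j := by
    by_contra! hc
    obtain ⟨w', hw'⟩ := exists_youngPerm_eq h hc
    exact hw w' (by rw [← hw', mul_inv_cancel_left])
  obtain ⟨q, rfl⟩ := (youngEquiv (fun i => (L i).deg) h).surjective j
  rw [youngColour_youngEquiv, Equiv.Perm.mul_apply, Equiv.Perm.inv_def] at hj
  exact baseAction_pureElement_apply_eq_zero h (a := fun j => ε (youngColour _ h (s.symm j)))
    (q := q) (H.asAlgebraHom_of_ne _ _ hj.symm) m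

theorem exists_baseAction_eq (H : IsRankOneSystem ρ ε v f) (s : Equiv.Perm (Fin n))
    (x : Representation.IndV (Wreath.youngHom (G := G) (fun i => (L i).deg) h) (youngRep ρ L)) :
    ∃ y, baseAction ρ L h (colourElement ε (youngColour _ h ∘ s.symm)) x =
      wreathCornerEmb ρ L h v s y := by
  have hx := mem_of_forall_wreathInd_inr_wreathEmb_mem ρ L h
    ((LinearMap.range (wreathCornerEmb ρ L h v s)).comap
      (baseAction ρ L h (colourElement ε (youngColour _ h ∘ s.symm)))) (fun w m => ?_) x
  · exact hx.imp fun _ => Eq.symm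
  rw [Submodule.mem_comap]
  by_cases hw : ∃ w', w = s * youngPerm _ h w'
  · obtain ⟨w', rfl⟩ := hw
    rw [← wreathInd_inr_inr, wreathInd_inr_youngPerm_wreathEmb, H.baseAction_apply]
    exact ⟨_, rfl⟩
  · rw [H.baseAction_apply_eq_zero h (not_exists.1 hw)]
    exact zero_mem _

theorem baseAction_wreathInd_eq_zero (H : IsRankOneSystem ρ ε v f) {s s' : Equiv.Perm (Fin n)}
    {γ : Wreath G (Fin n)} (hw : ∀ w, γ.right * s' ≠ s * youngPerm _ h w)
    (y : ⨂[F] i, (L i).carrier) :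
    baseAction ρ L h (colourElement ε (youngColour _ h ∘ s.symm))
      (wreathInd ρ L h γ (wreathCornerEmb ρ L h v s' y)) = 0 := by
  rw [wreathCornerEmb, LinearMap.comp_apply, LinearMap.comp_apply, wreathInd_inr_wreathEmb,
    H.baseAction_apply_eq_zero h hw]

theorem baseAction_wreathInd (H : IsRankOneSystem ρ ε v f) {s s' : Equiv.Perm (Fin n)}
    {γ : Wreath G (Fin n)} {w : ∀ i, Equiv.Perm (Fin (L i).deg)}
    (hw : γ.right * s' = s * youngPerm _ h w) (y : ⨂[F] i, (L i).carrier) :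
    baseAction ρ L h (colourElement ε (youngColour _ h ∘ s.symm))
        (wreathInd ρ L h γ (wreathCornerEmb ρ L h v s' y)) =
      wreathCornerEmb ρ L h v s
        ((∏ j, f (youngColour _ h (s.symm j))
          (ρ _ (γ.left j) (v (youngColour _ h (s.symm j))))) •
            outerPiTensor (fun i => (L i).rep) w y) := by
  have hγ : wreathInd ρ L h γ (wreathCornerEmb ρ L h v s' y) =
      wreathInd ρ L h (SemidirectProduct.inr s) (wreathEmb ρ L h
        (youngRep ρ L (blockBase G (youngEquiv _ h) (γ.left ∘ s))
          (blockEmb v (outerPiTensor (fun i => (L i).rep) w y)))) := by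
    rw [wreathCornerEmb, LinearMap.comp_apply, LinearMap.comp_apply, wreathInd_inr_wreathEmb, hw,
      ← wreathInd_inl_inr_wreathEmb, ← wreathInd_inr_inr, wreathInd_inr_youngPerm_wreathEmb,
      youngRep_blockPerm_blockEmb, wreathInd_inl_inr_wreathEmb]
  rw [hγ, H.baseAction_apply, blockProj_blockBase_blockEmb,
    ← Equiv.prod_comp ((youngEquiv _ h).trans s)]
  congr 2
  refine Finset.prod_congr rfl fun q _ => ?_
  have hq : youngColour (fun i => (L i).deg) h (s.symm (((youngEquiv _ h).trans s) q)) = q.1 := by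
    simp
  rw [hq]
  rfl

end IsRankOneSystem

/-- The permutations `s k` represent the double cosets of the Young subgroup `∏ S_{d i}` under the
image of `Γ`, and `q k : Q k → ∏ S_{d i}` is the stabilizer of the coset of `s k`: the combinatorial
data of Mackey's formula for the restriction along `θ`. -/
structure IsMackeySystem {d : Fin r → ℕ} (h : ∑ i, d i = n) {Γ : Type*} [Group Γ]
    (θ : Γ →* Wreath G (Fin n)) {K : Type*} (s : K → Equiv.Perm (Fin n)) {Q : K → Type*}
    [∀ k, Group (Q k)] (q : ∀ k, Q k →* ∀ i, Equiv.Perm (Fin (d i))) : Prop where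
  eq_and_mem_range : ∀ k l γ w,
    (θ γ).right * s l = s k * youngPerm d h w → k = l ∧ w ∈ (q k).range
  exists_apply_eq : ∀ k σ,
    ∃ γ, θ γ = SemidirectProduct.inr (s k * youngPerm d h (q k σ) * (s k)⁻¹)
  exists_eq_mul : ∀ w, ∃ k γ τ w', θ γ = SemidirectProduct.inr τ ∧ w = τ * s k * youngPerm d h w'

section Mackey

variable {Γ : Type*} [Group Γ] {θ : Γ →* Wreath G (Fin n)} {b : (Fin n → G) →* Γ}
  {K : Type*} {s : K → Equiv.Perm (Fin n)} {Q : K → Type*} [∀ k, Group (Q k)]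
  {q : ∀ k, Q k →* ∀ i, Equiv.Perm (Fin (L i).deg)}

theorem IsMackeySystem.exists_asAlgebraHom_eq_baseAction (M : IsMackeySystem h θ s q)
    (hb : θ.comp b = SemidirectProduct.inl) {u : Fin r → F[G]}
    (hu : ∀ i, u i ∈ TwoSidedIdeal.span {ε i}) (w : Equiv.Perm (Fin n)) :
    ∃ a ∈ TwoSidedIdeal.span (Set.range fun k => MonoidAlgebra.mapDomainAlgHom F F b
        (colourElement ε (youngColour _ h ∘ (s k).symm))),
      Representation.asAlgebraHom ((wreathInd ρ L h).comp θ : Representation F Γ _) a =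
        baseAction ρ L h (colourElement u (youngColour _ h ∘ w.symm)) := by
  obtain ⟨k, γ, τ, w', hγ, rfl⟩ := M.exists_eq_mul w
  refine ⟨MonoidAlgebra.single γ 1 * MonoidAlgebra.mapDomainAlgHom F F b
    (colourElement u (youngColour _ h ∘ (s k).symm)) * MonoidAlgebra.single γ⁻¹ 1, ?_, ?_⟩
  · refine TwoSidedIdeal.mul_mem_right _ _ _ (TwoSidedIdeal.mul_mem_left _ _ _ ?_)
    have hspan := map_mem_span_image (MonoidAlgebra.mapDomainAlgHom F F b).toRingHom
      (pureElement_mem_span fun j => hu (youngColour _ h ((s k).symm j)))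
    rw [Set.image_singleton] at hspan
    refine TwoSidedIdeal.span_mono ?_ hspan
    exact Set.singleton_subset_iff.2 ⟨k, rfl⟩
  · have hcolour : youngColour (fun i => (L i).deg) h ∘ (τ * s k * youngPerm _ h w').symm =
        (youngColour _ h ∘ (s k).symm) ∘ τ.symm := funext fun j => by
      rw [Function.comp_apply, ← youngColour_youngPerm h w']
      simp [← Equiv.Perm.inv_def]
    rw [map_mul, map_mul, asAlgebraHom_comp_mapDomainAlgHom h hb, hcolour,
      Representation.asAlgebraHom_single_one, Representation.asAlgebraHom_single_one,
      MonoidHom.comp_apply, MonoidHom.comp_apply, map_inv, hγ, ← map_inv SemidirectProduct.inr]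
    exact wreathInd_inr_mul_baseAction_mul h _ τ

theorem IsMackeySystem.exists_asAlgebraHom_eq_one (M : IsMackeySystem h θ s q)
    (hb : θ.comp b = SemidirectProduct.inl) (H : IsRankOneSystem ρ ε v f) :
    ∃ a ∈ TwoSidedIdeal.span (Set.range fun k => MonoidAlgebra.mapDomainAlgHom F F b
        (colourElement ε (youngColour _ h ∘ (s k).symm))),
      Representation.asAlgebraHom ((wreathInd ρ L h).comp θ : Representation F Γ _) a = 1 := by
  choose u hu hu1 using H.exists_asAlgebraHom_eq_one
  have hu0 (i j) (hji : j ≠ i) : (ρ j).asAlgebraHom (u i) = 0 :=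
    asAlgebraHom_eq_zero_of_mem_span (ρ j) (H.asAlgebraHom_of_ne i j hji) (hu i)
  rw [← baseAction_sum_colourElement h hu1 hu0, map_sum]
  refine Finset.sum_induction _ (fun y => ∃ a ∈ TwoSidedIdeal.span _,
    Representation.asAlgebraHom ((wreathInd ρ L h).comp θ : Representation F Γ _) a = y)
    ?_ ⟨0, zero_mem _, map_zero _⟩ fun c hc => ?_
  · rintro _ _ ⟨a, ha, rfl⟩ ⟨a', ha', rfl⟩
    exact ⟨a + a', add_mem ha ha', map_add _ _ _⟩
  · obtain ⟨w, -, rfl⟩ := Finset.mem_image.1 hc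
    exact M.exists_asAlgebraHom_eq_baseAction h hb hu w

/-- The case distinction in `hT` and `hT0` is the one between elements of `Γ` which fix the coset of
`s k` and elements which move it. -/
theorem IsMackeySystem.isModuleCorner (M : IsMackeySystem h θ s q)
    (hb : θ.comp b = SemidirectProduct.inl) (H : IsRankOneSystem ρ ε v f)
    (T : ∀ k, Γ → F[Q k])
    (hT : ∀ k γ σ, (θ γ).right * s k = s k * youngPerm _ h (q k σ) →
      T k γ = MonoidAlgebra.single σ (∏ j, f (youngColour _ h ((s k).symm j))
        (ρ _ ((θ γ).left j) (v (youngColour _ h ((s k).symm j))))))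
    (hT0 : ∀ k γ, (∀ σ, (θ γ).right * s k ≠ s k * youngPerm _ h (q k σ)) → T k γ = 0) :
    IsModuleCorner
      (fun k => MonoidAlgebra.mapDomainAlgHom F F b
        (colourElement ε (youngColour _ h ∘ (s k).symm)))
      (fun k => groupAlgebraLift (T k))
      (X := Representation.asModule ((wreathInd ρ L h).comp θ : Representation F Γ _))
      (Y := fun k => Representation.asModule
        ((outerPiTensor fun i => (L i).rep).comp (q k) : Representation F (Q k) _))
      (fun k => (wreathCornerEmb ρ L h v (s k)).toAddMonoidHom) := by
  refine IsModuleCorner.of_rep (S := Q) (Y := fun _ => ⨂[F] i, (L i).carrier)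
    ((wreathInd ρ L h).comp θ : Representation F Γ _)
    (fun k => ((outerPiTensor fun i => (L i).rep).comp (q k) :
      Representation F (Q k) (⨂[F] i, (L i).carrier))) _ T
    (fun k => wreathCornerEmb ρ L h v (s k))
    (fun k => wreathCornerEmb_injective h H.dual_apply (s k)) (fun k σ => ?_) (fun k x => ?_)
    (fun k γ y => ?_) (fun k l hkl γ y => ?_) (M.exists_asAlgebraHom_eq_one h hb H)
  · obtain ⟨γ, hγ⟩ := M.exists_apply_eq k σ
    refine ⟨γ, ?_⟩
    rw [hT k γ σ (by rw [hγ]; simp [mul_assoc]), hγ]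
    simp [H.dual_apply]
  · rw [asAlgebraHom_comp_mapDomainAlgHom h hb]
    exact H.exists_baseAction_eq h (s k) x
  · rw [asAlgebraHom_comp_mapDomainAlgHom h hb, MonoidHom.comp_apply]
    by_cases hσ : ∃ σ, (θ γ).right * s k = s k * youngPerm _ h (q k σ)
    · obtain ⟨σ, hσ⟩ := hσ
      rw [hT k γ σ hσ, Representation.asAlgebraHom_single, H.baseAction_wreathInd h hσ]
      rfl
    · rw [hT0 k γ (not_exists.1 hσ), map_zero, LinearMap.zero_apply, map_zero]
      refine H.baseAction_wreathInd_eq_zero h (fun w hw => hσ ?_) y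
      obtain ⟨σ, rfl⟩ := (M.eq_and_mem_range k k γ w hw).2
      exact ⟨σ, hw⟩
  · rw [asAlgebraHom_comp_mapDomainAlgHom h hb, MonoidHom.comp_apply]
    exact H.baseAction_wreathInd_eq_zero h (fun w hw => hkl (M.eq_and_mem_range k l γ w hw).1) y

end Mackey

end RankOne

end WreathCorner

/-! ### Corners of outer tensor products -/

section OuterTensor

variable {F : Type*} [Field F] {Γ H : Type*} [Group Γ] [Group H]

theorem tensorEquiv_mul (x y : F[Γ] ⊗[F] F[H]) :
    MonoidAlgebra.tensorEquiv F (x * y) =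
      MonoidAlgebra.tensorEquiv F x * MonoidAlgebra.tensorEquiv F y := by
  refine (LinearMap.map_mul_iff (MonoidAlgebra.tensorEquiv F).toLinearMap).2 ?_ x y
  ext
  simp [MonoidAlgebra.single_mul_single]

theorem tensorEquiv_tmul_mem_span {e a : F[Γ]} {ε b : F[H]} (ha : a ∈ TwoSidedIdeal.span {e})
    (hb : b ∈ TwoSidedIdeal.span {ε}) : MonoidAlgebra.tensorEquiv F (a ⊗ₜ b) ∈
      TwoSidedIdeal.span {MonoidAlgebra.tensorEquiv F (e ⊗ₜ ε)} := by
  set I := TwoSidedIdeal.span {MonoidAlgebra.tensorEquiv F (e ⊗ₜ[F] ε)}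
  let β := TensorProduct.mk F F[Γ] F[H] |>.compr₂ (MonoidAlgebra.tensorEquiv F).toLinearMap
  refine map_mem_of_mem_span (β.flip b).toAddMonoidHom I (fun c e' he d => ?_) ha
  refine map_mem_of_mem_span (β (c * e' * d)).toAddMonoidHom I (fun c' ε' hε d' => ?_) hb
  obtain rfl : e' = e := he
  obtain rfl : ε' = ε := hε
  change MonoidAlgebra.tensorEquiv F ((c * e' * d) ⊗ₜ (c' * ε' * d')) ∈ I
  rw [← Algebra.TensorProduct.tmul_mul_tmul, ← Algebra.TensorProduct.tmul_mul_tmul,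
    tensorEquiv_mul, tensorEquiv_mul]
  exact I.mul_mem_right _ _ (I.mul_mem_left _ _ (TwoSidedIdeal.subset_span rfl))

variable {X W : Type*} [AddCommGroup X] [Module F X] [AddCommGroup W] [Module F W]
  (R : Representation F Γ X) (ρ : Representation F H W)

theorem asAlgebraHom_outerTensor_tensorEquiv_tmul (a : F[Γ]) (b : F[H]) :
    (outerTensor R ρ).asAlgebraHom (MonoidAlgebra.tensorEquiv F (a ⊗ₜ b)) =
      TensorProduct.map (R.asAlgebraHom a) (ρ.asAlgebraHom b) := by
  suffices (outerTensor R ρ).asAlgebraHom.toLinearMap ∘ₗ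
      (MonoidAlgebra.tensorEquiv F).toLinearMap =
      TensorProduct.homTensorHomMap (RingHom.id F) X W X W ∘ₗ
        TensorProduct.map R.asAlgebraHom.toLinearMap ρ.asAlgebraHom.toLinearMap from
    LinearMap.congr_fun this (a ⊗ₜ b)
  ext
  simp [outerTensor]

theorem flip_mk_injective {f : Module.Dual F W} {v : W} (hf : f v = 1) :
    Function.Injective ((TensorProduct.mk F X W).flip v) :=
  Function.LeftInverse.injective
    (g := (TensorProduct.rid F X).toLinearMap ∘ₗ TensorProduct.map LinearMap.id f)
    fun x => by simp [hf]

variable {R ρ}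

theorem IsModuleCorner.outerTensor {S Y : Type*} [Group S] [AddCommGroup Y] [Module F Y]
    {τ : Representation F S Y} {e : F[Γ]} {T : Γ → F[S]} {ι : Y →ₗ[F] X}
    (h : IsModuleCorner (K := Unit) (fun _ => e) (fun _ => groupAlgebraLift T) (X := R.asModule)
      (Y := fun _ => τ.asModule) (fun _ => ι.toAddMonoidHom))
    (hT : ∀ σ, ∃ g, T g = MonoidAlgebra.single σ 1) {ε u : F[H]} {v : W} {f : Module.Dual F W}
    (hf : f v = 1) (hε : ∀ x, ρ.asAlgebraHom ε x = f x • v) (hu : u ∈ TwoSidedIdeal.span {ε})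
    (hu1 : ρ.asAlgebraHom u = 1) :
    IsModuleCorner (K := Unit)
      (fun _ => MonoidAlgebra.tensorEquiv F (e ⊗ₜ ε))
      (fun _ => groupAlgebraLift fun x : Γ × H => f (ρ x.2 v) • T x.1)
      (X := (outerTensor R ρ).asModule) (Y := fun _ => τ.asModule)
      (fun _ => ((TensorProduct.mk F X W).flip v ∘ₗ ι).toAddMonoidHom) := by
  refine IsModuleCorner.of_rep (K := Unit) (_root_.outerTensor R ρ) (fun _ => τ)
    (fun _ => MonoidAlgebra.tensorEquiv F (e ⊗ₜ ε)) (fun _ x => f (ρ x.2 v) • T x.1)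
    (fun _ => (TensorProduct.mk F X W).flip v ∘ₗ ι)
    (fun _ => (flip_mk_injective hf).comp (h.injective ())) (fun _ σ => ?_) (fun _ z => ?_)
    (fun _ g y => ?_) (fun k l hkl => absurd rfl hkl) ?_
  · obtain ⟨g, hg⟩ := hT σ
    exact ⟨(g, 1), by simp [hg, hf]⟩
  · rw [asAlgebraHom_outerTensor_tensorEquiv_tmul]
    induction z using TensorProduct.induction_on with
    | zero => exact ⟨0, by simp⟩
    | add x y hx hy =>
      obtain ⟨a, ha⟩ := hx
      obtain ⟨b, hb⟩ := hy
      exact ⟨a + b, by rw [map_add, map_add, ha, hb]⟩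
    | tmul x w =>
      obtain ⟨y, hy⟩ : ∃ y, R.asAlgebraHom e x = ι y := h.exists_smul_eq () x
      exact ⟨f w • y, by simp [hy, hε, TensorProduct.smul_tmul']⟩
  · have hcorner : R.asAlgebraHom e (R g.1 (ι y)) = ι (τ.asAlgebraHom (T g.1) y) := by
      have hsmul : R.asAlgebraHom e (R.asAlgebraHom (MonoidAlgebra.single g.1 1) (ι y)) =
          ι (τ.asAlgebraHom (groupAlgebraLift T (MonoidAlgebra.single g.1 1)) y) :=
        h.smul_smul () (MonoidAlgebra.single g.1 1) y
      rwa [Representation.asAlgebraHom_single_one, groupAlgebraLift_single, one_smul] at hsmul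
    change _ = ι _ ⊗ₜ[F] v
    rw [asAlgebraHom_outerTensor_tensorEquiv_tmul,
      show _root_.outerTensor R ρ g (((TensorProduct.mk F X W).flip v ∘ₗ ι) y) =
        R g.1 (ι y) ⊗ₜ ρ g.2 v from rfl, TensorProduct.map_tmul, hcorner, hε]
    simp [TensorProduct.smul_tmul']
  · obtain ⟨a, ha, ha1⟩ := h.unital
    rw [Set.range_const] at ha ⊢
    refine ⟨_, tensorEquiv_tmul_mem_span ha hu, ?_⟩
    have ha1 : R.asAlgebraHom a = 1 := LinearMap.ext ha1
    rw [asAlgebraHom_outerTensor_tensorEquiv_tmul, ha1, hu1, TensorProduct.map_one]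

end OuterTensor

/-! ### The submodule theorem for Specht modules -/

namespace Tableau

variable {μ : YoungDiagram}

theorem mk_row_col_mem (t : Tableau μ) (x : Fin μ.card) : (t.row x, t.col x) ∈ μ :=
  (YoungDiagram.mem_cells _).1 (Equiv.toFun t x).2

theorem exists_row_col_eq (t : Tableau μ) {i j : ℕ} (h : (i, j) ∈ μ) :
    ∃ x, t.row x = i ∧ t.col x = j := by
  obtain ⟨x, hx⟩ := Equiv.surjective t ⟨(i, j), (YoungDiagram.mem_cells _).2 h⟩
  have hx' : (Equiv.toFun t x).1 = (i, j) := congrArg Subtype.val hx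
  exact ⟨x, congrArg Prod.fst hx', congrArg Prod.snd hx'⟩

theorem exists_smul_eq (t s : Tableau μ) : ∃ σ : Equiv.Perm (Fin μ.card), σ • t = s :=
  ⟨Equiv.trans t (Equiv.symm s), Equiv.ext fun x => by
    change Equiv.toFun t (Equiv.invFun t (Equiv.toFun s x)) = Equiv.toFun s x
    exact Equiv.apply_symm_apply t _⟩

theorem card_col_lt_eq (t s : Tableau μ) (j : ℕ) :
    Finset.card {x | t.col x < j} = Finset.card {x | s.col x < j} := by
  refine Finset.card_equiv (Equiv.trans t (Equiv.symm s)) fun x => ?_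
  have hcol : s.col (Equiv.trans t (Equiv.symm s) x) = t.col x :=
    congrArg (fun c : μ.cells => c.1.2) (Equiv.apply_symm_apply s (Equiv.toFun t x))
  simp [hcol]

/-- The entries of the `i`-th row of `s` lie in distinct columns of `t`, so there are at most
`min j μᵢ` of them in the first `j` columns of `t`. -/
theorem card_col_lt_row_eq_le {t s : Tableau μ}
    (h : ∀ x y, s.row x = s.row y → t.col x = t.col y → x = y) (j i : ℕ) :
    Finset.card {x | t.col x < j ∧ s.row x = i} ≤ Finset.card {x | s.col x < j ∧ s.row x = i} := by
  rcases le_total j (μ.rowLen i) with hj | hj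
  · refine le_trans (b := (Finset.range j).card) ?_ ?_
    · refine Finset.card_le_card_of_injOn t.col (fun x hx => ?_) fun x hx y hy hxy => ?_
      · simpa using (Finset.mem_filter.1 hx).2.1
      · exact h x y ((Finset.mem_filter.1 hx).2.2.trans (Finset.mem_filter.1 hy).2.2.symm) hxy
    · refine Finset.card_le_card_of_surjOn s.col fun c hc => ?_
      have hcj : c < j := by simpa using hc
      obtain ⟨x, hx, hxc⟩ := s.exists_row_col_eq
        (YoungDiagram.mem_iff_lt_rowLen.2 (hcj.trans_le hj))
      exact ⟨x, by simp [hx, hxc, hcj], hxc⟩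
  · refine Finset.card_le_card fun x hx => ?_
    obtain ⟨-, -, rfl⟩ := Finset.mem_filter.1 hx
    have hlt := YoungDiagram.mem_iff_lt_rowLen.1 (s.mk_row_col_mem x)
    simp [hlt.trans_le hj]

theorem card_col_lt_row_eq {t s : Tableau μ}
    (h : ∀ x y, s.row x = s.row y → t.col x = t.col y → x = y) (j : ℕ) (x : Fin μ.card) :
    Finset.card {y | t.col y < j ∧ s.row y = s.row x} =
      Finset.card {y | s.col y < j ∧ s.row y = s.row x} := by
  have hsum (u : Tableau μ) : Finset.card {y | u.col y < j} =
      ∑ i ∈ Finset.univ.image s.row, Finset.card {y | u.col y < j ∧ s.row y = i} := by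
    rw [Finset.card_eq_sum_card_fiberwise (f := s.row) (t := Finset.univ.image s.row)
      fun y _ => Finset.mem_image_of_mem _ (Finset.mem_univ y)]
    simp only [Finset.filter_filter]
  exact (Finset.sum_eq_sum_iff_of_le fun i _ => card_col_lt_row_eq_le h j i).1
    ((hsum t).symm.trans ((card_col_lt_eq t s j).trans (hsum s))) (s.row x)
    (Finset.mem_image_of_mem _ (Finset.mem_univ x))

theorem mk_row_col_mem_of_injective {t s : Tableau μ}
    (h : ∀ x y, s.row x = s.row y → t.col x = t.col y → x = y) (x : Fin μ.card) :
    (s.row x, t.col x) ∈ μ := by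
  have hrow : Finset.card {y | t.col y < μ.rowLen (s.row x) ∧ s.row y = s.row x} =
      Finset.card {y | s.row y = s.row x} := by
    rw [card_col_lt_row_eq h]
    refine congrArg Finset.card (Finset.filter_congr fun y _ => and_iff_right_of_imp fun hy => ?_)
    exact hy ▸ YoungDiagram.mem_iff_lt_rowLen.1 (s.mk_row_col_mem y)
  simp only [and_comm (a := t.col _ < _), ← Finset.filter_filter] at hrow
  exact YoungDiagram.mem_iff_lt_rowLen.2 (Finset.card_filter_eq_iff.1 hrow x (by simp))

theorem exists_col_perm {t s : Tableau μ}
    (h : ∀ x y, s.row x = s.row y → t.col x = t.col y → x = y) :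
    ∃ σ : Equiv.Perm (Fin μ.card), (∀ x, t.col (σ x) = t.col x) ∧ Tabloid.mk (σ • t) =
      Tabloid.mk s := by
  choose φ hr hc using fun x => t.exists_row_col_eq (mk_row_col_mem_of_injective h x)
  have hφ : Function.Injective φ := fun x y hxy =>
    h x y (by rw [← hr x, ← hr y, hxy]) (by rw [← hc x, ← hc y, hxy])
  let e := Equiv.ofBijective φ (Finite.injective_iff_bijective.1 hφ)
  refine ⟨e⁻¹, fun x => ?_, Quotient.sound fun x => ?_⟩
  · obtain ⟨y, rfl⟩ := e.surjective x
    rw [Equiv.Perm.inv_def, Equiv.symm_apply_apply]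
    exact (hc y).symm
  · rw [row_smul, inv_inv]
    exact hr x

/-- The column stabilizer of a tableau. -/
def colStabilizer (t : Tableau μ) : Subgroup (Equiv.Perm (Fin μ.card)) where
  carrier := {σ | ∀ x, t.col (σ x) = t.col x}
  one_mem' _ := rfl
  mul_mem' hσ hτ x := (hσ _).trans (hτ x)
  inv_mem' {σ} hσ x := by simpa using (hσ (σ⁻¹ x)).symm

instance (t : Tableau μ) : DecidablePred (· ∈ t.colStabilizer) :=
  fun σ => inferInstanceAs (Decidable (∀ x, t.col (σ x) = t.col x))

theorem swap_mem_colStabilizer {t : Tableau μ} {x y : Fin μ.card} (h : t.col x = t.col y) :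
    Equiv.swap x y ∈ t.colStabilizer := fun z => by
  rw [Equiv.swap_apply_def]
  split_ifs with hx hy
  · rw [hx, h]
  · rw [hy, h]
  · rfl

theorem swap_smul_mk {s : Tableau μ} {x y : Fin μ.card} (h : s.row x = s.row y) :
    Equiv.swap x y • Tabloid.mk s = Tabloid.mk s := by
  rw [Tabloid.smul_mk]
  refine Quotient.sound fun z => ?_
  rw [Tableau.row_smul, Equiv.swap_inv, Equiv.swap_apply_def]
  split_ifs with hx hy
  · rw [hx, h]
  · rw [hy, h]
  · rfl

end Tableau

section Submodule

variable {F : Type u} [Field F] {μ : YoungDiagram}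

variable (F) in
/-- The signed column sum of a tableau. -/
def columnAntisymmetrizer (t : Tableau μ) : F[Tabloid μ] →ₗ[F] F[Tabloid μ] :=
  ∑ σ : t.colStabilizer, ((Equiv.Perm.sign σ.1 : ℤ) : F) • permModule F μ σ.1

theorem columnAntisymmetrizer_apply (t : Tableau μ) (u : F[Tabloid μ]) :
    columnAntisymmetrizer F t u =
      ∑ σ : t.colStabilizer, ((Equiv.Perm.sign σ.1 : ℤ) : F) • permModule F μ σ.1 u := by
  simp only [columnAntisymmetrizer, LinearMap.sum_apply, LinearMap.smul_apply]

theorem columnAntisymmetrizer_mk_self (t : Tableau μ) :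
    columnAntisymmetrizer F t (MonoidAlgebra.single (Tabloid.mk t) 1) = polytabloid F t := by
  rw [columnAntisymmetrizer_apply, polytabloid, ← Finset.sum_subtype _ (p := (· ∈ t.colStabilizer))
    (fun σ => Finset.mem_filter_univ σ) (fun σ => ((Equiv.Perm.sign σ : ℤ) : F) • permModule F μ σ
      (MonoidAlgebra.single (Tabloid.mk t) 1))]
  refine Finset.sum_congr rfl fun σ _ => ?_
  rw [Representation.ofMulAction_single, Tabloid.smul_mk, MonoidAlgebra.smul_single', mul_one]

theorem columnAntisymmetrizer_permModule (t : Tableau μ) (τ : t.colStabilizer)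
    (u : F[Tabloid μ]) : columnAntisymmetrizer F t (permModule F μ τ.1 u) =
      ((Equiv.Perm.sign τ.1 : ℤ) : F) • columnAntisymmetrizer F t u := by
  rw [columnAntisymmetrizer_apply, columnAntisymmetrizer_apply, Finset.smul_sum]
  refine Fintype.sum_equiv (Equiv.mulRight τ) _ _ fun π => ?_
  rw [Equiv.coe_mulRight, Subgroup.coe_mul, map_mul, map_mul, Module.End.mul_apply, smul_smul]
  congr 1
  rcases Int.units_eq_one_or (Equiv.Perm.sign τ.1) with h | h <;> simp [h]

theorem columnAntisymmetrizer_eq_zero {t s : Tableau μ} {x y : Fin μ.card} (hxy : x ≠ y)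
    (hrow : s.row x = s.row y) (hcol : t.col x = t.col y) :
    columnAntisymmetrizer F t (MonoidAlgebra.single (Tabloid.mk s) 1) = 0 := by
  let τ : t.colStabilizer := ⟨Equiv.swap x y, Tableau.swap_mem_colStabilizer hcol⟩
  have hτ : τ * τ = 1 := Subtype.ext (Equiv.swap_mul_self x y)
  rw [columnAntisymmetrizer_apply]
  refine Finset.sum_involution (fun π _ => π * τ) (fun π _ => ?_) (fun π _ _ h => hxy ?_)
    (fun π _ => Finset.mem_univ _) (fun π _ => by rw [mul_assoc, hτ, mul_one])
  · rw [Subgroup.coe_mul, map_mul, map_mul, Module.End.mul_apply, Equiv.Perm.sign_swap hxy,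
      Representation.ofMulAction_single (Equiv.swap x y), Tableau.swap_smul_mk hrow]
    simp
  · simpa [τ] using congrArg (fun π : t.colStabilizer => π.1 y) (mul_eq_left.1 h)

theorem exists_columnAntisymmetrizer_eq (t : Tableau μ) (u : F[Tabloid μ]) :
    ∃ c : F, columnAntisymmetrizer F t u = c • polytabloid F t := by
  simp only [eq_comm (a := columnAntisymmetrizer F t u), ← Submodule.mem_span_singleton]
  induction u using MonoidAlgebra.induction_linear with
  | zero => simp
  | add x y hx hy => exact map_add (columnAntisymmetrizer F t) x y ▸ add_mem hx hy
  | single T c =>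
    rw [← mul_one c, ← MonoidAlgebra.smul_single', map_smul]
    refine Submodule.smul_mem _ _ ?_
    induction T using Quotient.inductionOn with | _ s
    change columnAntisymmetrizer F t (MonoidAlgebra.single (Tabloid.mk s) 1) ∈ _
    by_cases h : ∀ x y, s.row x = s.row y → t.col x = t.col y → x = y
    · obtain ⟨σ, hσ, hs⟩ := Tableau.exists_col_perm h
      rw [← hs, ← Tabloid.smul_mk, ← Representation.ofMulAction_single,
        columnAntisymmetrizer_permModule t ⟨σ, hσ⟩, columnAntisymmetrizer_mk_self]
      exact Submodule.smul_mem _ _ (Submodule.mem_span_singleton_self _)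
    · push Not at h
      obtain ⟨x, y, hrow, hcol, hxy⟩ := h
      rw [columnAntisymmetrizer_eq_zero hxy hrow hcol]
      exact zero_mem _

variable (F μ) in
/-- The standard form on the permutation module, as a bilinear map. -/
def tabloidBilin : LinearMap.BilinForm F F[Tabloid μ] :=
  LinearMap.mk₂ F tabloidForm
    (fun a b c => by
      classical
      rw [tabloidForm, MonoidAlgebra.coeff_add,
        Finsupp.sum_add_index' (by simp) (by intros; ring)]
      rfl)
    (fun c a b => by
      rw [tabloidForm, MonoidAlgebra.coeff_smul, Finsupp.sum_smul_index (by simp)]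
      simp [tabloidForm, Finsupp.mul_sum, mul_assoc])
    (fun a b c => by simp [tabloidForm, mul_add, Finsupp.sum_add])
    fun c a b => by simp [tabloidForm, Finsupp.mul_sum, mul_left_comm]

theorem tabloidBilin_columnAntisymmetrizer (t : Tableau μ) (a b : F[Tabloid μ]) :
    tabloidBilin F μ (columnAntisymmetrizer F t a) b =
      tabloidBilin F μ a (columnAntisymmetrizer F t b) := by
  simp only [columnAntisymmetrizer_apply, LinearMap.sum_apply, map_sum, LinearMap.smul_apply,
    map_smul]
  refine Fintype.sum_equiv (Equiv.inv _) _ _ fun σ => ?_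
  rw [Equiv.inv_apply, Subgroup.coe_inv, Equiv.Perm.sign_inv]
  refine congrArg _ (?_ : tabloidForm _ b = tabloidForm a _)
  rw [tabloidForm_perm, inv_inv]

theorem eq_top_of_polytabloid_mem {U : Submodule F (specht F μ).toSubmodule}
    (hU : ∀ σ, ∀ x ∈ U, (specht F μ).toRepresentation σ x ∈ U) {t : Tableau μ}
    (ht : polytabloid F t ∈ U.map (specht F μ).toSubmodule.subtype) : U = ⊤ := by
  have hle : (specht F μ).toSubmodule ≤ U.map (specht F μ).toSubmodule.subtype := by
    refine Submodule.span_le.2 ?_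
    rintro _ ⟨s, rfl⟩
    obtain ⟨σ, rfl⟩ := t.exists_smul_eq s
    obtain ⟨y, hy, hyt⟩ := ht
    exact ⟨_, hU σ y hy, (congrArg (permModule F μ σ) hyt).trans (permModule_polytabloid F σ t)⟩
  exact eq_top_iff.2 fun y _ => by
    obtain ⟨z, hz, hzy⟩ := hle y.2
    exact Subtype.ext hzy ▸ hz

theorem eq_top_or_le_spechtRadical {U : Submodule F (specht F μ).toSubmodule}
    (hU : ∀ σ, ∀ x ∈ U, (specht F μ).toRepresentation σ x ∈ U) :
    U = ⊤ ∨ U ≤ spechtRadical F μ := by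
  by_cases h : ∀ x ∈ U, ∀ t, columnAntisymmetrizer F t (x : F[Tabloid μ]) = 0
  · refine Or.inr fun x hx y hy => ?_
    change y ∈ Submodule.span F (Set.range (polytabloid F (μ := μ))) at hy
    suffices hspan : Submodule.span F (Set.range (polytabloid F (μ := μ))) ≤
        LinearMap.ker ((tabloidBilin F μ).flip x) from hspan hy
    refine Submodule.span_le.2 ?_
    rintro _ ⟨t, rfl⟩
    change tabloidBilin F μ (polytabloid F t) x = 0
    rw [← columnAntisymmetrizer_mk_self, tabloidBilin_columnAntisymmetrizer, h x hx t, map_zero]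
  · push Not at h
    obtain ⟨x, hx, t, ht⟩ := h
    obtain ⟨c, hc⟩ := exists_columnAntisymmetrizer_eq t (x : F[Tabloid μ])
    have hmem : columnAntisymmetrizer F t (x : F[Tabloid μ]) ∈
        U.map (specht F μ).toSubmodule.subtype := by
      rw [columnAntisymmetrizer_apply]
      exact sum_mem fun σ _ => Submodule.smul_mem _ _ ⟨_, hU σ x hx, rfl⟩
    rw [hc] at hmem ht
    exact Or.inl (eq_top_of_polytabloid_mem hU
      ((Submodule.smul_mem_iff _ (left_ne_zero_of_smul ht)).1 hmem))

theorem dModule_eq_bot_or_eq_top (N : Subrepresentation (dModule F μ).rep) :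
    N = ⊥ ∨ N = ⊤ := by
  let q : (specht F μ).toSubmodule →ₗ[F] (dModule F μ).carrier := (spechtRadical F μ).mkQ
  have hq : Function.Surjective q := (spechtRadical F μ).mkQ_surjective
  rcases eq_top_or_le_spechtRadical (U := N.toSubmodule.comap q)
    (fun σ x hx => N.apply_mem_toSubmodule σ hx) with h | h
  · refine Or.inr (Subrepresentation.ext ?_)
    exact Submodule.comap_injective_of_surjective hq (h.trans (Submodule.comap_top q).symm)
  · refine Or.inl (Subrepresentation.ext (eq_bot_iff.2 fun x hx => ?_))
    obtain ⟨y, rfl⟩ := hq x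
    exact (Submodule.Quotient.mk_eq_zero _).2 (h hx)

variable (F μ) in
theorem isSemisimpleRepresentation_dModule :
    (dModule F μ).rep.IsSemisimpleRepresentation where
  exists_isCompl N := by
    rcases dModule_eq_bot_or_eq_top N with rfl | rfl
    exacts [⟨⊤, isCompl_bot_top⟩, ⟨⊥, isCompl_top_bot⟩]

end Submodule

/-! ### Removing a letter from a block -/

section Branching

theorem exists_viaEmbeddingHom_eq {α β : Type*} (κ : α ↪ β) {w : Equiv.Perm β}
    (hw : ∀ y ∉ Set.range κ, w y = y) : ∃ σ, Equiv.Perm.viaEmbeddingHom κ σ = w := by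
  have hrange (y) : w y ∈ Set.range κ ↔ y ∈ Set.range κ :=
    not_iff_not.1 ⟨fun hy => by rwa [← w.injective (hw _ hy)], fun hy => by rwa [hw y hy]⟩
  let e := Equiv.ofInjective κ κ.injective
  refine ⟨e.symm.permCongr (w.subtypePerm hrange), Equiv.ext fun y => ?_⟩
  rw [Equiv.Perm.viaEmbeddingHom_apply]
  by_cases hy : y ∈ Set.range κ
  · obtain ⟨x, rfl⟩ := hy
    rw [Equiv.Perm.viaEmbedding_apply]
    exact Equiv.apply_ofInjective_symm κ.injective _
  · rw [Equiv.Perm.viaEmbedding_apply_of_notMem _ _ _ hy, hw y hy]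

theorem last_notMem_range_castSuccEmb (n : ℕ) :
    Fin.last n ∉ Set.range (Fin.castSuccEmb : Fin n ↪ Fin (n + 1)) := by
  simp

theorem exists_viaEmbeddingHom_castSucc_eq {n : ℕ} {w : Equiv.Perm (Fin (n + 1))}
    (hw : w (Fin.last n) = Fin.last n) :
    ∃ σ, Equiv.Perm.viaEmbeddingHom Fin.castSuccEmb σ = w :=
  exists_viaEmbeddingHom_eq _ fun y hy => by
    induction y using Fin.lastCases with
    | last => exact hw
    | cast j => exact absurd ⟨j, rfl⟩ hy

variable {r n : ℕ} {d d' : Fin r → ℕ} (h : ∑ i, d i = n + 1) (h' : ∑ i, d' i = n)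

/-- The permutation `s` of the letters moves the letter `z` of the `k`-th block to the last
position, and moves the other blocks, which are those of shape `d'` embedded by `κ`, to consecutive
positions. -/
structure IsBranching (κ : ∀ i, Fin (d' i) ↪ Fin (d i)) (k : Fin r) (z : Fin (d k))
    (s : Equiv.Perm (Fin (n + 1))) : Prop where
  apply_youngEquiv : ∀ q : Σ i, Fin (d' i),
    s (youngEquiv d h ⟨q.1, κ q.1 q.2⟩) = (youngEquiv d' h' q).castSucc
  apply_removed : s (youngEquiv d h ⟨k, z⟩) = Fin.last n

theorem exists_isBranching (κ : ∀ i, Fin (d' i) ↪ Fin (d i)) {k : Fin r} {z : Fin (d k)}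
    (hz : z ∉ Set.range (κ k)) : ∃ s, IsBranching h h' κ k z s := by
  let f : (Σ i, Fin (d' i)) ↪ Σ i, Fin (d i) := (Function.Embedding.refl _).sigmaMap κ
  have hf : ⟨k, z⟩ ∉ Set.range f := by
    rintro ⟨⟨i, x⟩, hx⟩
    obtain rfl : i = k := congrArg Sigma.fst hx
    exact hz ⟨x, eq_of_heq (Sigma.mk.inj_iff.1 hx).2⟩
  let g := f.optionElim ⟨k, z⟩ hf
  have hg : Function.Bijective g := (Fintype.bijective_iff_injective_and_card _).2
    ⟨g.injective, by simp [h, h']⟩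
  let e := (Equiv.ofBijective g hg).symm
  have hsome (q : Σ i, Fin (d' i)) : e ⟨q.1, κ q.1 q.2⟩ = some q :=
    Equiv.ofBijective_symm_apply_apply g hg (some q)
  have hnone : e ⟨k, z⟩ = none := Equiv.ofBijective_symm_apply_apply g hg none
  exact ⟨(youngEquiv d h).symm.trans (e.trans
    ((Equiv.optionCongr (youngEquiv d' h')).trans finSuccEquivLast.symm)),
    fun q => by simp [hsome], by simp [hnone]⟩

/-- The embedding of `∏ S_{d' i}` in `∏ S_{d i}` induced by embeddings of the blocks. -/
def branchHom (κ : ∀ i, Fin (d' i) ↪ Fin (d i)) :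
    (∀ i, Equiv.Perm (Fin (d' i))) →* ∀ i, Equiv.Perm (Fin (d i)) where
  toFun σ i := Equiv.Perm.viaEmbeddingHom (κ i) (σ i)
  map_one' := funext fun _ => map_one _
  map_mul' _ _ := funext fun _ => map_mul _ _ _

variable {h h'}

namespace IsBranching

variable {κ : ∀ i, Fin (d' i) ↪ Fin (d i)} {k : Fin r} {z : Fin (d k)}
  {s : Equiv.Perm (Fin (n + 1))}

theorem eq_of_notMem_range (hs : IsBranching h h' κ k z s) {i : Fin r} {y : Fin (d i)}
    (hy : y ∉ Set.range (κ i)) : (⟨i, y⟩ : Σ i, Fin (d i)) = ⟨k, z⟩ := by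
  apply (youngEquiv d h).injective
  apply s.injective
  rw [hs.apply_removed]
  by_contra hne
  obtain ⟨j, hj⟩ := Fin.exists_castSucc_eq.2 hne
  obtain ⟨q, rfl⟩ := (youngEquiv d' h').surjective j
  rw [← hs.apply_youngEquiv] at hj
  obtain rfl | hq := (youngEquiv d h).injective (s.injective hj)
  exact hy ⟨q.2, rfl⟩

theorem mul_youngPerm (hs : IsBranching h h' κ k z s) (σ : ∀ i, Equiv.Perm (Fin (d' i))) :
    s * youngPerm d h (branchHom κ σ) =
      Equiv.Perm.viaEmbeddingHom Fin.castSuccEmb (youngPerm d' h' σ) * s := by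
  refine Equiv.ext fun j => ?_
  obtain ⟨⟨i, y⟩, rfl⟩ := (youngEquiv d h).surjective j
  rw [Equiv.Perm.mul_apply, Equiv.Perm.mul_apply, youngPerm_youngEquiv]
  by_cases hy : y ∈ Set.range (κ i)
  · obtain ⟨x, rfl⟩ := hy
    have hx : branchHom κ σ i (κ i x) = κ i (σ i x) := Equiv.Perm.viaEmbedding_apply _ _ _
    rw [hx, hs.apply_youngEquiv ⟨i, x⟩, hs.apply_youngEquiv ⟨i, σ i x⟩]
    refine Eq.trans ?_ (Equiv.Perm.viaEmbedding_apply _ Fin.castSuccEmb _).symm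
    rw [youngPerm_youngEquiv, Fin.coe_castSuccEmb]
  · have hfix : branchHom κ σ i y = y := Equiv.Perm.viaEmbedding_apply_of_notMem _ _ _ hy
    rw [hfix, hs.eq_of_notMem_range hy, hs.apply_removed]
    exact (Equiv.Perm.viaEmbedding_apply_of_notMem _ _ _ (last_notMem_range_castSuccEmb n)).symm

theorem mul_eq_mul_iff (hs : IsBranching h h' κ k z s) (τ : Equiv.Perm (Fin n))
    (σ : ∀ i, Equiv.Perm (Fin (d' i))) :
    Equiv.Perm.viaEmbeddingHom Fin.castSuccEmb τ * s = s * youngPerm d h (branchHom κ σ) ↔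
      τ = youngPerm d' h' σ := by
  rw [hs.mul_youngPerm, mul_left_inj, (Equiv.Perm.viaEmbeddingHom_injective _).eq_iff]

theorem youngColour_castSucc (hs : IsBranching h h' κ k z s) (j : Fin n) :
    youngColour d h (s.symm j.castSucc) = youngColour d' h' j := by
  obtain ⟨q, rfl⟩ := (youngEquiv d' h').surjective j
  rw [← hs.apply_youngEquiv, Equiv.symm_apply_apply, youngColour_youngEquiv, youngColour_youngEquiv]

theorem youngColour_last (hs : IsBranching h h' κ k z s) :
    youngColour d h (s.symm (Fin.last n)) = k := by
  rw [← hs.apply_removed, Equiv.symm_apply_apply, youngColour_youngEquiv]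

theorem mem_range_branchHom (hs : IsBranching h h' κ k z s) {w : ∀ i, Equiv.Perm (Fin (d i))}
    (hw : w k z = z) : w ∈ (branchHom κ).range := by
  have hfix (i) (y) (hy : y ∉ Set.range (κ i)) : w i y = y := by
    obtain ⟨rfl, hyz⟩ := Sigma.mk.inj_iff.1 (hs.eq_of_notMem_range hy)
    rwa [eq_of_heq hyz]
  choose σ hσ using fun i => exists_viaEmbeddingHom_eq (κ i) (hfix i)
  exact ⟨σ, funext hσ⟩

theorem exists_eq_mul (hs : IsBranching h h' κ k z s) {w : Equiv.Perm (Fin (n + 1))} {y : Fin (d k)}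
    (hw : w (youngEquiv d h ⟨k, y⟩) = Fin.last n) :
    ∃ τ w', w = Equiv.Perm.viaEmbeddingHom Fin.castSuccEmb τ * s * youngPerm d h w' := by
  let w' : ∀ i, Equiv.Perm (Fin (d i)) := Pi.mulSingle k (Equiv.swap z y)
  have hw' : (youngPerm d h w')⁻¹ (youngEquiv d h ⟨k, z⟩) = youngEquiv d h ⟨k, y⟩ := by
    rw [Equiv.Perm.inv_def, Equiv.symm_apply_eq, youngPerm_youngEquiv]
    simp [w']
  obtain ⟨τ, hτ⟩ := exists_viaEmbeddingHom_castSucc_eq (w := w * (youngPerm d h w')⁻¹ * s⁻¹) (by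
    rw [Equiv.Perm.mul_apply, Equiv.Perm.mul_apply, ← hs.apply_removed, Equiv.Perm.inv_def s,
      Equiv.symm_apply_apply, hw', hw, hs.apply_removed])
  exact ⟨τ, w', by rw [hτ, inv_mul_cancel_right, inv_mul_cancel_right]⟩

theorem eq_and_mem_range {d'' : Fin r → ℕ} {h'' : ∑ i, d'' i = n}
    {κ' : ∀ i, Fin (d'' i) ↪ Fin (d i)} {l : Fin r} {y : Fin (d l)} {s' : Equiv.Perm (Fin (n + 1))}
    (hs : IsBranching h h' κ k z s) (hs' : IsBranching h h'' κ' l y s') (hz : (z : ℕ) + 1 = d k)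
    (hy : (y : ℕ) + 1 = d l) {τ : Equiv.Perm (Fin n)} {w : ∀ i, Equiv.Perm (Fin (d i))}
    (hw : Equiv.Perm.viaEmbeddingHom Fin.castSuccEmb τ * s' = s * youngPerm d h w) :
    k = l ∧ w ∈ (branchHom κ).range := by
  have hlast : Fin.last n = s (youngEquiv d h ⟨l, w l y⟩) := by
    rw [← youngPerm_youngEquiv h w ⟨l, y⟩, ← Equiv.Perm.mul_apply, ← hw, Equiv.Perm.mul_apply,
      hs'.apply_removed]
    exact (Equiv.Perm.viaEmbedding_apply_of_notMem τ _ _ (last_notMem_range_castSuccEmb n)).symm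
  obtain ⟨rfl, hzy⟩ := Sigma.mk.inj_iff.1
    ((youngEquiv d h).injective (s.injective (hs.apply_removed.trans hlast)))
  obtain rfl : z = y := Fin.ext (by omega)
  exact ⟨rfl, hs.mem_range_branchHom (eq_of_heq hzy).symm⟩

end IsBranching

end Branching

/-! ### Socles of restrictions -/

section Socle

variable {F : Type*} [Field F] {Γ W W' : Type*} [Group Γ] [AddCommGroup W] [Module F W]
  [AddCommGroup W'] [Module F W'] {τ : Representation F Γ W} {τ' : Representation F Γ W'}

theorem nonempty_equiv_of_linearEquiv (e : τ.asModule ≃ₗ[F[Γ]] τ'.asModule) :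
    Nonempty (τ.Equiv τ') :=
  ⟨Representation.IntertwiningMap.ofBijective
    ((Representation.IntertwiningMap.equivLinearMapAsModule τ τ').symm e.toLinearMap) e.bijective⟩

theorem range_equivLinearMapAsModule_eq_moduleSocle {φ : τ.IntertwiningMap τ'}
    (hφ : φ.range = socle τ') :
    LinearMap.range (Representation.IntertwiningMap.equivLinearMapAsModule τ τ' φ) =
      moduleSocle F[Γ] τ'.asModule :=
  SetLike.ext fun x => SetLike.ext_iff.1 hφ x

theorem range_subrepresentationSubtype (U : Subrepresentation τ) :
    (subrepresentationSubtype U).range = U :=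
  SetLike.ext fun x => by
    rw [Representation.IntertwiningMap.mem_range]
    exact ⟨fun ⟨y, hy⟩ => hy ▸ y.2, fun hx => ⟨⟨x, hx⟩, rfl⟩⟩

theorem nonempty_socle_equiv (e : moduleSocle F[Γ] τ.asModule ≃ₗ[F[Γ]] τ'.asModule) :
    Nonempty ((socle τ).toRepresentation.Equiv τ') := by
  have e' := LinearEquiv.ofInjective (Representation.IntertwiningMap.equivLinearMapAsModule _ _
    (subrepresentationSubtype (socle τ))) Subtype.val_injective
  rw [range_equivLinearMapAsModule_eq_moduleSocle (range_subrepresentationSubtype _)] at e'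
  exact nonempty_equiv_of_linearEquiv (e'.trans e)

theorem isSemisimpleModule_of_range_eq_moduleSocle {A X Y : Type*} [Ring A] [AddCommGroup X]
    [Module A X] [AddCommGroup Y] [Module A Y] {φ : Y →ₗ[A] X} (hφ : Function.Injective φ)
    (h : LinearMap.range φ = moduleSocle A X) : IsSemisimpleModule A Y := by
  have e := LinearEquiv.ofInjective φ hφ
  rw [h] at e
  have : IsSemisimpleModule A (moduleSocle A X) := by
    rw [moduleSocle, sSup_eq_iSup]
    exact isSemisimpleModule_biSup_of_isSemisimpleModule_submodule
      fun N (hN : IsSimpleModule A N) => inferInstance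
  exact IsSemisimpleModule.congr e

theorem socle_eq_top (hτ : τ.IsSemisimpleRepresentation) : socle τ = ⊤ := by
  rw [Representation.isSemisimpleRepresentation_iff_isSemisimpleModule_asModule] at hτ
  have htop := IsSemisimpleModule.sSup_simples_eq_top F[Γ] τ.asModule
  exact SetLike.ext fun x => SetLike.ext_iff.1 htop x

end Socle

theorem viaEmbeddingHom_refl (α : Type*) :
    Equiv.Perm.viaEmbeddingHom (Function.Embedding.refl α) = MonoidHom.id (Equiv.Perm α) :=
  MonoidHom.ext fun σ => Equiv.ext fun x =>
    Equiv.Perm.viaEmbedding_apply σ (Function.Embedding.refl α) x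

theorem exists_socFamily_intertwiningMap {F : Type u} [Field F] {r : ℕ} (L : Fin r → SymRep F)
    (hL : ∀ i, (L i).rep.IsSemisimpleRepresentation) (k i : Fin r) :
    ∃ (κ : Fin (socFamily L k i).deg ↪ Fin (L i).deg)
      (φ : (socFamily L k i).rep.IntertwiningMap
        ((L i).rep.comp (Equiv.Perm.viaEmbeddingHom κ) : Representation F _ _)),
      Function.Injective φ ∧
      φ.range = socle ((L i).rep.comp (Equiv.Perm.viaEmbeddingHom κ)) ∧
      (i = k → ∀ x : Fin (L i).deg, (x : ℕ) + 1 = (L i).deg → x ∉ Set.range κ) := by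
  obtain rfl | hi := eq_or_ne i k
  · rw [socFamily, Function.update_self]
    refine ⟨Fin.castLEEmb (Nat.sub_le _ 1), subrepresentationSubtype (socle _),
      Subtype.val_injective, range_subrepresentationSubtype _, ?_⟩
    rintro - x hx ⟨y, rfl⟩
    exact y.2.ne (Nat.eq_sub_of_add_eq hx)
  · rw [socFamily, Function.update_of_ne hi]
    refine ⟨Function.Embedding.refl _, ?_⟩
    rw [viaEmbeddingHom_refl, MonoidHom.comp_id]
    refine ⟨Representation.IntertwiningMap.id _, Function.injective_id, ?_, fun h => absurd h hi⟩
    rw [socle_eq_top (hL i)]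
    exact SetLike.ext fun x => ⟨fun _ => Submodule.mem_top, fun _ => ⟨x, rfl⟩⟩

/-! ### The restriction to `G_{n-1,1}` -/

section LastHom

variable {G : Type v} [Group G] {n : ℕ}

theorem lastHom_right (x : Wreath G (Fin n) × G) :
    (Wreath.lastHom n x).right = Equiv.Perm.viaEmbeddingHom Fin.castSuccEmb x.1.right := rfl

theorem lastHom_left_castSucc (x : Wreath G (Fin n) × G) (j : Fin n) :
    (Wreath.lastHom n x).left j.castSucc = x.1.left j := Fin.snoc_castSucc (α := fun _ => G) _ _ _

theorem lastHom_left_last (x : Wreath G (Fin n) × G) :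
    (Wreath.lastHom n x).left (Fin.last n) = x.2 := Fin.snoc_last (α := fun _ => G) _ _

theorem lastHom_inr (τ : Equiv.Perm (Fin n)) :
    Wreath.lastHom (G := G) n (SemidirectProduct.inr τ, 1) =
      SemidirectProduct.inr (Equiv.Perm.viaEmbeddingHom Fin.castSuccEmb τ) :=
  SemidirectProduct.ext (funext fun j =>
    Fin.lastCases (lastHom_left_last _) (fun j => lastHom_left_castSucc _ j) j) rfl

variable (G n) in
/-- The base group `G^{n+1}` as a subgroup of `G_{n,1} ≅ G_n × G`. -/
def lastBase : (Fin (n + 1) → G) →* Wreath G (Fin n) × G where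
  toFun g := (SemidirectProduct.inl (Fin.init g), g (Fin.last n))
  map_one' := rfl
  map_mul' g g' := Prod.ext (map_mul SemidirectProduct.inl (Fin.init g) (Fin.init g')) rfl

theorem lastHom_comp_lastBase :
    (Wreath.lastHom n).comp (lastBase G n) = SemidirectProduct.inl :=
  MonoidHom.ext fun g => SemidirectProduct.ext (Fin.snoc_init_self (α := fun _ => G) g)
    (map_one (Equiv.Perm.viaEmbeddingHom (Fin.castSuccEmb (n := n))))

theorem mapDomainAlgHom_lastBase_pureElement {F : Type u} [Field F] [Finite G]
    (a : Fin (n + 1) → F[G]) :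
    MonoidAlgebra.mapDomainAlgHom F F (lastBase G n) (pureElement a) =
      MonoidAlgebra.tensorEquiv F (MonoidAlgebra.mapDomainAlgHom F F SemidirectProduct.inl
        (pureElement fun j => a j.castSucc) ⊗ₜ a (Fin.last n)) := by
  let tmul : F[Fin n → G] →ₗ[F] F[G] →ₗ[F] F[Wreath G (Fin n) × G] :=
    ((TensorProduct.mk F _ _).comp (MonoidAlgebra.mapDomainAlgHom F F
      SemidirectProduct.inl).toLinearMap).compr₂ (MonoidAlgebra.tensorEquiv F).toLinearMap
  have h : (MonoidAlgebra.mapDomainAlgHom F F (lastBase G n)).toLinearMap.compMultilinearMap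
      pureElement = (tmul.compMultilinearMap pureElement).uncurryRight := by
    refine multilinearMap_ext_single fun g => ?_
    change MonoidAlgebra.mapDomainAlgHom F F (lastBase G n) (pureElement _) =
      MonoidAlgebra.tensorEquiv F (MonoidAlgebra.mapDomainAlgHom F F SemidirectProduct.inl
        (pureElement fun j => .single (g j.castSucc) 1) ⊗ₜ .single (g (Fin.last n)) 1)
    rw [pureElement_single, pureElement_single]
    simp only [lastBase, MonoidAlgebra.mapDomainAlgHom_apply, MonoidHom.coe_mk,
      MonoidAlgebra.mapDomain_single, MonoidAlgebra.tensorEquiv_single_tmul_single, mul_one]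
    rfl
  exact congrArg (· a) h

variable {r : ℕ}

theorem isMackeySystem_lastHom {d : Fin r → ℕ} (h : ∑ i, d i = n + 1)
    {d' : {k : Fin r // 0 < d k} → Fin r → ℕ} {h' : ∀ k, ∑ i, d' k i = n}
    {κ : ∀ k i, Fin (d' k i) ↪ Fin (d i)} {z : ∀ k : {k : Fin r // 0 < d k}, Fin (d k)}
    {s : {k : Fin r // 0 < d k} → Equiv.Perm (Fin (n + 1))} (hz : ∀ k, (z k : ℕ) + 1 = d k)
    (hs : ∀ k, IsBranching h (h' k) (κ k) k (z k) (s k)) :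
    IsMackeySystem h (Wreath.lastHom (G := G) n) s fun k => branchHom (κ k) where
  eq_and_mem_range k l γ w hw := by
    obtain ⟨hkl, hw'⟩ := (hs k).eq_and_mem_range (hs l) (hz k) (hz l) hw
    exact ⟨Subtype.ext hkl, hw'⟩
  exists_apply_eq k σ := by
    refine ⟨(SemidirectProduct.inr (youngPerm _ (h' k) σ), 1), ?_⟩
    rw [lastHom_inr, (hs k).mul_youngPerm, mul_inv_cancel_right]
  exists_eq_mul w := by
    obtain ⟨⟨k, y⟩, hy⟩ := (youngEquiv d h).surjective (w⁻¹ (Fin.last n))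
    have hw : w (youngEquiv d h ⟨k, y⟩) = Fin.last n := by
      rw [hy, Equiv.Perm.inv_def, Equiv.apply_symm_apply]
    obtain ⟨τ, w', hw'⟩ := (hs ⟨k, y.pos⟩).exists_eq_mul hw
    exact ⟨⟨k, y.pos⟩, (SemidirectProduct.inr τ, 1), _, w', lastHom_inr τ, hw'⟩

theorem isMackeySystem_id {d : Fin r → ℕ} (h : ∑ i, d i = n) :
    IsMackeySystem h (MonoidHom.id (Wreath G (Fin n))) (fun _ : Unit => 1)
      fun _ => MonoidHom.id _ where
  eq_and_mem_range _ _ _ w _ := ⟨rfl, w, rfl⟩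
  exists_apply_eq _ σ := ⟨SemidirectProduct.inr (youngPerm d h σ), by simp⟩
  exists_eq_mul w := ⟨(), SemidirectProduct.inr w, w, 1, rfl, by simp⟩

end LastHom

section Compress

variable {F : Type u} [Field F] {G : Type v} [Group G] {r : ℕ} {V : Fin r → Type w}
  [∀ i, AddCommGroup (V i)] [∀ i, Module F (V i)] {n : ℕ} {d : Fin r → ℕ}

open scoped Classical in
/-- The compression of the action of `γ ∈ G_n` on the induced module to the multiplicity space: it
is zero unless `γ` lies in `∏ G_{d i}`. -/
def wreathCompress (ρ : ∀ i, Representation F G (V i)) (v : ∀ i, V i)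
    (f : ∀ i, Module.Dual F (V i)) (h : ∑ i, d i = n) (γ : Wreath G (Fin n)) :
    F[∀ i, Equiv.Perm (Fin (d i))] :=
  if hσ : ∃ σ, γ.right = youngPerm d h σ then
    MonoidAlgebra.single hσ.choose (∏ j, f (youngColour d h j)
      (ρ _ (γ.left j) (v (youngColour d h j)))) else 0

variable {ρ : ∀ i, Representation F G (V i)} {v : ∀ i, V i} {f : ∀ i, Module.Dual F (V i)}
  {h : ∑ i, d i = n}

theorem wreathCompress_of_eq {γ : Wreath G (Fin n)} {σ : ∀ i, Equiv.Perm (Fin (d i))}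
    (hσ : γ.right = youngPerm d h σ) :
    wreathCompress ρ v f h γ = MonoidAlgebra.single σ (∏ j, f (youngColour d h j)
      (ρ _ (γ.left j) (v (youngColour d h j)))) := by
  have hex : ∃ σ, γ.right = youngPerm d h σ := ⟨σ, hσ⟩
  have hchoose : hex.choose = σ := youngPerm_injective h (hex.choose_spec.symm.trans hσ)
  rw [wreathCompress, dif_pos hex, hchoose]

theorem wreathCompress_of_ne {γ : Wreath G (Fin n)} (hσ : ∀ σ, γ.right ≠ youngPerm d h σ) :
    wreathCompress ρ v f h γ = 0 :=
  dif_neg (not_exists.2 hσ)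

theorem exists_wreathCompress_eq (hf : ∀ i, f i (v i) = 1) (h : ∑ i, d i = n)
    (σ : ∀ i, Equiv.Perm (Fin (d i))) : ∃ γ, wreathCompress ρ v f h γ = .single σ 1 := by
  refine ⟨SemidirectProduct.inr (youngPerm d h σ), ?_⟩
  rw [wreathCompress_of_eq (σ := σ) rfl]
  simp [hf]

theorem IsBranching.smul_wreathCompress {d' : Fin r → ℕ} {h : ∑ i, d i = n + 1}
    {h' : ∑ i, d' i = n} {κ : ∀ i, Fin (d' i) ↪ Fin (d i)} {k : Fin r} {z : Fin (d k)}
    {s : Equiv.Perm (Fin (n + 1))} (hs : IsBranching h h' κ k z s) {x : Wreath G (Fin n) × G}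
    {σ : ∀ i, Equiv.Perm (Fin (d' i))}
    (hσ : (Wreath.lastHom n x).right * s = s * youngPerm d h (branchHom κ σ)) :
    f k (ρ k x.2 (v k)) • wreathCompress ρ v f h' x.1 =
      MonoidAlgebra.single σ (∏ j, f (youngColour d h (s.symm j))
        (ρ _ ((Wreath.lastHom n x).left j) (v (youngColour d h (s.symm j))))) := by
  rw [lastHom_right, hs.mul_eq_mul_iff] at hσ
  have hcolour (c c') (g : G) (hc : c = c') : f c (ρ c g (v c)) = f c' (ρ c' g (v c')) := by
    rw [hc]
  rw [wreathCompress_of_eq hσ, MonoidAlgebra.smul_single', Fin.prod_univ_castSucc, mul_comm,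
    lastHom_left_last, hcolour _ _ _ hs.youngColour_last]
  congr 2
  refine Finset.prod_congr rfl fun j _ => ?_
  rw [lastHom_left_castSucc, hcolour _ _ _ (hs.youngColour_castSucc j)]

end Compress

section BranchCorner

variable {F : Type u} [Field F] {G : Type v} [Group G] [Finite G] {r : ℕ} {V : Fin r → Type w}
  [∀ i, AddCommGroup (V i)] [∀ i, Module F (V i)] {ρ : ∀ i, Representation F G (V i)}
  {ε : Fin r → F[G]} {v : ∀ i, V i} {f : ∀ i, Module.Dual F (V i)}

theorem IsRankOneSystem.isModuleCorner_wreathInd (H : IsRankOneSystem ρ ε v f)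
    (L : Fin r → SymRep F) {n : ℕ} (h : ∑ i, (L i).deg = n) :
    IsModuleCorner (K := Unit)
      (fun _ => MonoidAlgebra.mapDomainAlgHom F F SemidirectProduct.inl
        (colourElement ε (youngColour _ h)))
      (fun _ => groupAlgebraLift (wreathCompress ρ v f h))
      (X := (wreathInd ρ L h).asModule)
      (Y := fun _ => (outerPiTensor fun i => (L i).rep).asModule)
      (fun _ => (wreathCornerEmb ρ L h v 1).toAddMonoidHom) :=
  (isMackeySystem_id h).isModuleCorner h rfl H (fun _ => wreathCompress ρ v f h)
    (fun _ _ _ hσ => wreathCompress_of_eq (by simpa using hσ))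
    (fun _ _ hσ => wreathCompress_of_ne (by simpa using hσ))

theorem IsRankOneSystem.isModuleCorner_wreathInd_comp_lastHom (H : IsRankOneSystem ρ ε v f)
    (L : Fin r → SymRep F) {n : ℕ} (h : ∑ i, (L i).deg = n + 1)
    {d' : {k : Fin r // 0 < (L k).deg} → Fin r → ℕ} (h' : ∀ k, ∑ i, d' k i = n)
    {κ : ∀ k i, Fin (d' k i) ↪ Fin (L i).deg} {z : ∀ k : {k // 0 < (L k).deg}, Fin (L k).deg}
    {s : {k : Fin r // 0 < (L k).deg} → Equiv.Perm (Fin (n + 1))}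
    (hz : ∀ k, (z k : ℕ) + 1 = (L k).deg)
    (hs : ∀ k, IsBranching h (h' k) (κ k) k (z k) (s k)) :
    IsModuleCorner
      (fun k => MonoidAlgebra.tensorEquiv F (MonoidAlgebra.mapDomainAlgHom F F
        SemidirectProduct.inl (colourElement ε (youngColour _ (h' k))) ⊗ₜ ε k))
      (fun k => groupAlgebraLift fun x : Wreath G (Fin n) × G =>
        f k (ρ k x.2 (v k)) • wreathCompress ρ v f (h' k) x.1)
      (X := Representation.asModule ((wreathInd ρ L h).comp (Wreath.lastHom n) :
        Representation F (Wreath G (Fin n) × G) _))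
      (Y := fun k => (outerPiTensor fun i => ((L i).rep.comp
        (Equiv.Perm.viaEmbeddingHom (κ k i)) : Representation F _ _)).asModule)
      (fun k => (wreathCornerEmb ρ L h v (s k)).toAddMonoidHom) := by
  have he (k) : MonoidAlgebra.mapDomainAlgHom F F (lastBase G n)
        (colourElement ε (youngColour _ h ∘ (s k).symm)) =
      MonoidAlgebra.tensorEquiv F (MonoidAlgebra.mapDomainAlgHom F F
        SemidirectProduct.inl (colourElement ε (youngColour _ (h' k))) ⊗ₜ ε k) := by
    simp only [colourElement, mapDomainAlgHom_lastBase_pureElement, Function.comp_apply,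
      (hs k).youngColour_castSucc, (hs k).youngColour_last]
  simp only [← he]
  refine (isMackeySystem_lastHom h hz hs).isModuleCorner h lastHom_comp_lastBase H
    (fun k x => f k (ρ k x.2 (v k)) • wreathCompress ρ v f (h' k) x.1)
    (fun k _ _ hσ => (hs k).smul_wreathCompress hσ) fun k x hσ => ?_
  change f k (ρ k x.2 (v k)) • wreathCompress ρ v f (h' k) x.1 = 0
  rw [wreathCompress_of_ne fun σ hσ' => hσ σ ?_, smul_zero]
  rwa [lastHom_right, (hs k).mul_eq_mul_iff]

theorem IsRankOneSystem.exists_isModuleCorner_directSum (H : IsRankOneSystem ρ ε v f)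
    {K : Type*} [Finite K] {c : K → Fin r} (hc : Function.Injective c)
    (L : K → Fin r → SymRep F) {n : ℕ} (h : ∀ k, ∑ i, (L k i).deg = n) :
    ∃ ι, IsModuleCorner
      (fun k => MonoidAlgebra.tensorEquiv F (MonoidAlgebra.mapDomainAlgHom F F
        SemidirectProduct.inl (colourElement ε (youngColour _ (h k))) ⊗ₜ ε (c k)))
      (fun k => groupAlgebraLift fun x : Wreath G (Fin n) × G =>
        f (c k) (ρ (c k) x.2 (v (c k))) • wreathCompress ρ v f (h k) x.1)
      (X := Representation.asModule (Representation.directSum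
        fun k => outerTensor (wreathInd ρ (L k) (h k)) (ρ (c k))))
      (Y := fun k => Representation.asModule (outerPiTensor fun i => (L k i).rep)) ι := by
  classical
  choose u hu hu1 using H.exists_asAlgebraHom_eq_one
  refine ⟨_, IsModuleCorner.directSum _ (fun k =>
    (H.isModuleCorner_wreathInd (L k) (h k)).outerTensor
      (exists_wreathCompress_eq H.dual_apply (h k)) (H.dual_apply (c k))
      (H.asAlgebraHom_apply (c k)) (hu (c k)) (hu1 (c k))) fun k l hkl => ?_⟩
  rw [asAlgebraHom_outerTensor_tensorEquiv_tmul, H.asAlgebraHom_of_ne _ _ (hc.ne hkl.symm),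
    TensorProduct.map_zero_right]

end BranchCorner

section Main

variable {F : Type u} [Field F] [IsAlgClosed F] {r : ℕ}

theorem exists_intertwiningMap_range_eq_socle (L : Fin r → SymRep F)
    (hL : ∀ i, (L i).rep.IsSemisimpleRepresentation) (k : Fin r) :
    ∃ (κ : ∀ i, Fin (socFamily L k i).deg ↪ Fin (L i).deg)
      (φ : (outerPiTensor fun i => (socFamily L k i).rep).IntertwiningMap
        (outerPiTensor fun i =>
          ((L i).rep.comp (Equiv.Perm.viaEmbeddingHom (κ i)) : Representation F _ _))),
      Function.Injective φ ∧ φ.range = socle (outerPiTensor fun i =>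
        ((L i).rep.comp (Equiv.Perm.viaEmbeddingHom (κ i)) : Representation F _ _)) ∧
      ∀ x : Fin (L k).deg, (x : ℕ) + 1 = (L k).deg → x ∉ Set.range (κ k) := by
  choose κ φ hφ hsoc hκ using exists_socFamily_intertwiningMap L hL k
  exact ⟨κ, outerPiMap φ, piTensorMap_injective (fun i => (φ i).toLinearMap) hφ,
    range_outerPiMap_eq_socle φ hφ hsoc, hκ k rfl⟩

variable {G : Type v} [Group G] [Finite G] {V : Fin r → Type w}
  [∀ i, AddCommGroup (V i)] [∀ i, Module F (V i)] {ρ : ∀ i, Representation F G (V i)}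
  {ε : Fin r → F[G]} {v : ∀ i, V i} {f : ∀ i, Module.Dual F (V i)}

theorem IsRankOneSystem.isSemisimpleRepresentation_wreathInd_socFamily
    (H : IsRankOneSystem ρ ε v f) (L : Fin r → SymRep F)
    (hL : ∀ i, (L i).rep.IsSemisimpleRepresentation) (k : Fin r) {n : ℕ}
    (h : ∑ i, (socFamily L k i).deg = n) :
    (wreathInd ρ (socFamily L k) h).IsSemisimpleRepresentation := by
  obtain ⟨κ, φ, hφ, hsoc, -⟩ := exists_intertwiningMap_range_eq_socle L hL k
  have hrange := range_equivLinearMapAsModule_eq_moduleSocle hsoc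
  rw [Representation.isSemisimpleRepresentation_iff_isSemisimpleModule_asModule]
  exact (H.isModuleCorner_wreathInd (socFamily L k) h).isSemisimpleModule fun _ =>
    isSemisimpleModule_of_range_eq_moduleSocle hφ hrange

theorem IsRankOneSystem.nonempty_socle_wreathInd_comp_lastHom_equiv
    (H : IsRankOneSystem ρ ε v f) (L : Fin r → SymRep F)
    (hL : ∀ i, (L i).rep.IsSemisimpleRepresentation) {n : ℕ} (h : ∑ i, (L i).deg = n + 1) :
    Nonempty ((socle ((wreathInd ρ L h).comp (Wreath.lastHom n))).toRepresentation.Equiv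
      (Representation.directSum fun k : {k : Fin r // 0 < (L k).deg} =>
        outerTensor (wreathInd ρ (socFamily L k.1) (sum_deg_socFamily L h k.1 k.2)) (ρ k.1))) := by
  choose κ φ hφ hsoc hκ using fun k : {k : Fin r // 0 < (L k).deg} =>
    exists_intertwiningMap_range_eq_socle L hL k
  let z (k : {k : Fin r // 0 < (L k).deg}) : Fin (L k).deg :=
    ⟨(L k).deg - 1, Nat.sub_lt k.2 one_pos⟩
  have hz (k) : (z k : ℕ) + 1 = (L k).deg := Nat.sub_add_cancel k.2
  have h' (k : {k : Fin r // 0 < (L k).deg}) := sum_deg_socFamily L h k.1 k.2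
  choose s hs using fun k => exists_isBranching h (h' k) (κ k) (hκ k (z k) (hz k))
  obtain ⟨ι, hι⟩ := H.exists_isModuleCorner_directSum Subtype.val_injective
    (fun k : {k : Fin r // 0 < (L k).deg} => socFamily L k) h'
  obtain ⟨e⟩ := (H.isModuleCorner_wreathInd_comp_lastHom L h h' hz hs
    ).nonempty_moduleSocle_linearEquiv (fun k =>
      Representation.IntertwiningMap.equivLinearMapAsModule _ _ (φ k)) hφ
      (fun k => range_equivLinearMapAsModule_eq_moduleSocle (hsoc k)) hι
  exact nonempty_socle_equiv e

end Main

theorem mainTheorem8_general {F : Type u} [Field F] [IsAlgClosed F]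
    {G : Type v} [Group G] [Finite G] {r : ℕ} {V : Fin r → Type w}
    [∀ i, AddCommGroup (V i)] [∀ i, Module F (V i)] (ρ : ∀ i, Representation F G (V i))
    (hirr : ∀ i, (ρ i).IsIrreducible)
    (hne : Pairwise fun i j => IsEmpty ((ρ i).Equiv (ρ j)))
    (L : Fin r → SymRep F) (hL : ∀ i, (L i).rep.IsSemisimpleRepresentation)
    (n : ℕ) (h : ∑ i, (L i).deg = n + 1) :
    (∀ (k : Fin r) (hk : 0 < (L k).deg),
      (wreathInd ρ (socFamily L k) (sum_deg_socFamily L h k hk)).IsSemisimpleRepresentation) ∧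
    Nonempty ((socle ((wreathInd ρ L h).comp (Wreath.lastHom n))).toRepresentation.Equiv
      (Representation.directSum fun k : {k : Fin r // 0 < (L k).deg} =>
        outerTensor (wreathInd ρ (socFamily L k.1) (sum_deg_socFamily L h k.1 k.2))
          (ρ k.1))) := by
  have hfin (i : Fin r) : FiniteDimensional F (V i) :=
    have := hirr i
    finiteDimensional_of_isIrreducible (ρ i)
  obtain ⟨ε, v, f, H⟩ := exists_isRankOneSystem ρ hirr hne
  exact ⟨fun k hk => H.isSemisimpleRepresentation_wreathInd_socFamily L hL k _,
    H.nonempty_socle_wreathInd_comp_lastHom_equiv L hL h⟩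

end

theorem mainTheorem8 {F : Type u} [Field F] [IsAlgClosed F] (p : ℕ) [CharP F p]
    {G : Type v} [Group G] [Finite G] {r : ℕ} {V : Fin r → Type w}
    [∀ i, AddCommGroup (V i)] [∀ i, Module F (V i)] (ρ : ∀ i, Representation F G (V i))
    (hirr : ∀ i, (ρ i).IsIrreducible)
    (hne : Pairwise fun i j => IsEmpty ((ρ i).Equiv (ρ j)))
    (μ : Fin r → YoungDiagram) (hμ : ∀ i, IsPRegular p (μ i))
    (n : ℕ) (hn : ∑ i, (μ i).card = n + 1) :
    (∀ (k : Fin r) (hk : 0 < (μ k).card),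
      (wreathInd ρ (socFamily (fun i => dModule F (μ i)) k)
        (sum_deg_socFamily (fun i => dModule F (μ i)) hn k hk)).IsSemisimpleRepresentation) ∧
    Nonempty
      ((socle ((wreathInd ρ (fun i => dModule F (μ i)) hn).comp
          (Wreath.lastHom n))).toRepresentation.Equiv
        (Representation.directSum fun k : {k : Fin r // 0 < (μ k).card} =>
          outerTensor
            (wreathInd ρ (socFamily (fun i => dModule F (μ i)) k.1)
              (sum_deg_socFamily (fun i => dModule F (μ i)) hn k.1 k.2))
            (ρ k.1))) := by
  exact mainTheorem8_general ρ hirr hne (fun i => dModule F (μ i))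
    (fun i => isSemisimpleRepresentation_dModule F (μ i)) n hn
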